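/- For $\kappa\in\{0,1,-1\}$ let $M_\kappa$ be $\mathbb R^3$, $S^3$ or hyperbolic space $H^3$, respectively, and let $\mathcal G_\kappa$ be the four-dimensional manifold of oriented complete geodesics $[\gamma]$ of $M_\kappa$ ($\gamma$ of unit speed, up to translation of the parameter). The tangent space $T_{[\gamma]}\mathcal G_\kappa$ is identified with the space of Jacobi fields along $\gamma$ orthogonal to $\gamma'$, by sending the velocity of a smooth curve $s\mapsto[\gamma_s]$, $\gamma_0=\gamma$, to the component orthogonal to $\gamma'$ of $\frac{d}{ds}\big|_0\gamma_s$. Let $\mathcal J(J)=\gamma'\times J$ be the complex structure, $g_\times(I,J)=\frac12\langle I\times J'+J\times I',\gamma'\rangle$ the pseudo-Riemannian metric induced by the cross product, and $\omega_\times(I,J)=g_\times(\mathcal J I,J)$ the fundamental symplectic form of the Kähler structure $(g_\times,\mathcal J)$. Let $S\subset M_\kappa$ be a compact connected smooth embedded surface which is quadratically convex: for each $p\in S$ the complete totally geodesic surface tangent to $S$ at $p$ meets $S$ only at $p$, and the shape operator of $S$ at $p$ is definite. Let $\mathcal U\subset\mathcal G_\kappa$ be the set of oriented geodesics that do not meet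 $S$, excluding in addition, for $\kappa=1$, the great circles contained in one of the planes $T_pS\subset\mathbb R^4$, $p\in S$. The outer billiard map $B$ associated with $S$ is defined on $\mathcal U$ as follows. For $\ell=[\gamma]\in\mathcal U$ there are exactly two complete totally geodesic surfaces $P_\pm$ that contain $\ell$ and are tangent to $S$, say at $p_\pm$. Let $q_\pm$ be the point of $\ell$ realizing the distance $d_\pm$ to $p_\pm$, let $\gamma_\pm$ be the unit speed minimizing geodesic ray with $\gamma_\pm(0)=q_\pm$ and $\gamma_\pm(d_\pm)=p_\pm$, and let $W_\pm$ be the parallel field along $\gamma$ with value $\gamma_\pm'(0)$ at $q_\pm$; the signs are chosen so that $\{W_+,W_-,\gamma'\}$ is a positively oriented frame. Then $B(\ell)$ is the oriented geodesic obtained by parallel transport of $\ell$ along $\gamma_+$ between $0$ and $2d_+$. Then, for every such $\kappa$ and $S$, the map $B$ does not preserve $\omega_\times$: there are a point $\ell\in\mathcal U$ at which $B$ is smooth and tangent vectors $I,J\in T_\ell\mathcal G_\kappa$ such that $\omega_\times(dB_\ell I,dB_\ell J)\neq\omega_\times(I,J)$. -/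

import Mathlib

open scoped ContDiff Topology

noncomputable section

namespace OuterBilliard

/-- The ambient vector space `ℝ⁴`, with coordinates `x₀, x₁, x₂, x₃`. -/
abbrev V : Type := Fin 4 → ℝ

/-! ### The three-dimensional space forms

Everywhere `κ` is `0`, `1` or `-1`. -/

/-- The form `κ x₀ y₀ + x₁ y₁ + x₂ y₂ + x₃ y₃`. It restricts to the Riemannian metric
on the tangent spaces of the space form below. -/
def form (κ : ℝ) (x y : V) : ℝ :=
  κ * (x 0 * y 0) + x 1 * y 1 + x 2 * y 2 + x 3 * y 3

/-- The space form `M_κ ⊆ ℝ⁴`: the affine space `{x₀ = 1} ≅ ℝ³` for `κ = 0`, the unit sphere `S³`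
for `κ = 1`, and the sheet `x₀ > 0` of the hyperboloid `-x₀² + x₁² + x₂² + x₃² = -1`
for `κ = -1`. -/
def spaceForm (κ : ℝ) : Set V :=
  {x | x 0 ^ 2 + κ * (x 1 ^ 2 + x 2 ^ 2 + x 3 ^ 2) = 1 ∧ (κ = 1 ∨ 0 < x 0)}

/-- The tangent space of `M_κ` at `x`, as a subspace of `ℝ⁴`. -/
def tangentSpace (κ : ℝ) (x : V) : Submodule ℝ V where
  carrier := {v | x 0 * v 0 + κ * (x 1 * v 1 + x 2 * v 2 + x 3 * v 3) = 0}
  add_mem' := by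
    intro a b ha hb
    simp only [Set.mem_ofPred_eq, Pi.add_apply] at *
    linear_combination ha + hb
  zero_mem' := by simp
  smul_mem' := by
    intro t a ha
    simp only [Set.mem_ofPred_eq, Pi.smul_apply, smul_eq_mul] at *
    linear_combination t * ha

/-- `v` is a unit tangent vector of `M_κ` at the point `x` of `M_κ`. -/
def IsUnitTangent (κ : ℝ) (x v : V) : Prop :=
  x ∈ spaceForm κ ∧ v ∈ tangentSpace κ x ∧ form κ v v = 1

/-- The function `c_κ`. -/
def cosK (κ r : ℝ) : ℝ :=
  if κ = 0 then 1 else if κ = 1 then Real.cos r else Real.cosh r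

/-- The function `s_κ`. -/
def sinK (κ r : ℝ) : ℝ :=
  if κ = 0 then r else if κ = 1 then Real.sin r else Real.sinh r

/-- The geodesic of `M_κ` through `x` with unit initial velocity `v`. -/
def geodesic (κ : ℝ) (x v : V) (r : ℝ) : V := cosK κ r • x + sinK κ r • v

/-- The velocity of the geodesic above, see `hasDerivAt_geodesic`. -/
def geodesicVel (κ : ℝ) (x v : V) (r : ℝ) : V := cosK κ r • v - (κ * sinK κ r) • x

theorem hasDerivAt_cosK {κ : ℝ} (hκ : κ = 0 ∨ κ = 1 ∨ κ = -1) (r : ℝ) :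
    HasDerivAt (cosK κ) (-(κ * sinK κ r)) r := by
  rcases hκ with rfl | rfl | rfl
  · have h : cosK 0 = fun _ => 1 := by funext r; simp [cosK]
    rw [h]
    simpa using hasDerivAt_const r (1 : ℝ)
  · have h : cosK 1 = Real.cos := by funext r; simp [cosK]
    rw [h]
    simpa [sinK] using Real.hasDerivAt_cos r
  · have h : cosK (-1) = Real.cosh := by
      funext r; simp [cosK, show (-1 : ℝ) ≠ 1 by norm_num]
    rw [h]
    simpa [sinK, show (-1 : ℝ) ≠ 1 by norm_num] using Real.hasDerivAt_cosh r

theorem hasDerivAt_sinK {κ : ℝ} (hκ : κ = 0 ∨ κ = 1 ∨ κ = -1) (r : ℝ) :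
    HasDerivAt (sinK κ) (cosK κ r) r := by
  rcases hκ with rfl | rfl | rfl
  · have h : sinK 0 = fun r => r := by funext r; simp [sinK]
    rw [h]
    simpa [cosK] using hasDerivAt_id' r
  · have h : sinK 1 = Real.sin := by funext r; simp [sinK]
    rw [h]
    simpa [cosK] using Real.hasDerivAt_sin r
  · have h : sinK (-1) = Real.sinh := by
      funext r; simp [sinK, show (-1 : ℝ) ≠ 1 by norm_num]
    rw [h]
    simpa [cosK, show (-1 : ℝ) ≠ 1 by norm_num] using Real.hasDerivAt_sinh r

theorem cosK_sq_add {κ : ℝ} (hκ : κ = 0 ∨ κ = 1 ∨ κ = -1) (r : ℝ) :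
    cosK κ r ^ 2 + κ * sinK κ r ^ 2 = 1 := by
  rcases hκ with rfl | rfl | rfl
  · simp [cosK]
  · simp [cosK, sinK]
  · have := Real.cosh_sq r
    simp [cosK, sinK, show (-1 : ℝ) ≠ 1 by norm_num]
    linarith

theorem hasDerivAt_geodesic {κ : ℝ} (hκ : κ = 0 ∨ κ = 1 ∨ κ = -1) (x v : V) (r : ℝ) :
    HasDerivAt (geodesic κ x v) (geodesicVel κ x v r) r := by
  have h := ((hasDerivAt_cosK hκ r).smul_const x).add ((hasDerivAt_sinK hκ r).smul_const v)
  have e : geodesicVel κ x v r = -(κ * sinK κ r) • x + cosK κ r • v := by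
    simp only [geodesicVel, neg_smul]
    abel
  rw [e]
  exact h

/-- Parallel transport of the tangent vector `u` at `x` along the unit speed geodesic with
initial velocity `e`, between `0` and `r`: the velocity field of the geodesic is parallel,
and so are the constant fields orthogonal to the geodesic. -/
def parallelTransport (κ : ℝ) (x e : V) (r : ℝ) (u : V) : V :=
  form κ u e • geodesicVel κ x e r + (u - form κ u e • e)

/-- The Riemannian distance between two points of `M_κ`. -/
def spaceDist (κ : ℝ) (x y : V) : ℝ :=
  if κ = 0 then Real.sqrt (form κ (x - y) (x - y))
  else if κ = 1 then Real.arccos (form κ x y)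
  else Real.arcosh (-form κ x y)

/-- The canonical volume form of `M_κ` at `x`, evaluated at `a, b, c`. A basis `a, b, c` of the
tangent space at `x` is positively oriented if the value is positive. -/
def volumeForm (x a b c : V) : ℝ := Matrix.det (Matrix.of ![x, a, b, c])

/-- The cross product of two tangent vectors `a, b` of `M_κ` at `x`; it is the tangent vector
with `⟨a × b, c⟩ = vol (a, b, c)` for all tangent vectors `c`. -/
def cross (κ : ℝ) (x a b : V) : V := fun i =>
  (if i = 0 then κ else 1) * volumeForm x a b (Pi.single i 1)

theorem volumeForm_eq (x a b c : V) : volumeForm x a b c =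
    (x 0 * a 1 - x 1 * a 0) * (b 2 * c 3 - b 3 * c 2)
    - (x 0 * a 2 - x 2 * a 0) * (b 1 * c 3 - b 3 * c 1)
    + (x 0 * a 3 - x 3 * a 0) * (b 1 * c 2 - b 2 * c 1)
    + (x 1 * a 2 - x 2 * a 1) * (b 0 * c 3 - b 3 * c 0)
    - (x 1 * a 3 - x 3 * a 1) * (b 0 * c 2 - b 2 * c 0)
    + (x 2 * a 3 - x 3 * a 2) * (b 0 * c 1 - b 1 * c 0) := by
  simp [volumeForm, Matrix.det_succ_row_zero, Fin.sum_univ_succ, Fin.succAbove]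
  ring

theorem form_cross {κ : ℝ} (x a b c : V) (hc : κ ^ 2 * c 0 = c 0) :
    form κ (cross κ x a b) c = volumeForm x a b c := by
  simp only [form, cross, volumeForm_eq, Pi.single_apply]
  simp
  linear_combination -(a 3 * (b 1 * x 2 - b 2 * x 1) + a 2 * (b 3 * x 1 - b 1 * x 3)
    + a 1 * (b 2 * x 3 - b 3 * x 2)) * hc

theorem tangent_zero {κ : ℝ} (hκ : κ = 0 ∨ κ = 1 ∨ κ = -1) {x c : V}
    (hx : x ∈ spaceForm κ) (hc : c ∈ tangentSpace κ x) : κ ^ 2 * c 0 = c 0 := by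
  have hc' : x 0 * c 0 + κ * (x 1 * c 1 + x 2 * c 2 + x 3 * c 3) = 0 := hc
  rcases hκ with rfl | rfl | rfl
  · have h1 := hx.1
    have hx0 : x 0 ≠ 0 := by
      intro h
      simp [h] at h1
    have : x 0 * c 0 = 0 := by linarith
    rcases mul_eq_zero.1 this with h | h
    · exact absurd h hx0
    · simp [h]
  · ring
  · ring

theorem form_add (κ : ℝ) (x y z : V) : form κ (x + y) z = form κ x z + form κ y z := by
  simp only [form, Pi.add_apply]
  ring

/-! ### Oriented geodesics -/

/-- The unit tangent bundle of `M_κ`. Its points are identified with the unit speed geodesics. -/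
@[ext]
structure UnitTangent (κ : ℝ) where
  base : V
  vec : V
  isUnitTangent : IsUnitTangent κ base vec

namespace UnitTangent

variable {κ : ℝ}

/-- The unit speed geodesic with initial velocity `w`. -/
def curve (w : UnitTangent κ) (r : ℝ) : V := geodesic κ w.base w.vec r

/-- Its velocity. -/
def vel (w : UnitTangent κ) (r : ℝ) : V := geodesicVel κ w.base w.vec r

end UnitTangent

/-- Two unit speed geodesics are equivalent if they differ by a translation of the parameter. -/
instance geodesicSetoid (κ : ℝ) : Setoid (UnitTangent κ) where
  r w w' := ∃ t₀ : ℝ, ∀ t, w'.curve t = w.curve (t + t₀)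
  iseqv :=
    { refl := fun w => ⟨0, fun t => by simp⟩
      symm := fun {w w'} ⟨t₀, h⟩ => ⟨-t₀, fun t => by rw [h]; simp⟩
      trans := fun {a b c} ⟨t₀, h⟩ ⟨t₁, h'⟩ => ⟨t₁ + t₀, fun t => by rw [h', h, add_assoc]⟩ }

/-- The space `𝒢_κ` of oriented geodesics of `M_κ`. -/
def OrientedGeodesic (κ : ℝ) : Type := Quotient (geodesicSetoid κ)

/-- The oriented geodesic `[γ]` of a unit speed geodesic `γ`. -/
def UnitTangent.toGeodesic {κ : ℝ} (w : UnitTangent κ) : OrientedGeodesic κ :=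
  Quotient.mk (geodesicSetoid κ) w

/-- The set of points of an oriented geodesic. -/
def OrientedGeodesic.points {κ : ℝ} (ℓ : OrientedGeodesic κ) : Set V :=
  {x | ∃ w : UnitTangent κ, w.toGeodesic = ℓ ∧ ∃ r, x = w.curve r}

/-! ### Tangent vectors of `𝒢_κ` as Jacobi fields -/

/-- The space `𝔍_γ` of the Jacobi fields along `γ` orthogonal to `γ'`, that is, of the fields
`c_κ A + s_κ B` with `A, B` parallel along `γ` and orthogonal to `γ'` (as vectors of `ℝ⁴`,
these `A, B` are constant). It is the model of the tangent space of `𝒢_κ` at `[γ]`. -/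
def jacobiFields {κ : ℝ} (w : UnitTangent κ) : Submodule ℝ (ℝ → V) where
  carrier := {J | ∃ a b : V,
    a ∈ tangentSpace κ w.base ∧ form κ a w.vec = 0 ∧
    b ∈ tangentSpace κ w.base ∧ form κ b w.vec = 0 ∧
    J = fun r => cosK κ r • a + sinK κ r • b}
  add_mem' := by
    rintro _ _ ⟨a, b, ha, ha', hb, hb', rfl⟩ ⟨c, d, hc, hc', hd, hd', rfl⟩
    refine ⟨a + c, b + d, add_mem ha hc, ?_, add_mem hb hd, ?_, ?_⟩
    · simp only [form, Pi.add_apply] at *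
      linear_combination ha' + hc'
    · simp only [form, Pi.add_apply] at *
      linear_combination hb' + hd'
    · funext r
      simp only [Pi.add_apply, smul_add]
      abel
  zero_mem' := ⟨0, 0, zero_mem _, by simp [form], zero_mem _, by simp [form], by
    funext r; simp⟩
  smul_mem' := by
    rintro t _ ⟨a, b, ha, ha', hb, hb', rfl⟩
    refine ⟨t • a, t • b, Submodule.smul_mem _ _ ha, ?_, Submodule.smul_mem _ _ hb, ?_, ?_⟩
    · simp only [form, Pi.smul_apply, smul_eq_mul] at *
      linear_combination t * ha'
    · simp only [form, Pi.smul_apply, smul_eq_mul] at *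
      linear_combination t * hb'
    · funext r
      simp only [Pi.smul_apply, smul_add, smul_comm t]

/-- The covariant derivative along the unit speed geodesic `γ` of a field `J` tangent to `M_κ`:
the component of the derivative in `ℝ⁴` that is tangent to `M_κ`. -/
def covDeriv {κ : ℝ} (w : UnitTangent κ) (J : ℝ → V) (r : ℝ) : V :=
  deriv J r + (κ * form κ (w.vel r) (J r)) • w.curve r

/-- The complex structure `J ↦ γ' × J`. -/
def complexStructure {κ : ℝ} (w : UnitTangent κ) (J : ℝ → V) (r : ℝ) : V :=
  cross κ (w.curve r) (w.vel r) (J r)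

/-- The expression `½ ⟨I × J' + J × I', γ'⟩` at the parameter `r`. It does not depend on `r`,
see `crossMetricAt_eq`. -/
def crossMetricAt {κ : ℝ} (w : UnitTangent κ) (I J : ℝ → V) (r : ℝ) : ℝ :=
  (1 / 2) * form κ (cross κ (w.curve r) (I r) (covDeriv w J r)
    + cross κ (w.curve r) (J r) (covDeriv w I r)) (w.vel r)

theorem covDeriv_eq {κ : ℝ} (hκ : κ = 0 ∨ κ = 1 ∨ κ = -1) (w : UnitTangent κ) {a b : V}
    (ha : a ∈ tangentSpace κ w.base) (ha' : form κ a w.vec = 0)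
    (hb : b ∈ tangentSpace κ w.base) (hb' : form κ b w.vec = 0) (r : ℝ) :
    covDeriv w (fun r => cosK κ r • a + sinK κ r • b) r
      = cosK κ r • b - (κ * sinK κ r) • a := by
  have h : HasDerivAt (fun r => cosK κ r • a + sinK κ r • b)
      (-(κ * sinK κ r) • a + cosK κ r • b) r :=
    ((hasDerivAt_cosK hκ r).smul_const a).add ((hasDerivAt_sinK hκ r).smul_const b)
  have h0 : κ * form κ (w.vel r) (cosK κ r • a + sinK κ r • b) = 0 := by
    have ea : w.base 0 * a 0 + κ * (w.base 1 * a 1 + w.base 2 * a 2 + w.base 3 * a 3) = 0 := ha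
    have eb : w.base 0 * b 0 + κ * (w.base 1 * b 1 + w.base 2 * b 2 + w.base 3 * b 3) = 0 := hb
    simp only [form, UnitTangent.vel, geodesicVel, Pi.add_apply, Pi.sub_apply, Pi.smul_apply,
      smul_eq_mul] at *
    rcases hκ with rfl | rfl | rfl
    · simp
    · linear_combination cosK 1 r ^ 2 * ha' + cosK 1 r * sinK 1 r * hb'
        - sinK 1 r * cosK 1 r * ea - sinK 1 r ^ 2 * eb
    · linear_combination -cosK (-1) r ^ 2 * ha' - cosK (-1) r * sinK (-1) r * hb'
        + sinK (-1) r * cosK (-1) r * ea + sinK (-1) r ^ 2 * eb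
  rw [covDeriv, h.deriv, h0, zero_smul, add_zero, neg_smul]
  abel

theorem crossMetricAt_eq {κ : ℝ} (hκ : κ = 0 ∨ κ = 1 ∨ κ = -1) (w : UnitTangent κ)
    (I J : jacobiFields w) (r : ℝ) : crossMetricAt w I J r = crossMetricAt w I J 0 := by
  obtain ⟨_, a, b, ha, ha', hb, hb', rfl⟩ := I
  obtain ⟨_, a₁, b₁, hc, hc', hd, hd', rfl⟩ := J
  have key : ∀ r, crossMetricAt w (fun r => cosK κ r • a + sinK κ r • b)
      (fun r => cosK κ r • a₁ + sinK κ r • b₁) r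
      = 1 / 2 * form κ (cross κ w.base a b₁ + cross κ w.base a₁ b) w.vec := by
    intro r
    simp only [crossMetricAt, covDeriv_eq hκ w ha ha' hb hb', covDeriv_eq hκ w hc hc' hd hd']
    have h := cosK_sq_add hκ r
    have hv : w.vec ∈ tangentSpace κ w.base := w.isUnitTangent.2.1
    have hp := w.isUnitTangent.1
    have h0 : κ ^ 2 * w.vec 0 = w.vec 0 := tangent_zero hκ hp hv
    have h1 : κ ^ 3 = κ := by rcases hκ with rfl | rfl | rfl <;> norm_num
    have hr : κ ^ 2 * w.vel r 0 = w.vel r 0 := by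
      simp only [UnitTangent.vel, geodesicVel, Pi.sub_apply, Pi.smul_apply, smul_eq_mul]
      linear_combination cosK κ r * h0 - sinK κ r * w.base 0 * h1
    have fc : ∀ x a b c : V, κ ^ 2 * c 0 = c 0 → form κ (cross κ x a b) c
        = volumeForm x a b c := fun x a b c => form_cross x a b c
    rw [form_add, form_add, fc _ _ _ _ hr, fc _ _ _ _ hr, fc _ _ _ _ h0, fc _ _ _ _ h0]
    simp only [volumeForm_eq, UnitTangent.vel, UnitTangent.curve, geodesic, geodesicVel,
      Pi.add_apply, Pi.sub_apply, Pi.smul_apply, smul_eq_mul]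
    generalize cosK κ r = c at *
    generalize sinK κ r = s at *
    generalize w.base = p at *
    generalize w.vec = v at *
    linear_combination (1 / 2 * (((p 0 * a 1 - p 1 * a 0) * (b₁ 2 * v 3 - b₁ 3 * v 2)
    - (p 0 * a 2 - p 2 * a 0) * (b₁ 1 * v 3 - b₁ 3 * v 1)
    + (p 0 * a 3 - p 3 * a 0) * (b₁ 1 * v 2 - b₁ 2 * v 1)
    + (p 1 * a 2 - p 2 * a 1) * (b₁ 0 * v 3 - b₁ 3 * v 0)
    - (p 1 * a 3 - p 3 * a 1) * (b₁ 0 * v 2 - b₁ 2 * v 0)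
    + (p 2 * a 3 - p 3 * a 2) * (b₁ 0 * v 1 - b₁ 1 * v 0))
      + ((p 0 * a₁ 1 - p 1 * a₁ 0) * (b 2 * v 3 - b 3 * v 2)
    - (p 0 * a₁ 2 - p 2 * a₁ 0) * (b 1 * v 3 - b 3 * v 1)
    + (p 0 * a₁ 3 - p 3 * a₁ 0) * (b 1 * v 2 - b 2 * v 1)
    + (p 1 * a₁ 2 - p 2 * a₁ 1) * (b 0 * v 3 - b 3 * v 0)
    - (p 1 * a₁ 3 - p 3 * a₁ 1) * (b 0 * v 2 - b 2 * v 0)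
    + (p 2 * a₁ 3 - p 3 * a₁ 2) * (b 0 * v 1 - b 1 * v 0)))) * (c ^ 2 + κ * s ^ 2 + 1) * h
  simp only [key]

/-- The pseudo-Riemannian metric `g_×`. -/
def crossMetric {κ : ℝ} (w : UnitTangent κ) (I J : ℝ → V) : ℝ := crossMetricAt w I J 0

/-- The fundamental form `ω_× (I, J) = g_× (𝒥 I, J)`. -/
def omegaCross {κ : ℝ} (w : UnitTangent κ) (I J : jacobiFields w) : ℝ :=
  crossMetric w (complexStructure w (I : ℝ → V)) (J : ℝ → V)

/-- The velocity at `0` of the curve `c` in `𝒢_κ` corresponds to the Jacobi field `J ∈ 𝔍_γ`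
(where `[γ] = c 0`): locally `c s = [φ_s]` for a smooth variation `φ` of `γ = φ_0` by unit speed
geodesics, and `J` is the component orthogonal to `γ'` of the variation field of `φ`. -/
def HasVelocity {κ : ℝ} (c : ℝ → OrientedGeodesic κ) (w : UnitTangent κ)
    (J : jacobiFields w) : Prop :=
  ∃ x v : ℝ → V, ContDiffAt ℝ ∞ x 0 ∧ ContDiffAt ℝ ∞ v 0 ∧ x 0 = w.base ∧ v 0 = w.vec ∧
    (∀ᶠ s in 𝓝 0, ∃ h : IsUnitTangent κ (x s) (v s),
      c s = (UnitTangent.mk (x s) (v s) h).toGeodesic) ∧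
    ∀ r, (J : ℝ → V) r =
      deriv (fun s => geodesic κ (x s) (v s) r) 0
        - form κ (deriv (fun s => geodesic κ (x s) (v s) r) 0) (w.vel r) • w.vel r

/-- The map `f` on `𝒢_κ` is smooth at `[w]` for the quotient structure of the unit tangent bundle
by the geodesic flow: near `w` it lifts to a smooth map on unit tangent vectors, here one
that maps `w` to `w'`. -/
def HasSmoothLift {κ : ℝ} (f : OrientedGeodesic κ → OrientedGeodesic κ)
    (w w' : UnitTangent κ) : Prop :=
  ∃ F : V × V → V × V, ContDiffAt ℝ ∞ F (w.base, w.vec) ∧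
    F (w.base, w.vec) = (w'.base, w'.vec) ∧
    ∀ᶠ z in 𝓝 (w.base, w.vec), ∀ h : IsUnitTangent κ z.1 z.2,
      ∃ h' : IsUnitTangent κ (F z).1 (F z).2,
        f (UnitTangent.mk z.1 z.2 h).toGeodesic = (UnitTangent.mk (F z).1 (F z).2 h').toGeodesic

/-- The map `f` on `𝒢_κ` is smooth at `[w]`, with `f [w] = [w']`, and its differential there
is `L`. -/
def HasDifferential {κ : ℝ} (f : OrientedGeodesic κ → OrientedGeodesic κ)
    (w w' : UnitTangent κ) (L : jacobiFields w →ₗ[ℝ] jacobiFields w') : Prop :=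
  HasSmoothLift f w w' ∧
    ∀ (c : ℝ → OrientedGeodesic κ) (J : jacobiFields w),
      HasVelocity c w J → HasVelocity (f ∘ c) w' (L J)

/-- The map `f` preserves the two-form `Ω` on `U`: wherever `f` is smooth in `U`, the pullback
of `Ω` by the differential of `f` is `Ω`. (So the negation says that `f` is smooth at some point
of `U` where the pullback is not `Ω`.) -/
def PreservesForm {κ : ℝ} (f : OrientedGeodesic κ → OrientedGeodesic κ)
    (Ω : ∀ w : UnitTangent κ, jacobiFields w → jacobiFields w → ℝ)
    (U : Set (OrientedGeodesic κ)) : Prop :=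
  ∀ (w w' : UnitTangent κ) (L : jacobiFields w →ₗ[ℝ] jacobiFields w'),
    w.toGeodesic ∈ U → HasDifferential f w w' L →
      ∀ I J : jacobiFields w, Ω w' (L I) (L J) = Ω w I J

/-! ### Quadratically convex surfaces -/

/-- `S` is a smooth embedded surface of `M_κ`: locally a regular level set of a smooth function
on `M_κ`. -/
def IsSmoothSurface (κ : ℝ) (S : Set V) : Prop :=
  S ⊆ spaceForm κ ∧ ∀ p ∈ S, ∃ (O : Set V) (h : V → ℝ), IsOpen O ∧ p ∈ O ∧
    ContDiffOn ℝ ∞ h O ∧ (∀ x ∈ O, x ∈ S ↔ x ∈ spaceForm κ ∧ h x = 0) ∧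
    ∃ v ∈ tangentSpace κ p, fderiv ℝ h p v ≠ 0

/-- The tangent plane `T_p S ⊆ ℝ⁴`: the velocities at `p` of the smooth curves in `S`. -/
def surfaceTangent (S : Set V) (p : V) : Set V :=
  {u | ∃ c : ℝ → V, ContDiffAt ℝ ∞ c 0 ∧ c 0 = p ∧ (∀ᶠ s in 𝓝 0, c s ∈ S) ∧ deriv c 0 = u}

/-- The complete totally geodesic surface of `M_κ` tangent to `S` at `p`: the section of `M_κ` by
the linear span of `p` and `T_p S`. -/
def tangentSurface (κ : ℝ) (S : Set V) (p : V) : Set V :=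
  {x | x ∈ spaceForm κ ∧ x ∈ Submodule.span ℝ (insert p (surfaceTangent S p))}

/-- `S` meets each of its tangent totally geodesic surfaces only at the point of tangency. -/
def IsStrictlyConvex (κ : ℝ) (S : Set V) : Prop :=
  ∀ p ∈ S, ∀ x ∈ S, x ∈ tangentSurface κ S p → x = p

/-- `n` is a smooth unit normal field of the surface `S` of `M_κ` near `p`. -/
def IsUnitNormalNear (κ : ℝ) (S : Set V) (p : V) (n : V → V) : Prop :=
  ContDiffAt ℝ ∞ n p ∧
    ∀ᶠ x in 𝓝[S] p, n x ∈ tangentSpace κ x ∧ form κ (n x) (n x) = 1 ∧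
      ∀ u ∈ surfaceTangent S x, form κ (n x) u = 0

/-- The shape operator `u ↦ -∇_u n` of `S` at `p` is definite (it is positive definite for one of
the two unit normals). For `u ∈ T_p S` the derivative of `n` in `ℝ⁴` is tangent to
`M_κ`, so that it is the covariant derivative. -/
def HasDefiniteShapeOperator (κ : ℝ) (S : Set V) (p : V) : Prop :=
  ∃ n : V → V, IsUnitNormalNear κ S p n ∧
    ∀ u ∈ surfaceTangent S p, u ≠ 0 → 0 < form κ (-(fderiv ℝ n p u)) u

/-- `S` is a compact connected quadratically convex surface of `M_κ`: a strictly convex surface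
all of whose shape operators are definite. -/
structure IsQuadraticallyConvex (κ : ℝ) (S : Set V) : Prop where
  smooth : IsSmoothSurface κ S
  compact : IsCompact S
  connected : IsConnected S
  strictlyConvex : IsStrictlyConvex κ S
  definite : ∀ p ∈ S, HasDefiniteShapeOperator κ S p

/-! ### The outer billiard map -/

/-- The billiard table `𝒰`: the oriented geodesics that do not meet `S` and, if `κ = 1`, are
not great circles contained in a linear plane `T_p S ⊆ ℝ⁴`, `p ∈ S`. -/
def billiardTable (κ : ℝ) (S : Set V) : Set (OrientedGeodesic κ) :=
  {ℓ | (∀ x ∈ ℓ.points, x ∉ S) ∧ (κ = 1 → ¬ ∃ p ∈ S, ℓ.points ⊆ surfaceTangent S p)}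

/-- The totally geodesic surface tangent to `S` at `p` contains the geodesic `γ` of `w`; the point
`q = γ t` realizes the distance `d` between `p` and `γ`; and the geodesic ray from `q` with unit
initial velocity `e` is at `p` at time `d`. -/
def IsTangency {κ : ℝ} (S : Set V) (w : UnitTangent κ) (p : V) (t d : ℝ) (e : V) : Prop :=
  p ∈ S ∧ (∀ r, w.curve r ∈ tangentSurface κ S p) ∧
    (∀ r, spaceDist κ p (w.curve t) ≤ spaceDist κ p (w.curve r)) ∧
    d = spaceDist κ p (w.curve t) ∧
    IsUnitTangent κ (w.curve t) e ∧ geodesic κ (w.curve t) e d = p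

/-- `ℓ'` is the image of `ℓ = [γ]` under the outer billiard map associated with `S`. The two
totally geodesic surfaces tangent to `S` that contain `ℓ` are labelled by `+` and `-` in such a way
that `{W₊, W₋, γ'}` is a positively oriented frame along `γ`, where `W₊` and `W₋` are the parallel
fields along `γ` that extend the initial velocities `e₊`, `e₋` of the rays to the tangency
points (the frame is tested at `γ 0`). Then `ℓ` is parallel transported along the ray `γ₊`
between `0` and `2 d₊`. -/
def IsOuterBilliardImage {κ : ℝ} (S : Set V) (ℓ ℓ' : OrientedGeodesic κ) : Prop :=
  ∃ w : UnitTangent κ, w.toGeodesic = ℓ ∧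
    ∃ (p₁ : V) (t₁ d₁ : ℝ) (e₁ : V) (p₂ : V) (t₂ d₂ : ℝ) (e₂ : V),
      IsTangency S w p₁ t₁ d₁ e₁ ∧ IsTangency S w p₂ t₂ d₂ e₂ ∧
      0 < volumeForm w.base
        (parallelTransport κ (w.curve t₁) (w.vel t₁) (-t₁) e₁)
        (parallelTransport κ (w.curve t₂) (w.vel t₂) (-t₂) e₂) w.vec ∧
      ∃ h : IsUnitTangent κ (geodesic κ (w.curve t₁) e₁ (2 * d₁))
          (parallelTransport κ (w.curve t₁) e₁ (2 * d₁) (w.vel t₁)),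
        ℓ' = (UnitTangent.mk _ _ h).toGeodesic

open Classical in
/-- The outer billiard map `B` associated with `S` (extended by the identity to the geodesics where
the construction does not apply). -/
def outerBilliard (κ : ℝ) (S : Set V) (ℓ : OrientedGeodesic κ) : OrientedGeodesic κ :=
  if h : ∃ ℓ', IsOuterBilliardImage S ℓ ℓ' then h.choose else ℓ

end OuterBilliard

end

/-! The map is tested on geodesics that stay inside one complete totally geodesic surface tangent to
S. While ℓ moves inside the surface tangent at p, its tangency point stays p, and B acts on ℓ as the
point reflection in p followed by a reversal of orientation: the foot x of the perpendicular from p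
goes to its mirror image x', while the velocity v, orthogonal to that perpendicular, is unchanged as
a vector of ℝ⁴. Let e be the unit vector at x pointing to p, and e' its parallel translate at x'.
Displacing ℓ along e is the Jacobi field I = c_κ e, and turning ℓ about x is J = s_κ e. The mirror
image moves backwards but turns the same way, so dB I = -c_κ e' and dB J = s_κ e'. By
`omegaCross_eq`, ω_× takes the value -t/2 on (c_κ t e, s_κ e) for every unit e orthogonal to the
velocity. Hence -1/2 becomes 1/2.

It remains to find a geodesic in the table at which B is smooth and the tangency point used is p.
From p ∈ S and an orthonormal basis e, v of T_pS, step back from p along e by a small d and take the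
geodesic there in the direction v. Definiteness of the shape operator puts S locally on one side of
its tangent surface, and connectedness with strict convexity makes this global
(`IsQuadraticallyConvex.lam_pos`): each point of S has a linear functional `lam` that is positive on
the rest of S. Turning a hyperplane around ℓ until it supports S again gives a second tangency point
(`exists_second_tangencyPoint`), and a sign argument excludes a third (`tangencyPoint_unique`).

Definiteness is also the nondegeneracy needed to apply the implicit function theorem to the tangency
point (`exists_tangencyPoint`). Thus `outerBilliard_eq` gives B a smooth explicit lift to unit
tangent vectors, and `exists_hasDifferential` turns the derivative of that lift into a map of Jacobi
fields. On the sphere, tangency points at distance π/2 from ℓ have to be avoided, which compactness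
allows for small d (`exists_close`). If p carries the wrong sign in the orientation rule, ℓ is
reversed. -/

noncomputable section

namespace OuterBilliard

/-! ### The three models in common: two bilinear forms and the geodesic flow -/

section

variable {κ : ℝ}

/-! ### Elementary algebra of the space forms -/

/-- The bilinear form defining the space form: `M_κ` lies in `{tfun x x = 1}`, and its tangent
space at `x` is the kernel of `tfun x`. -/
def tfun (κ : ℝ) (x y : V) : ℝ := x 0 * y 0 + κ * (x 1 * y 1 + x 2 * y 2 + x 3 * y 3)

theorem mem_tangentSpace_iff {x v : V} : v ∈ tangentSpace κ x ↔ tfun κ x v = 0 := Iff.rfl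

theorem tfun_comm (x y : V) : tfun κ x y = tfun κ y x := by simp only [tfun]; ring
theorem tfun_add (x y z : V) : tfun κ x (y + z) = tfun κ x y + tfun κ x z := by
  simp only [tfun, Pi.add_apply]; ring
theorem tfun_sub (x y z : V) : tfun κ x (y - z) = tfun κ x y - tfun κ x z := by
  simp only [tfun, Pi.sub_apply]; ring
theorem tfun_smul (t : ℝ) (x y : V) : tfun κ x (t • y) = t * tfun κ x y := by
  simp only [tfun, Pi.smul_apply, smul_eq_mul]; ring
theorem tfun_add_left (x y z : V) : tfun κ (y + z) x = tfun κ y x + tfun κ z x := by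
  simp only [tfun, Pi.add_apply]; ring
theorem tfun_sub_left (x y z : V) : tfun κ (y - z) x = tfun κ y x - tfun κ z x := by
  simp only [tfun, Pi.sub_apply]; ring
theorem tfun_smul_left (t : ℝ) (x y : V) : tfun κ (t • y) x = t * tfun κ y x := by
  simp only [tfun, Pi.smul_apply, smul_eq_mul]; ring

theorem form_comm (x y : V) : form κ x y = form κ y x := by simp only [form]; ring
theorem form_add_right (x y z : V) : form κ x (y + z) = form κ x y + form κ x z := by
  simp only [form, Pi.add_apply]; ring
theorem form_sub_right (x y z : V) : form κ x (y - z) = form κ x y - form κ x z := by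
  simp only [form, Pi.sub_apply]; ring
theorem form_smul_right (t : ℝ) (x y : V) : form κ x (t • y) = t * form κ x y := by
  simp only [form, Pi.smul_apply, smul_eq_mul]; ring
theorem form_sub_left (x y z : V) : form κ (y - z) x = form κ y x - form κ z x := by
  simp only [form, Pi.sub_apply]; ring
theorem form_smul_left (t : ℝ) (x y : V) : form κ (t • y) x = t * form κ y x := by
  simp only [form, Pi.smul_apply, smul_eq_mul]; ring
theorem form_neg_left (x y : V) : form κ (-y) x = -form κ y x := by
  simp only [form, Pi.neg_apply]; ring
theorem form_neg_right (x y : V) : form κ x (-y) = -form κ x y := by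
  simp only [form, Pi.neg_apply]; ring
theorem form_zero_left (x : V) : form κ 0 x = 0 := by simp [form]
theorem form_zero_right (x : V) : form κ x 0 = 0 := by simp [form]

/-- Links the two bilinear forms, so that the three curvatures can be treated together. For κ = ±1
the correction vanishes and `form` is κ times `tfun`. For κ = 0 only zeroth coordinates are left,
and these are 1 on points and 0 on tangent vectors. -/
theorem smul_form (a b : V) :
    κ * form κ a b = tfun κ a b - (1 - κ ^ 2) * (a 0 * b 0) := by
  simp only [form, tfun]; ring

theorem tfun_self {x : V} (hx : x ∈ spaceForm κ) : tfun κ x x = 1 := by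
  have h : x 0 ^ 2 + κ * (x 1 ^ 2 + x 2 ^ 2 + x 3 ^ 2) = 1 := hx.1
  simp only [tfun]; linear_combination h

theorem base_zero (hκ : κ = 0 ∨ κ = 1 ∨ κ = -1) {x : V} (hx : x ∈ spaceForm κ) :
    (1 - κ ^ 2) * x 0 = 1 - κ ^ 2 := by
  obtain ⟨h1, h2⟩ := hx
  rcases hκ with rfl | rfl | rfl
  · have h3 : 0 < x 0 := by simpa using h2
    have : (x 0 - 1) * (x 0 + 1) = 0 := by linear_combination h1
    rcases mul_eq_zero.1 this with h | h
    · linear_combination h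
    · linarith
  · ring
  · ring

theorem tangent_zero' (hκ : κ = 0 ∨ κ = 1 ∨ κ = -1) {x c : V}
    (hx : x ∈ spaceForm κ) (hc : tfun κ x c = 0) : (1 - κ ^ 2) * c 0 = 0 := by
  linear_combination -tangent_zero hκ hx hc

theorem form_self_nonneg (hκ : κ = 0 ∨ κ = 1 ∨ κ = -1) {x a : V}
    (hx : x ∈ spaceForm κ) (ha : tfun κ x a = 0) :
    0 ≤ form κ a a ∧ (form κ a a = 0 → a = 0) := by
  suffices H : 0 ≤ form κ a a ∧
      (form κ a a = 0 → a 0 = 0 ∧ a 1 = 0 ∧ a 2 = 0 ∧ a 3 = 0) by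
    refine ⟨H.1, fun h => ?_⟩
    obtain ⟨h0, h1, h2, h3⟩ := H.2 h
    funext i
    fin_cases i <;> simp [h0, h1, h2, h3]
  have h0 := tangent_zero' hκ hx ha
  have hxx := tfun_self hx
  have h2 := hx.2
  rcases hκ with rfl | rfl | rfl
  · have h0 : a 0 = 0 := by linarith
    simp only [form]
    refine ⟨by nlinarith [sq_nonneg (a 1), sq_nonneg (a 2), sq_nonneg (a 3)], fun h => ⟨h0, ?_⟩⟩
    refine ⟨?_, ?_, ?_⟩ <;> nlinarith [sq_nonneg (a 1), sq_nonneg (a 2), sq_nonneg (a 3)]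
  · simp only [form]
    refine ⟨by nlinarith [sq_nonneg (a 0), sq_nonneg (a 1), sq_nonneg (a 2), sq_nonneg (a 3)],
      fun h => ?_⟩
    refine ⟨?_, ?_, ?_, ?_⟩ <;>
      nlinarith [sq_nonneg (a 0), sq_nonneg (a 1), sq_nonneg (a 2), sq_nonneg (a 3)]
  · simp only [form, tfun] at *
    have hx0 : 0 < x 0 := by
      rcases h2 with h | h
      · norm_num at h
      · exact h
    -- Lagrange's identity for the spatial parts of x and a, after substituting x₀a₀ = Σ xᵢaᵢ and
    -- x₀² = 1 + Σ xᵢ²: tangent vectors of the hyperboloid are spacelike.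
    have key : x 0 ^ 2 * (-1 * (a 0 * a 0) + a 1 * a 1 + a 2 * a 2 + a 3 * a 3) =
        (a 1 * a 1 + a 2 * a 2 + a 3 * a 3) + (x 1 * a 2 - x 2 * a 1) ^ 2
          + (x 1 * a 3 - x 3 * a 1) ^ 2 + (x 2 * a 3 - x 3 * a 2) ^ 2 := by
      linear_combination (-(x 0 * a 0) - (x 1 * a 1 + x 2 * a 2 + x 3 * a 3)) * ha
        + (a 1 * a 1 + a 2 * a 2 + a 3 * a 3) * hxx
    have hp : 0 < x 0 ^ 2 := by positivity
    constructor
    · by_contra hn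
      push Not at hn
      nlinarith [sq_nonneg (a 1), sq_nonneg (a 2), sq_nonneg (a 3),
        sq_nonneg (x 1 * a 2 - x 2 * a 1), sq_nonneg (x 1 * a 3 - x 3 * a 1),
        sq_nonneg (x 2 * a 3 - x 3 * a 2), mul_pos_of_neg_of_neg (neg_neg_of_pos hp) hn]
    · intro h
      rw [h, mul_zero] at key
      have hs : a 1 ^ 2 + a 2 ^ 2 + a 3 ^ 2 = 0 := by
        nlinarith [sq_nonneg (a 1), sq_nonneg (a 2), sq_nonneg (a 3),
          sq_nonneg (x 1 * a 2 - x 2 * a 1), sq_nonneg (x 1 * a 3 - x 3 * a 1),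
          sq_nonneg (x 2 * a 3 - x 3 * a 2)]
      have e1 : a 1 = 0 := by nlinarith [sq_nonneg (a 1), sq_nonneg (a 2), sq_nonneg (a 3)]
      have e2 : a 2 = 0 := by nlinarith [sq_nonneg (a 1), sq_nonneg (a 2), sq_nonneg (a 3)]
      have e3 : a 3 = 0 := by nlinarith [sq_nonneg (a 1), sq_nonneg (a 2), sq_nonneg (a 3)]
      refine ⟨?_, e1, e2, e3⟩
      simpa [e1, e2, e3] using h

theorem exists_unit_smul (hκ : κ = 0 ∨ κ = 1 ∨ κ = -1) {x a : V}
    (hx : x ∈ spaceForm κ) (ha : tfun κ x a = 0) (h0 : a ≠ 0) :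
    ∃ t : ℝ, form κ (t • a) (t • a) = 1 := by
  have h := form_self_nonneg hκ hx ha
  have hp : 0 < form κ a a := lt_of_le_of_ne h.1 fun e => h0 (h.2 e.symm)
  refine ⟨(Real.sqrt (form κ a a))⁻¹, ?_⟩
  rw [form_smul_left, form_smul_right]
  have h1 := Real.mul_self_sqrt hp.le
  have h2 := (Real.sqrt_pos.2 hp).ne'
  generalize Real.sqrt (form κ a a) = s at *
  rw [← h1]
  field_simp

/-! ### Trigonometry -/

@[simp] theorem cosK_zero : cosK κ 0 = 1 := by simp [cosK]
@[simp] theorem sinK_zero : sinK κ 0 = 0 := by simp [sinK]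

theorem cosK_add (hκ : κ = 0 ∨ κ = 1 ∨ κ = -1) (a b : ℝ) :
    cosK κ (a + b) = cosK κ a * cosK κ b - κ * (sinK κ a * sinK κ b) := by
  rcases hκ with rfl | rfl | rfl
  · simp [cosK]
  · simp [cosK, sinK, Real.cos_add]
  · simp [cosK, sinK, Real.cosh_add, show (-1 : ℝ) ≠ 1 by norm_num]

theorem sinK_add (hκ : κ = 0 ∨ κ = 1 ∨ κ = -1) (a b : ℝ) :
    sinK κ (a + b) = sinK κ a * cosK κ b + cosK κ a * sinK κ b := by
  rcases hκ with rfl | rfl | rfl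
  · simp [cosK, sinK]
  · simp [cosK, sinK, Real.sin_add]
  · simp [cosK, sinK, Real.sinh_add, show (-1 : ℝ) ≠ 1 by norm_num]

theorem exists_cosK_sinK (hκ : κ = 0 ∨ κ = 1 ∨ κ = -1) {a b : ℝ} (h : a ^ 2 + κ * b ^ 2 = 1)
    (h' : κ ≠ 1 → 0 < a) : ∃ t, cosK κ t = a ∧ sinK κ t = b := by
  rcases hκ with rfl | rfl | rfl
  · have h3 : 0 < a := h' (by norm_num)
    have : (a - 1) * (a + 1) = 0 := by linear_combination h
    have : a = 1 := by
      rcases mul_eq_zero.1 this with h | h <;> linarith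
    exact ⟨b, by simp [cosK, this], by simp [sinK]⟩
  · have hn : ‖(⟨a, b⟩ : ℂ)‖ = 1 := by
      rw [Complex.norm_def, Complex.normSq_mk]
      rw [show a * a + b * b = 1 by linarith, Real.sqrt_one]
    have hn0 : (⟨a, b⟩ : ℂ) ≠ 0 := by
      intro h0
      rw [h0] at hn
      simp at hn
    refine ⟨Complex.arg ⟨a, b⟩, ?_, ?_⟩
    · simp [cosK, Complex.cos_arg hn0, hn]
    · simp [sinK, Complex.sin_arg, hn]
  · have h3 : 0 < a := h' (by norm_num)
    have hm : (-1 : ℝ) ≠ 1 := by norm_num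
    refine ⟨Real.arsinh b, ?_, ?_⟩
    · simp only [cosK, neg_eq_zero, one_ne_zero, if_false, hm]
      rw [Real.cosh_arsinh, show 1 + b ^ 2 = a ^ 2 by linarith, Real.sqrt_sq h3.le]
    · simp [sinK, hm]

/-! ### Unit tangent vectors and the geodesic flow -/

theorem IsUnitTangent.tfun_base {x v : V} (h : IsUnitTangent κ x v) : tfun κ x x = 1 :=
  tfun_self h.1

theorem IsUnitTangent.tfun_vec {x v : V} (h : IsUnitTangent κ x v) : tfun κ x v = 0 := h.2.1

theorem IsUnitTangent.vec_zero (hκ : κ = 0 ∨ κ = 1 ∨ κ = -1) {x v : V}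
    (h : IsUnitTangent κ x v) : (1 - κ ^ 2) * v 0 = 0 := tangent_zero' hκ h.1 h.2.1

theorem smul_form_base (hκ : κ = 0 ∨ κ = 1 ∨ κ = -1) {x a : V} (hx : x ∈ spaceForm κ)
    (ha : tfun κ x a = 0) : κ * form κ x a = 0 := by
  rw [smul_form, ha]
  linear_combination -x 0 * tangent_zero' hκ hx ha

theorem smul_form_self (hκ : κ = 0 ∨ κ = 1 ∨ κ = -1) {x : V} (hx : x ∈ spaceForm κ) :
    κ * form κ x x = κ ^ 2 := by
  rw [smul_form, tfun_self hx]
  linear_combination (-x 0 - 1) * base_zero hκ hx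

theorem tfun_tangent (hκ : κ = 0 ∨ κ = 1 ∨ κ = -1) {x a b : V} (hx : x ∈ spaceForm κ)
    (ha : tfun κ x a = 0) : tfun κ a b = κ * form κ a b := by
  rw [smul_form]
  linear_combination b 0 * tangent_zero' hκ hx ha

theorem cube_eq (hκ : κ = 0 ∨ κ = 1 ∨ κ = -1) : κ ^ 3 = κ := by
  rcases hκ with rfl | rfl | rfl <;> norm_num

theorem IsUnitTangent.neg {x v : V} (h : IsUnitTangent κ x v) : IsUnitTangent κ x (-v) := by
  refine ⟨h.1, Submodule.neg_mem _ h.2.1, ?_⟩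
  rw [form_neg_left, form_neg_right, neg_neg]
  exact h.2.2

/-- Keeps hyperbolic geodesics on the upper sheet: together with |sinh r| < cosh r it makes cosh r ·
x₀ + sinh r · v₀ positive in `isUnitTangent_flow`. The proof is again Lagrange's identity. -/
theorem abs_vec_zero_lt {x v : V} (h : IsUnitTangent (-1) x v) : v 0 ^ 2 < x 0 ^ 2 := by
  obtain ⟨⟨h1, h2⟩, h3, h4⟩ := h
  have hx0 : 0 < x 0 := by
    rcases h2 with h | h
    · norm_num at h
    · exact h
  have h3 : x 0 * v 0 + -1 * (x 1 * v 1 + x 2 * v 2 + x 3 * v 3) = 0 := h3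
  simp only [form] at h4
  have key : v 0 ^ 2 + (x 1 * v 2 - x 2 * v 1) ^ 2
          + (x 1 * v 3 - x 3 * v 1) ^ 2 + (x 2 * v 3 - x 3 * v 2) ^ 2 = x 0 ^ 2 - 1 := by
    linear_combination (-(v 1 * v 1 + v 2 * v 2 + v 3 * v 3)) * h1 + (x 0 ^ 2 - 1) * h4 +
      (x 0 * v 0 + (x 1 * v 1 + x 2 * v 2 + x 3 * v 3)) * h3
  nlinarith [sq_nonneg (x 1 * v 2 - x 2 * v 1), sq_nonneg (x 1 * v 3 - x 3 * v 1),
    sq_nonneg (x 2 * v 3 - x 3 * v 2)]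

theorem tfun_geodesic (x v y : V) (r : ℝ) :
    tfun κ y (geodesic κ x v r) = cosK κ r * tfun κ y x + sinK κ r * tfun κ y v := by
  rw [geodesic, tfun_add, tfun_smul, tfun_smul]

theorem tfun_geodesicVel (x v y : V) (r : ℝ) :
    tfun κ y (geodesicVel κ x v r) = cosK κ r * tfun κ y v - κ * sinK κ r * tfun κ y x := by
  rw [geodesicVel, tfun_sub, tfun_smul, tfun_smul]

theorem form_geodesic (x v y : V) (r : ℝ) :
    form κ y (geodesic κ x v r) = cosK κ r * form κ y x + sinK κ r * form κ y v := by
  rw [geodesic, form_add_right, form_smul_right, form_smul_right]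

theorem form_geodesicVel (x v y : V) (r : ℝ) :
    form κ y (geodesicVel κ x v r) = cosK κ r * form κ y v - κ * sinK κ r * form κ y x := by
  rw [geodesicVel, form_sub_right, form_smul_right, form_smul_right]

theorem isUnitTangent_flow (hκ : κ = 0 ∨ κ = 1 ∨ κ = -1) {x v : V} (h : IsUnitTangent κ x v)
    (r : ℝ) : IsUnitTangent κ (geodesic κ x v r) (geodesicVel κ x v r) := by
  have hc := cosK_sq_add hκ r
  have hxx := h.tfun_base
  have hxv := h.tfun_vec
  have hvv := h.2.2
  have tvv : tfun κ v v = κ := by rw [tfun_tangent hκ h.1 hxv, hvv, mul_one]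
  have fxv := smul_form_base hκ h.1 hxv
  have fxx := smul_form_self hκ h.1
  refine ⟨⟨?_, ?_⟩, ?_, ?_⟩
  · have : tfun κ (geodesic κ x v r) (geodesic κ x v r) = 1 := by
      rw [tfun_geodesic, tfun_comm _ x, tfun_comm _ v, tfun_geodesic, tfun_geodesic,
        tfun_comm v x, hxx, hxv, tvv]
      linear_combination hc
    simp only [tfun] at this
    linear_combination this
  · rcases hκ with rfl | rfl | rfl
    · right
      have h0 : v 0 = 0 := by simpa using h.vec_zero (Or.inl rfl)
      have h1 : 0 < x 0 := by simpa using h.1.2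
      simpa [geodesic, cosK, sinK, h0] using h1
    · exact Or.inl rfl
    · right
      have h1 : 0 < x 0 := by
        rcases h.1.2 with h | h
        · norm_num at h
        · exact h
      have h2 := abs_lt_of_sq_lt_sq (abs_vec_zero_lt h) h1.le
      have hm : (-1 : ℝ) ≠ 1 := by norm_num
      simp only [geodesic, cosK, sinK, neg_eq_zero, one_ne_zero, if_false, hm, Pi.add_apply,
        Pi.smul_apply, smul_eq_mul]
      have hch := Real.cosh_sq r
      have hcp := Real.cosh_pos r
      have h3 : |Real.sinh r * v 0| < Real.cosh r * x 0 := by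
        rw [abs_mul]
        have : |Real.sinh r| < Real.cosh r := by
          apply abs_lt_of_sq_lt_sq _ hcp.le
          linarith
        exact mul_lt_mul'' this h2 (abs_nonneg _) (abs_nonneg _)
      linarith [neg_abs_le (Real.sinh r * v 0)]
  · rw [mem_tangentSpace_iff, tfun_geodesicVel, tfun_comm _ x, tfun_comm _ v, tfun_geodesic,
      tfun_geodesic, tfun_comm v x, hxx, hxv, tvv]
    ring
  · rw [form_geodesicVel, form_comm _ x, form_comm _ v, form_geodesicVel,
      form_geodesicVel, form_comm v x, hvv]
    linear_combination hc - 2 * cosK κ r * sinK κ r * fxv + κ * sinK κ r ^ 2 * fxx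
      + sinK κ r ^ 2 * cube_eq hκ

theorem geodesic_geodesic (hκ : κ = 0 ∨ κ = 1 ∨ κ = -1) (x v : V) (a b : ℝ) :
    geodesic κ (geodesic κ x v a) (geodesicVel κ x v a) b = geodesic κ x v (a + b) := by
  simp only [geodesic, geodesicVel, cosK_add hκ, sinK_add hκ]
  module

theorem geodesic_zero (x v : V) : geodesic κ x v 0 = x := by simp [geodesic]
theorem geodesicVel_zero (x v : V) : geodesicVel κ x v 0 = v := by simp [geodesicVel]

/-- The equivalence relation compares only the curves; the velocity is recovered by differentiating
the translated curve at 0. -/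
theorem toGeodesic_eq_iff (hκ : κ = 0 ∨ κ = 1 ∨ κ = -1) (w w' : UnitTangent κ) :
    w'.toGeodesic = w.toGeodesic ↔ ∃ t, w'.base = w.curve t ∧ w'.vec = w.vel t := by
  rw [eq_comm]
  constructor
  · intro h
    obtain ⟨t, ht⟩ : ∃ t₀ : ℝ, ∀ t, w'.curve t = w.curve (t + t₀) := Quotient.exact h
    refine ⟨t, by simpa [UnitTangent.curve, geodesic_zero] using ht 0, ?_⟩
    have h1 : HasDerivAt w'.curve w'.vec 0 := by
      have := hasDerivAt_geodesic hκ w'.base w'.vec 0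
      rwa [geodesicVel_zero] at this
    have h2 : HasDerivAt (fun s => w.curve (s + t)) (w.vel t) 0 := by
      have h3 : HasDerivAt w.curve (w.vel t) (0 + t) := by
        rw [zero_add]
        exact hasDerivAt_geodesic hκ w.base w.vec t
      exact HasDerivAt.comp_add_const 0 t h3
    rw [← funext ht] at h2
    exact h1.unique h2
  · rintro ⟨t, h1, h2⟩
    refine Quotient.sound ⟨t, fun s => ?_⟩
    rw [UnitTangent.curve, h1, h2, add_comm]
    exact geodesic_geodesic hκ _ _ _ _

end

/-! ### Strict minima, supporting functionals and charts of a surface -/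

section

variable {κ : ℝ}

/-! ### Calculus preliminaries -/

theorem isInvertible_of_injective {E : Type*} [NormedAddCommGroup E] [NormedSpace ℝ E]
    [FiniteDimensional ℝ E] (A : E →L[ℝ] E) (hA : ∀ x, A x = 0 → x = 0) : A.IsInvertible := by
  have hi : Function.Injective (A : E →ₗ[ℝ] E) :=
    (injective_iff_map_eq_zero (A : E →ₗ[ℝ] E)).2 hA
  refine ⟨(LinearEquiv.ofInjectiveEndo (A : E →ₗ[ℝ] E) hi).toContinuousLinearEquiv, ?_⟩
  ext x
  rfl

/-- Compactness of the unit sphere gives B u u ≥ μ‖u‖² with μ > 0. For small u, differentiability of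
f' at 0 makes f'(tu)u differ from t B u u by at most half of tμ‖u‖², so f is strictly increasing
along the segment from 0 to u. No continuity of second derivatives is needed. -/
theorem eventually_lt_of_second_deriv_pos {E : Type*} [NormedAddCommGroup E] [NormedSpace ℝ E]
    [FiniteDimensional ℝ E] {f : E → ℝ} {f' : E → E →L[ℝ] ℝ} {B : E →L[ℝ] E →L[ℝ] ℝ}
    (hf : ∀ᶠ u in 𝓝 (0 : E), HasFDerivAt f (f' u) u) (h0 : f' 0 = 0)
    (hB : HasFDerivAt f' B 0) (hpos : ∀ u, u ≠ 0 → 0 < B u u) :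
    ∀ᶠ u in 𝓝 (0 : E), u ≠ 0 → f 0 < f u := by
  obtain ⟨μ, hμ, hμB⟩ : ∃ μ > 0, ∀ u, μ * ‖u‖ ^ 2 ≤ B u u := by
    rcases subsingleton_or_nontrivial E with hE | hE
    · exact ⟨1, one_pos, fun u => by simp [Subsingleton.elim u 0]⟩
    have hne : (Metric.sphere (0 : E) 1).Nonempty := NormedSpace.sphere_nonempty.2 zero_le_one
    obtain ⟨m, hm, hmin⟩ := (isCompact_sphere (0 : E) 1).exists_isMinOn hne
      (f := fun u => B u u) (by fun_prop)
    have hm0 : m ≠ 0 := by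
      rintro rfl
      simp at hm
    refine ⟨B m m, hpos m hm0, fun u => ?_⟩
    rcases eq_or_ne u 0 with rfl | hu
    · simp
    have hn : ‖u‖ ≠ 0 := norm_ne_zero_iff.2 hu
    have h1 : ‖u‖⁻¹ • u ∈ Metric.sphere (0 : E) 1 := by
      simp [norm_smul, hn]
    have h2 : B m m ≤ B (‖u‖⁻¹ • u) (‖u‖⁻¹ • u) := hmin h1
    simp only [map_smul, smul_apply, smul_eq_mul] at h2
    calc B m m * ‖u‖ ^ 2 ≤ (‖u‖⁻¹ * (‖u‖⁻¹ * B u u)) * ‖u‖ ^ 2 := by gcongr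
      _ = B u u := by field_simp
  have ho := hB.isLittleO.def (half_pos hμ)
  simp only [sub_zero, h0] at ho
  obtain ⟨ε, hε, hball⟩ := Metric.eventually_nhds_iff_ball.1 (hf.and ho)
  filter_upwards [Metric.ball_mem_nhds (0 : E) hε] with u hu hu0
  have hmem : ∀ t ∈ Set.Icc (0 : ℝ) 1, t • u ∈ Metric.ball (0 : E) ε := by
    intro t ht
    rw [mem_ball_zero_iff] at hu ⊢
    rw [norm_smul, Real.norm_of_nonneg ht.1]
    nlinarith [norm_nonneg u, ht.2]
  have hder : ∀ t ∈ Set.Icc (0 : ℝ) 1, HasDerivAt (fun s : ℝ => f (s • u)) (f' (t • u) u) t := by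
    intro t ht
    have h1 : HasDerivAt (fun s : ℝ => s • u) u t := by
      simpa using (hasDerivAt_id t).smul_const u
    exact (hball _ (hmem t ht)).1.comp_hasDerivAt t h1
  have hmono : StrictMonoOn (fun s : ℝ => f (s • u)) (Set.Icc 0 1) := by
    apply strictMonoOn_of_deriv_pos (convex_Icc 0 1)
    · exact fun t ht => (hder t ht).continuousAt.continuousWithinAt
    · intro t ht
      rw [interior_Icc] at ht
      have ht' : t ∈ Set.Icc (0 : ℝ) 1 := ⟨ht.1.le, ht.2.le⟩
      rw [(hder t ht').deriv]
      have h1 := (hball _ (hmem t ht')).2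
      have h2 : |(f' (t • u) - B (t • u)) u| ≤ μ / 2 * ‖t • u‖ * ‖u‖ :=
        ((f' (t • u) - B (t • u)).le_opNorm u).trans (by gcongr)
      rw [norm_smul, Real.norm_of_nonneg ht.1.le] at h2
      have h3 := hμB u
      have hu' : 0 < ‖u‖ := norm_pos_iff.2 hu0
      simp only [map_smul, sub_apply, smul_apply,
        smul_eq_mul] at h2
      have h4 := (abs_le.1 h2).1
      have h5 : 0 < t * (μ * ‖u‖ ^ 2) := mul_pos ht.1 (by positivity)
      nlinarith [mul_le_mul_of_nonneg_left h3 ht.1.le]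
  have := hmono (Set.left_mem_Icc.2 zero_le_one) (Set.right_mem_Icc.2 zero_le_one) zero_lt_one
  simpa using this

/-! ### Linear functionals -/

/-- The bilinear form `form`, as a continuous bilinear map. -/
def formL (κ : ℝ) : V →L[ℝ] V →L[ℝ] ℝ :=
  κ • (ContinuousLinearMap.proj (R := ℝ) (φ := fun _ : Fin 4 => ℝ) 0).smulRight
      (ContinuousLinearMap.proj (R := ℝ) (φ := fun _ : Fin 4 => ℝ) 0)
    + (ContinuousLinearMap.proj (R := ℝ) (φ := fun _ : Fin 4 => ℝ) 1).smulRight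
      (ContinuousLinearMap.proj (R := ℝ) (φ := fun _ : Fin 4 => ℝ) 1)
    + (ContinuousLinearMap.proj (R := ℝ) (φ := fun _ : Fin 4 => ℝ) 2).smulRight
      (ContinuousLinearMap.proj (R := ℝ) (φ := fun _ : Fin 4 => ℝ) 2)
    + (ContinuousLinearMap.proj (R := ℝ) (φ := fun _ : Fin 4 => ℝ) 3).smulRight
      (ContinuousLinearMap.proj (R := ℝ) (φ := fun _ : Fin 4 => ℝ) 3)

theorem formL_apply (a b : V) : formL κ a b = form κ a b := by
  simp [formL, form]

/-- The bilinear form `tfun`, as a continuous bilinear map. -/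
def tfunL (κ : ℝ) : V →L[ℝ] V →L[ℝ] ℝ :=
  (ContinuousLinearMap.proj (R := ℝ) (φ := fun _ : Fin 4 => ℝ) 0).smulRight
      (ContinuousLinearMap.proj (R := ℝ) (φ := fun _ : Fin 4 => ℝ) 0)
    + κ • ((ContinuousLinearMap.proj (R := ℝ) (φ := fun _ : Fin 4 => ℝ) 1).smulRight
      (ContinuousLinearMap.proj (R := ℝ) (φ := fun _ : Fin 4 => ℝ) 1)
    + (ContinuousLinearMap.proj (R := ℝ) (φ := fun _ : Fin 4 => ℝ) 2).smulRight
      (ContinuousLinearMap.proj (R := ℝ) (φ := fun _ : Fin 4 => ℝ) 2)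
    + (ContinuousLinearMap.proj (R := ℝ) (φ := fun _ : Fin 4 => ℝ) 3).smulRight
      (ContinuousLinearMap.proj (R := ℝ) (φ := fun _ : Fin 4 => ℝ) 3))

theorem tfunL_apply (a b : V) : tfunL κ a b = tfun κ a b := by
  simp [tfunL, tfun]
  ring

/-- For a vector `n` tangent to `M_κ` at `p`, the linear functional on `ℝ⁴` whose kernel cuts
from `M_κ` the totally geodesic surface through `p` with normal `n`. -/
def lam (κ : ℝ) (p n y : V) : ℝ := form κ n y - (1 - κ ^ 2) * form κ n p * y 0

/-- The functional `lam`, as a continuous linear map. -/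
def lamL (κ : ℝ) (p n : V) : V →L[ℝ] ℝ :=
  formL κ n - ((1 - κ ^ 2) * formL κ n p) •
    ContinuousLinearMap.proj (R := ℝ) (φ := fun _ : Fin 4 => ℝ) 0

theorem lamL_apply (p n y : V) : lamL κ p n y = lam κ p n y := by
  simp [lamL, lam, formL_apply]

theorem lam_add (p n y z : V) : lam κ p n (y + z) = lam κ p n y + lam κ p n z := by
  simp only [← lamL_apply, map_add]
theorem lam_sub (p n y z : V) : lam κ p n (y - z) = lam κ p n y - lam κ p n z := by
  simp only [← lamL_apply, map_sub]
theorem lam_smul (p n y : V) (t : ℝ) : lam κ p n (t • y) = t * lam κ p n y := by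
  simp only [← lamL_apply, map_smul, smul_eq_mul]

theorem lam_self (hκ : κ = 0 ∨ κ = 1 ∨ κ = -1) {p n : V} (hp : p ∈ spaceForm κ)
    (hn : tfun κ p n = 0) : lam κ p n p = 0 := by
  rw [lam]
  have h1 := smul_form_base hκ hp hn
  rw [form_comm] at h1
  linear_combination κ * h1 - form κ n p * base_zero hκ hp

theorem lam_tangent (hκ : κ = 0 ∨ κ = 1 ∨ κ = -1) {p n y : V} (hp : p ∈ spaceForm κ)
    (hy : tfun κ p y = 0) : lam κ p n y = form κ n y := by
  rw [lam]
  linear_combination -form κ n p * tangent_zero' hκ hp hy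

theorem lam_geodesic (p n x v : V) (r : ℝ) :
    lam κ p n (geodesic κ x v r) = cosK κ r * lam κ p n x + sinK κ r * lam κ p n v := by
  rw [geodesic, lam_add, lam_smul, lam_smul]

theorem lam_geodesicVel (p n x v : V) (r : ℝ) :
    lam κ p n (geodesicVel κ x v r) = cosK κ r * lam κ p n v - κ * sinK κ r * lam κ p n x := by
  rw [geodesicVel, lam_sub, lam_smul, lam_smul]

theorem hasFDerivAt_tfun_self (p : V) :
    HasFDerivAt (fun x => tfun κ x x) ((2 : ℝ) • tfunL κ p) p := by
  have h := (tfunL κ).hasFDerivAt_of_bilinear (hasFDerivAt_id p) (hasFDerivAt_id p)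
  have e : (fun x => tfun κ x x) = fun y => (tfunL κ (id y)) (id y) := by
    funext x; simp [tfunL_apply]
  rw [e]
  refine h.congr_fderiv ?_
  ext u
  simp [tfunL_apply, tfun_comm _ p]
  ring

theorem contDiff_tfun_self : ContDiff ℝ ∞ (fun x => tfun κ x x) := by
  unfold tfun; fun_prop

theorem mem_spaceForm_of_tfun {x : V} (h : tfun κ x x = 1) (h' : κ = 1 ∨ 0 < x 0) :
    x ∈ spaceForm κ := by
  refine ⟨?_, h'⟩
  simp only [tfun] at h
  linear_combination h

theorem eventually_sign {p : V} (hp : p ∈ spaceForm κ) :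
    ∀ᶠ x : V in 𝓝 p, κ = 1 ∨ 0 < x 0 := by
  rcases hp.2 with h | h
  · exact Filter.Eventually.of_forall fun _ => Or.inl h
  · have : ContinuousAt (fun x : V => x 0) p := (continuous_apply 0).continuousAt
    filter_upwards [this.eventually_const_lt h] with x hx using Or.inr hx

/-! ### Local charts of surfaces -/

/-- `h` is a regular local equation on the open set `O` of the surface `S` of `M_κ` at `p`. -/
structure IsLocalEquation (κ : ℝ) (S : Set V) (p : V) (O : Set V) (h : V → ℝ) : Prop where
  isOpen : IsOpen O
  mem : p ∈ O
  mem_surface : p ∈ S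
  contDiffOn : ContDiffOn ℝ ∞ h O
  mem_iff : ∀ x ∈ O, x ∈ S ↔ x ∈ spaceForm κ ∧ h x = 0
  regular : ∃ v ∈ tangentSpace κ p, fderiv ℝ h p v ≠ 0

theorem IsSmoothSurface.exists_isLocalEquation {S : Set V} (hS : IsSmoothSurface κ S) {p : V}
    (hp : p ∈ S) : ∃ O h, IsLocalEquation κ S p O h := by
  obtain ⟨O, h, h1, h2, h3, h4, h5⟩ := hS.2 p hp
  exact ⟨O, h, h1, h2, hp, h3, h4, h5⟩

namespace IsLocalEquation

variable {S O : Set V} {p : V} {h : V → ℝ}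

theorem contDiffAt (H : IsLocalEquation κ S p O h) : ContDiffAt ℝ ∞ h p :=
  H.contDiffOn.contDiffAt (H.isOpen.mem_nhds H.mem)

theorem hasFDerivAt (H : IsLocalEquation κ S p O h) : HasFDerivAt h (fderiv ℝ h p) p :=
  (H.contDiffAt.differentiableAt (by simp)).hasFDerivAt

theorem mem_spaceForm (H : IsLocalEquation κ S p O h) : p ∈ spaceForm κ :=
  ((H.mem_iff p H.mem).1 H.mem_surface).1

theorem apply_eq_zero (H : IsLocalEquation κ S p O h) : h p = 0 :=
  ((H.mem_iff p H.mem).1 H.mem_surface).2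

/-- The tangent plane, as the kernel of the differentials of the equations. -/
def plane (κ : ℝ) (p : V) (h : V → ℝ) : Submodule ℝ V :=
  LinearMap.ker (tfunL κ p : V →ₗ[ℝ] ℝ) ⊓ LinearMap.ker (fderiv ℝ h p : V →ₗ[ℝ] ℝ)

theorem mem_plane {u : V} : u ∈ plane κ p h ↔ tfun κ p u = 0 ∧ fderiv ℝ h p u = 0 := by
  simp [plane, tfunL_apply]

/-- A local parametrization of the surface by its tangent plane. -/
theorem exists_chart (H : IsLocalEquation κ S p O h) :
    ∃ ψ : plane κ p h → V, ContDiffAt ℝ ∞ ψ 0 ∧ ψ 0 = p ∧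
      HasFDerivAt ψ (plane κ p h).subtypeL 0 ∧ (∀ᶠ u in 𝓝 0, ψ u ∈ S) ∧
      ∃ π : V →L[ℝ] plane κ p h, ∀ᶠ x in 𝓝 p, x ∈ S → ψ (π (x - p)) = x := by
  obtain ⟨v, hv, hv'⟩ := H.regular
  have hv : tfun κ p v = 0 := hv
  have hpp := tfun_self H.mem_spaceForm
  set K := plane κ p h with hK
  set g : V → ℝ × ℝ := fun x => (tfun κ x x, h x) with hg
  set g' : V →L[ℝ] ℝ × ℝ := ((2 : ℝ) • tfunL κ p).prod (fderiv ℝ h p) with hg'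
  have hgd : HasFDerivAt g g' p := (hasFDerivAt_tfun_self p).prodMk H.hasFDerivAt
  have hgc : ContDiffAt ℝ ∞ g p := contDiff_tfun_self.contDiffAt.prodMk H.contDiffAt
  -- Linear coordinates of ℝ⁴ adapted to S at p: the tangent plane, the direction p transverse to
  -- M_κ, and v, which is tangent to M_κ but transverse to S.
  set y' : K × (ℝ × ℝ) →L[ℝ] V := K.subtypeL.comp (ContinuousLinearMap.fst ℝ K (ℝ × ℝ))
    + ((ContinuousLinearMap.fst ℝ ℝ ℝ).comp (ContinuousLinearMap.snd ℝ K (ℝ × ℝ))).smulRight p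
    + ((ContinuousLinearMap.snd ℝ ℝ ℝ).comp (ContinuousLinearMap.snd ℝ K (ℝ × ℝ))).smulRight v
    with hy'
  have hy'a : ∀ (u : K) (s t : ℝ), y' (u, (s, t)) = u + s • p + t • v := by
    intro u s t; simp [hy']
  have hyd : ∀ z, HasFDerivAt (fun z => p + y' z) y' z := fun z =>
    y'.hasFDerivAt.const_add p
  have hyc : ContDiffAt ℝ ∞ (fun z => p + y' z) 0 := by fun_prop
  set f : K × (ℝ × ℝ) → ℝ × ℝ := fun z => g (p + y' z) with hf
  have hp0 : p + y' 0 = p := by simp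
  have hfd : HasFDerivAt f (g'.comp y') 0 := by
    rw [← hp0] at hgd
    exact HasFDerivAt.comp (0 : K × (ℝ × ℝ)) hgd (hyd 0)
  have hfc : ContDiffAt ℝ ∞ f 0 := by
    rw [← hp0] at hgc
    exact ContDiffAt.comp (0 : K × (ℝ × ℝ)) hgc hyc
  -- Both equations have zero differential along the tangent plane, so the implicit function has
  -- zero derivative at 0 and the differential of the chart is the inclusion.
  have hinl : fderiv ℝ f 0 ∘L .inl ℝ K (ℝ × ℝ) = 0 := by
    rw [hfd.fderiv]
    ext u
    · have := (mem_plane.1 u.2).1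
      simp [hy'a, hg', tfunL_apply, this]
    · have := (mem_plane.1 u.2).2
      simp [hy'a, hg', this]
  have hinv : (fderiv ℝ f 0 ∘L .inr ℝ K (ℝ × ℝ)).IsInvertible := by
    apply isInvertible_of_injective
    rintro ⟨s, t⟩ hst
    rw [hfd.fderiv, ContinuousLinearMap.comp_apply, ContinuousLinearMap.inr_apply,
      ContinuousLinearMap.comp_apply, hy'a, hg', ContinuousLinearMap.prod_apply] at hst
    have hs : s = 0 := by
      have := congrArg Prod.fst hst
      simpa [tfunL_apply, tfun_add, tfun_smul, hv, hpp] using this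
    have ht : t = 0 := by
      have := congrArg Prod.snd hst
      simpa [hs, hv'] using this
    simp [hs, ht]
  have hn : (∞ : WithTop ℕ∞) ≠ 0 := by simp
  set σ : K → ℝ × ℝ := hfc.implicitFunction hn hinv with hσ
  have hσ0 : σ 0 = 0 := hfc.implicitFunction_apply_self hn hinv
  have hσc : ContDiffAt ℝ ∞ σ 0 := hfc.contDiffAt_implicitFunction hn hinv
  have hσd : HasFDerivAt σ (0 : K →L[ℝ] ℝ × ℝ) 0 := by
    have := (hfc.hasStrictFDerivAt_implicitFunction hn hinv).hasFDerivAt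
    rw [hinl, ContinuousLinearMap.comp_zero, neg_zero] at this
    exact this
  have hσe : ∀ᶠ u in 𝓝 0, f (u, σ u) = f 0 := hfc.eventually_apply_implicitFunction hn hinv
  have hσu : ∀ᶠ z in 𝓝 (0 : K × (ℝ × ℝ)), f z = f 0 ↔ σ z.1 = z.2 :=
    hfc.eventually_apply_eq_iff_implicitFunction hn hinv
  have hf0 : f 0 = (1, 0) := by
    simp only [hf, hp0, hg, hpp, H.apply_eq_zero]
  set ψ : K → V := fun u => p + y' (u, σ u) with hψ
  have hψ0 : ψ 0 = p := by
    simp only [hψ, hσ0]; exact hp0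
  have hψd : HasFDerivAt ψ K.subtypeL 0 := by
    have h1 := (hyd ((0 : K), σ 0)).comp (0 : K) ((hasFDerivAt_id (0 : K)).prodMk hσd)
    refine h1.congr_fderiv ?_
    ext1 u
    have h2 := hy'a u 0 0
    simp only [zero_smul, add_zero] at h2
    exact h2
  have hψc : ContDiffAt ℝ ∞ ψ 0 := by
    have : ContDiffAt ℝ ∞ (fun u : K => (u, σ u)) 0 := contDiffAt_id.prodMk hσc
    exact contDiffAt_const.add (y'.contDiff.contDiffAt.comp (0 : K) this)
  refine ⟨ψ, hψc, hψ0, hψd, ?_, ?_⟩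
  · have h1 := hψd.continuousAt.eventually
      (by rw [hψ0]; exact (H.isOpen.mem_nhds H.mem) : ∀ᶠ x in 𝓝 (ψ 0), x ∈ O)
    have h2 := hψd.continuousAt.eventually (by rw [hψ0]; exact eventually_sign H.mem_spaceForm)
    filter_upwards [hσe, h1, h2] with u hu h1 h2
    rw [hf0] at hu
    have h3 : tfun κ (ψ u) (ψ u) = 1 := congrArg Prod.fst hu
    have h4 : h (ψ u) = 0 := congrArg Prod.snd hu
    exact (H.mem_iff _ h1).2 ⟨mem_spaceForm_of_tfun h3 h2, h4⟩
  -- Here π projects to the tangent plane along p and v, and `Z x` are the coordinates of x. The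
  -- uniqueness part of the implicit function theorem then puts every point of S near p in the image
  -- of the chart.
  · set q : V →L[ℝ] V := ContinuousLinearMap.id ℝ V - (tfunL κ p).smulRight p with hq
    set τ : V →L[ℝ] ℝ := (fderiv ℝ h p v)⁻¹ • (fderiv ℝ h p).comp q with hτ
    set π₀ : V →L[ℝ] V := q - τ.smulRight v with hπ₀
    have hmem : ∀ z, π₀ z ∈ K := by
      intro z
      rw [hK, mem_plane]
      constructor
      · simp [hπ₀, hq, tfun_sub, tfun_smul, tfunL_apply, hpp, hv]
      · simp [hπ₀, hτ]
        field_simp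
        simp
    set π : V →L[ℝ] K := π₀.codRestrict K hmem with hπ
    refine ⟨π, ?_⟩
    set Z : V → K × (ℝ × ℝ) := fun x => (π (x - p), (tfun κ p (x - p), τ (x - p))) with hZ
    have hyZ : ∀ x, p + y' (Z x) = x := by
      intro x
      simp only [hZ, hy'a, hπ, ContinuousLinearMap.coe_codRestrict_apply, hπ₀, hq]
      simp only [sub_apply, ContinuousLinearMap.smulRight_apply, tfunL_apply,
        ContinuousLinearMap.id_apply]
      abel
    have hZc : Filter.Tendsto Z (𝓝 p) (𝓝 0) := by
      have h1 : Continuous Z := by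
        simp only [hZ, ← tfunL_apply]
        fun_prop
      have h2 : Z p = 0 := by simp [hZ, tfun]
      rw [← h2]
      exact h1.continuousAt
    filter_upwards [hZc.eventually hσu, H.isOpen.mem_nhds H.mem] with x hx hxO hxS
    obtain ⟨h1, h2⟩ := (H.mem_iff x hxO).1 hxS
    have h3 : f (Z x) = f 0 := by
      rw [hf0]
      simp only [hf, hyZ, hg, tfun_self h1, h2]
    have h4 := hx.1 h3
    have h5 : (π (x - p), σ (π (x - p))) = Z x := by
      rw [show π (x - p) = (Z x).1 from rfl, h4]
    simp only [hψ]
    rw [h5, hyZ]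

end IsLocalEquation

end

/-! ### Tangent hyperplanes as kernels, and one-sidedness of convex surfaces -/

section

variable {κ : ℝ}

/-! ### Tangent planes and normals -/

namespace IsLocalEquation

variable {S O : Set V} {p : V} {h : V → ℝ}

theorem mem_plane_of_hasDerivAt (H : IsLocalEquation κ S p O h) {c : ℝ → V} {u : V} {s₀ : ℝ}
    (hc : HasDerivAt c u s₀) (h0 : c s₀ = p) (hS : ∀ᶠ s in 𝓝 s₀, c s ∈ S) :
    u ∈ plane κ p h := by
  subst h0
  have hO := hc.continuousAt.eventually (H.isOpen.mem_nhds H.mem)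
  rw [mem_plane]
  constructor
  · have h1 := (hasFDerivAt_tfun_self (κ := κ) (c s₀)).comp_hasDerivAt s₀ hc
    have h2 : (fun s => tfun κ (c s) (c s)) =ᶠ[𝓝 s₀] fun _ => 1 := by
      filter_upwards [hS, hO] with s hs hs'
      exact tfun_self ((H.mem_iff _ hs').1 hs).1
    have h3 := (h1.congr_of_eventuallyEq h2.symm).unique (hasDerivAt_const s₀ (1 : ℝ))
    simpa [tfunL_apply] using h3
  · have h1 := H.hasFDerivAt.comp_hasDerivAt s₀ hc
    have h2 : (fun s => h (c s)) =ᶠ[𝓝 s₀] fun _ => 0 := by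
      filter_upwards [hS, hO] with s hs hs'
      exact ((H.mem_iff _ hs').1 hs).2
    exact (h1.congr_of_eventuallyEq h2.symm).unique (hasDerivAt_const s₀ (0 : ℝ))

/-- The set of velocities is a linear subspace because the chart realizes every vector in the kernel
of the equations as the velocity of a curve in S. -/
theorem surfaceTangent_eq (H : IsLocalEquation κ S p O h) :
    surfaceTangent S p = plane κ p h := by
  ext u
  constructor
  · rintro ⟨c, hc, h0, hS, rfl⟩
    exact H.mem_plane_of_hasDerivAt (hc.differentiableAt (by simp)).hasDerivAt h0 hS
  · intro hu
    obtain ⟨ψ, hψ, hψ0, hψd, hψS, -⟩ := H.exists_chart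
    set w : plane κ p h := ⟨u, hu⟩
    have h0 : (0 : ℝ) • w = 0 := zero_smul _ _
    have hcont : ContDiffAt ℝ ∞ (fun s : ℝ => s • w) 0 := by fun_prop
    have hder : HasDerivAt (fun s : ℝ => s • w) w 0 := by
      simpa using (hasDerivAt_id (0 : ℝ)).smul_const w
    rw [← h0] at hψ hψd hψS
    refine ⟨fun s => ψ (s • w), hψ.comp (0 : ℝ) hcont, by simp only [h0, hψ0],
      hcont.continuousAt.eventually hψS, ?_⟩
    exact (hψd.comp_hasDerivAt (0 : ℝ) hder).deriv

end IsLocalEquation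

variable {S : Set V} {p : V}

theorem IsSmoothSurface.mem_surfaceTangent (hS : IsSmoothSurface κ S) {c : ℝ → V} {u : V}
    {s₀ : ℝ} (hc : HasDerivAt c u s₀) (hcS : ∀ᶠ s in 𝓝 s₀, c s ∈ S) :
    u ∈ surfaceTangent S (c s₀) := by
  obtain ⟨O, h, H⟩ := hS.exists_isLocalEquation hcS.self_of_nhds
  rw [H.surfaceTangent_eq]
  exact H.mem_plane_of_hasDerivAt hc rfl hcS

theorem IsSmoothSurface.tfun_eq_zero (hS : IsSmoothSurface κ S) (hp : p ∈ S) {u : V}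
    (hu : u ∈ surfaceTangent S p) : tfun κ p u = 0 := by
  obtain ⟨O, h, H⟩ := hS.exists_isLocalEquation hp
  rw [H.surfaceTangent_eq] at hu
  exact (IsLocalEquation.mem_plane.1 hu).1

/-- `n` is a unit normal of `S` at `p`. -/
def IsNormal (κ : ℝ) (S : Set V) (p n : V) : Prop :=
  tfun κ p n = 0 ∧ form κ n n = 1 ∧ ∀ u ∈ surfaceTangent S p, form κ n u = 0

theorem IsUnitNormalNear.isNormal {n : V → V} (hn : IsUnitNormalNear κ S p n) :
    ∀ᶠ x in 𝓝[S] p, IsNormal κ S x (n x) := hn.2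

theorem IsUnitNormalNear.isNormal_self {n : V → V} (hn : IsUnitNormalNear κ S p n) (hp : p ∈ S) :
    IsNormal κ S p (n p) := hn.2.self_of_nhdsWithin hp

theorem IsNormal.lam_normal (hκ : κ = 0 ∨ κ = 1 ∨ κ = -1) {n : V} (hp : p ∈ spaceForm κ)
    (hn : IsNormal κ S p n) : lam κ p n n = 1 := by
  rw [lam_tangent hκ hp hn.1, hn.2.1]

/-- The point p, the tangent plane and n together span ℝ⁴, and `lam` kills the first two and is 1 on
n, so it reads off the coefficient of n. Containment in a tangent surface thus becomes one linear
equation. -/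
theorem mem_span_iff_lam_eq_zero (hκ : κ = 0 ∨ κ = 1 ∨ κ = -1) (hS : IsSmoothSurface κ S)
    (hp : p ∈ S) {n : V} (hn : IsNormal κ S p n) (y : V) :
    y ∈ Submodule.span ℝ (insert p (surfaceTangent S p)) ↔ lam κ p n y = 0 := by
  have hpM := hS.1 hp
  constructor
  · intro hy
    have : Submodule.span ℝ (insert p (surfaceTangent S p)) ≤
        LinearMap.ker (lamL κ p n : V →ₗ[ℝ] ℝ) := by
      rw [Submodule.span_le, Set.insert_subset_iff]
      refine ⟨?_, fun u hu => ?_⟩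
      · simpa [lamL_apply] using lam_self hκ hpM hn.1
      · simpa [lamL_apply, lam_tangent hκ hpM (hS.tfun_eq_zero hp hu)] using hn.2.2 u hu
    simpa [lamL_apply] using this hy
  · intro hy
    obtain ⟨O, h, H⟩ := hS.exists_isLocalEquation hp
    have hh : fderiv ℝ h p n ≠ 0 := by
      intro h0
      have hmem : n ∈ surfaceTangent S p := by
        rw [H.surfaceTangent_eq]
        exact IsLocalEquation.mem_plane.2 ⟨hn.1, h0⟩
      have := hn.2.2 n hmem
      rw [hn.2.1] at this
      exact one_ne_zero this
    set z := y - tfun κ p y • p with hz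
    have hzt : tfun κ p z = 0 := by
      rw [hz, tfun_sub, tfun_smul, tfun_self hpM]; ring
    set u := z - (fderiv ℝ h p z / fderiv ℝ h p n) • n with hu
    have hut : u ∈ surfaceTangent S p := by
      rw [H.surfaceTangent_eq]
      refine IsLocalEquation.mem_plane.2 ⟨?_, ?_⟩
      · rw [hu, tfun_sub, tfun_smul, hzt, hn.1]; ring
      · rw [hu, map_sub, map_smul, smul_eq_mul, div_mul_cancel₀ _ hh, sub_self]
    have h1 : lam κ p n z = 0 := by
      rw [hz, lam_sub, lam_smul, hy, lam_self hκ hpM hn.1]; ring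
    have h2 : fderiv ℝ h p z / fderiv ℝ h p n = 0 := by
      have h3 := hn.2.2 u hut
      rw [← lam_tangent hκ hpM (hS.tfun_eq_zero hp hut), hu, lam_sub, h1, lam_smul,
        hn.lam_normal hκ hpM] at h3
      linarith
    have h4 : y = tfun κ p y • p + u := by
      rw [hu, h2, hz]; simp
    rw [h4]
    exact Submodule.add_mem _ (Submodule.smul_mem _ _ (Submodule.subset_span (Or.inl rfl)))
      (Submodule.subset_span (Or.inr hut))

/-! ### One-sidedness -/

theorem hasFDerivAt_lamL {n : V → V} {n' : V →L[ℝ] V} (hn : HasFDerivAt n n' p) :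
    HasFDerivAt (fun y => lamL κ y (n y)) ((formL κ).comp n' -
      ((1 - κ ^ 2) • ((formL κ).precompR V (n p) (ContinuousLinearMap.id ℝ V) +
        (formL κ).precompL V n' p)).smulRight
        (ContinuousLinearMap.proj (R := ℝ) (φ := fun _ : Fin 4 => ℝ) 0)) p := by
  have h1 : HasFDerivAt (fun y => formL κ (n y)) ((formL κ).comp n') p :=
    (formL κ).hasFDerivAt.comp p hn
  have h2 := (formL κ).hasFDerivAt_of_bilinear hn (hasFDerivAt_id p)
  have h3 := (h2.const_mul (1 - κ ^ 2)).smul_const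
    (ContinuousLinearMap.proj (R := ℝ) (φ := fun _ : Fin 4 => ℝ) 0)
  simp only [id_eq] at h3
  exact h1.sub h3

/-- The derivative of the field of functionals `lam` along a unit normal field, in a direction
`u` tangent to the surface. -/
theorem exists_hasFDerivAt_lamL {n : V → V} (hn : IsUnitNormalNear κ S p n)
    (hp : p ∈ S) : ∃ D : V →L[ℝ] V →L[ℝ] ℝ, HasFDerivAt (fun y => lamL κ y (n y)) D p ∧
      ∀ u ∈ surfaceTangent S p, ∀ y, D u y = lam κ p (fderiv ℝ n p u) y := by
  refine ⟨_, hasFDerivAt_lamL (hn.1.differentiableAt (by simp)).hasFDerivAt, fun u hu y => ?_⟩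
  have := (hn.isNormal_self hp).2.2 u hu
  simp [formL_apply, this, lam]

/-- In a chart, the height above the tangent hyperplane has a critical point at p, where its second
derivative is the second fundamental form u ↦ -⟨dn u, u⟩; definiteness makes the minimum strict. -/
theorem IsSmoothSurface.eventually_lam_pos (hκ : κ = 0 ∨ κ = 1 ∨ κ = -1)
    (hS : IsSmoothSurface κ S) (hp : p ∈ S) {n : V → V} (hn : IsUnitNormalNear κ S p n)
    (hd : ∀ u ∈ surfaceTangent S p, u ≠ 0 → 0 < form κ (-(fderiv ℝ n p u)) u) :
    ∀ᶠ x in 𝓝 p, x ∈ S → x ≠ p → 0 < lam κ p (n p) x := by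
  obtain ⟨O, h, H⟩ := hS.exists_isLocalEquation hp
  obtain ⟨ψ, hψ, hψ0, hψd, hψS, π, hπ⟩ := H.exists_chart
  have hpM := hS.1 hp
  have hnp := hn.isNormal_self hp
  obtain ⟨D, hD, hDu⟩ := exists_hasFDerivAt_lamL hn hp
  -- The functional at y ∈ S kills T_yS, so subtracting it does not change the differential of the
  -- height. The difference G vanishes at p, so the second derivative of the chart does not
  -- contribute when G(ψ u) ∘ ψ'(u) is differentiated at 0.
  set G : V → V →L[ℝ] ℝ := fun y => lamL κ p (n p) - lamL κ y (n y) with hG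
  have hGd : HasFDerivAt G (-D) p := by
    have := hD.const_sub (lamL κ p (n p))
    exact this
  set f' : IsLocalEquation.plane κ p h → IsLocalEquation.plane κ p h →L[ℝ] ℝ :=
    fun u => (G (ψ u)).comp (fderiv ℝ ψ u) with hf'
  have hψS' : Filter.Tendsto ψ (𝓝 0) (𝓝[S] p) := by
    rw [tendsto_nhdsWithin_iff]
    refine ⟨?_, hψS⟩
    have := hψd.continuousAt.tendsto
    rwa [hψ0] at this
  have hf : ∀ᶠ u in 𝓝 0, HasFDerivAt (fun u => lam κ p (n p) (ψ u)) (f' u) u := by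
    have h1 : ∀ᶠ u in 𝓝 0, ContDiffAt ℝ 1 ψ u :=
      (hψ.of_le (by exact_mod_cast le_top)).eventually (by simp)
    filter_upwards [h1, hψS.eventually_nhds, hψS'.eventually hn.isNormal] with u h1 h2 h3
    have h4 : HasFDerivAt ψ (fderiv ℝ ψ u) u := (h1.differentiableAt (by simp)).hasFDerivAt
    have h5 := (lamL κ p (n p)).hasFDerivAt.comp u h4
    have h6 : (fun u => lam κ p (n p) (ψ u)) = lamL κ p (n p) ∘ ψ := by
      funext u; simp [lamL_apply]
    rw [h6]
    refine h5.congr_fderiv ?_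
    ext w
    have hder : HasDerivAt (fun s : ℝ => u + s • w) w 0 := by
      simpa using ((hasDerivAt_id (0 : ℝ)).smul_const w).const_add u
    have h0 : u + (0 : ℝ) • w = u := by simp
    rw [← h0] at h4 h2
    have h7 : fderiv ℝ ψ u w ∈ surfaceTangent S (ψ u) := by
      have h8 := hS.mem_surfaceTangent (h4.comp_hasDerivAt (0 : ℝ) hder)
        (hder.continuousAt.eventually h2)
      simpa only [h0, Function.comp_apply] using h8
    have h9 : lam κ (ψ u) (n (ψ u)) (fderiv ℝ ψ u w) = 0 := by
      rw [h0] at h2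
      have hu := h2.self_of_nhds
      rw [lam_tangent hκ (hS.1 hu) (hS.tfun_eq_zero hu h7)]
      exact h3.2.2 _ h7
    simp [hf', hG, lamL_apply, h9]
  have hG0 : G (ψ 0) = 0 := by simp [hG, hψ0]
  have hf0 : f' 0 = 0 := by simp only [hf', hG0, ContinuousLinearMap.zero_comp]
  have hGψ : HasFDerivAt (fun u => G (ψ u)) ((-D).comp (IsLocalEquation.plane κ p h).subtypeL) 0 := by
    rw [← hψ0] at hGd
    exact hGd.comp 0 hψd
  have hψ2 : DifferentiableAt ℝ (fderiv ℝ ψ) 0 :=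
    (hψ.fderiv_right (m := 1) (by norm_cast)).differentiableAt (by simp)
  have hB := hGψ.clm_comp hψ2.hasFDerivAt
  have hev := eventually_lt_of_second_deriv_pos hf hf0 hB (by
    intro u hu
    have hu' : (u : V) ∈ surfaceTangent S p := by
      rw [H.surfaceTangent_eq]; exact u.2
    have h1 := hd u hu' (by simpa using hu)
    simp only [hG0, hψd.fderiv]
    simp only [map_zero, ContinuousLinearMap.zero_comp, zero_add,
      ContinuousLinearMap.comp_apply, ContinuousLinearMap.flip_apply,
      ContinuousLinearMap.compL_apply, Submodule.subtypeL_apply, neg_apply]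
    rw [hDu _ hu', lam_tangent hκ hpM (hS.tfun_eq_zero hp hu'), ← form_neg_left]
    exact h1)
  have hlim : Filter.Tendsto (fun x => π (x - p)) (𝓝 p) (𝓝 0) := by
    have h1 : Continuous (fun x => π (x - p)) := by fun_prop
    have h2 := h1.tendsto p
    simpa using h2
  filter_upwards [hπ, hlim.eventually hev] with x h1 h2 hxS hxp
  have h3 : π (x - p) ≠ 0 := by
    intro h0
    have := h1 hxS
    rw [h0, hψ0] at this
    exact hxp this.symm
  have h4 := h2 h3
  rw [h1 hxS, hψ0, lam_self hκ hpM hnp.1] at h4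
  exact h4

theorem continuous_lam (p n : V) : Continuous (lam κ p n) := by
  have : lam κ p n = lamL κ p n := by funext y; rw [lamL_apply]
  rw [this]; fun_prop

/-- From local to global: by strict convexity the functional vanishes on S only at p, and near p it
is positive. A negative value elsewhere would split S into two nonempty relatively open pieces, the
negative set and the positive set together with a neighbourhood of p. -/
theorem IsQuadraticallyConvex.lam_pos (hκ : κ = 0 ∨ κ = 1 ∨ κ = -1)
    (hS : IsQuadraticallyConvex κ S) (hp : p ∈ S) {n : V → V} (hn : IsUnitNormalNear κ S p n)
    (hd : ∀ u ∈ surfaceTangent S p, u ≠ 0 → 0 < form κ (-(fderiv ℝ n p u)) u) :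
    ∀ x ∈ S, x ≠ p → 0 < lam κ p (n p) x := by
  have hnp := hn.isNormal_self hp
  have hne : ∀ x ∈ S, x ≠ p → lam κ p (n p) x ≠ 0 := by
    intro x hx hxp h0
    exact hxp (hS.strictlyConvex p hp x hx ⟨hS.smooth.1 hx,
      (mem_span_iff_lam_eq_zero hκ hS.smooth hp hnp x).2 h0⟩)
  have hev := hS.smooth.eventually_lam_pos hκ hp hn hd
  obtain ⟨O, hO, hOo, hpO⟩ := eventually_nhds_iff.1 hev
  intro x hx hxp
  by_contra hneg
  have hneg' : lam κ p (n p) x < 0 := lt_of_le_of_ne (not_lt.1 hneg) (hne x hx hxp)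
  have hc := continuous_lam (κ := κ) p (n p)
  have hself : lam κ p (n p) p = 0 := lam_self hκ (hS.smooth.1 hp) hnp.1
  obtain ⟨y, hyS, hyU, hyW⟩ := hS.connected.isPreconnected {y | lam κ p (n p) y < 0}
    ({y | 0 < lam κ p (n p) y} ∪ O) (isOpen_lt hc continuous_const)
    ((isOpen_lt continuous_const hc).union hOo) (by
      intro y hy
      rcases eq_or_ne y p with rfl | hyp
      · exact Or.inr (Or.inr hpO)
      rcases lt_or_gt_of_ne (hne y hy hyp) with h | h
      · exact Or.inl h
      · exact Or.inr (Or.inl h)) ⟨x, hx, hneg'⟩ ⟨p, hp, Or.inr hpO⟩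
  have hyU : lam κ p (n p) y < 0 := hyU
  rcases hyW with h | h
  · exact absurd hyU (not_lt.2 (le_of_lt h))
  · rcases eq_or_ne y p with rfl | hyp
    · linarith
    · exact absurd hyU (not_lt.2 (hO y h hyS hyp).le)

end

/-! ### Tangency points: smooth dependence, and at most two per geodesic -/

section

variable {κ : ℝ} {S : Set V} {p : V}

/-! ### Smooth dependence of the tangency point -/

theorem contDiffAt_form {E : Type*} [NormedAddCommGroup E] [NormedSpace ℝ E] {a b : E → V}
    {z : E} (ha : ContDiffAt ℝ ∞ a z) (hb : ContDiffAt ℝ ∞ b z) :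
    ContDiffAt ℝ ∞ (fun y => form κ (a y) (b y)) z := by
  simp only [← formL_apply]
  exact ((formL κ).contDiff.contDiffAt.comp z ha).clm_apply hb

theorem contDiffAt_tfun {E : Type*} [NormedAddCommGroup E] [NormedSpace ℝ E] {a b : E → V}
    {z : E} (ha : ContDiffAt ℝ ∞ a z) (hb : ContDiffAt ℝ ∞ b z) :
    ContDiffAt ℝ ∞ (fun y => tfun κ (a y) (b y)) z := by
  simp only [← tfunL_apply]
  exact ((tfunL κ).contDiff.contDiffAt.comp z ha).clm_apply hb

theorem contDiffAt_lam {E : Type*} [NormedAddCommGroup E] [NormedSpace ℝ E] {a b c : E → V}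
    {z : E} (ha : ContDiffAt ℝ ∞ a z) (hb : ContDiffAt ℝ ∞ b z) (hc : ContDiffAt ℝ ∞ c z) :
    ContDiffAt ℝ ∞ (fun y => lam κ (a y) (b y) (c y)) z := by
  have h0 : ContDiffAt ℝ ∞ (fun y => c y 0) z := contDiffAt_pi.1 hc 0
  exact (contDiffAt_form hb hc).sub ((contDiffAt_const.mul (contDiffAt_form hb ha)).mul h0)

theorem mem_span_of_functional (ℓ : V →ₗ[ℝ] ℝ) (hℓ : ℓ ≠ 0) {a b c d : V}
    (hli : LinearIndependent ℝ ![a, b, c]) (ha : ℓ a = 0) (hb : ℓ b = 0) (hc : ℓ c = 0)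
    (hd : ℓ d = 0) : d ∈ Submodule.span ℝ (Set.range ![a, b, c]) := by
  by_contra hn
  have h4 : LinearIndependent ℝ ![d, a, b, c] := linearIndependent_finCons.2 ⟨hli, hn⟩
  have htop : Submodule.span ℝ (Set.range ![d, a, b, c]) = ⊤ :=
    h4.span_eq_top_of_card_eq_finrank (by simp)
  have hle : Submodule.span ℝ (Set.range ![d, a, b, c]) ≤ LinearMap.ker ℓ := by
    rw [Submodule.span_le]
    rintro _ ⟨i, rfl⟩
    fin_cases i <;> simp [ha, hb, hc, hd]
  rw [htop, top_le_iff, LinearMap.ker_eq_top] at hle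
  exact hℓ hle

/-- Differentiating the tangency of n along a curve in S gives tfun p (dn u) + κ⟨u, n⟩ = 0, and the
second term vanishes. -/
theorem IsSmoothSurface.tfun_fderiv_normal (hκ : κ = 0 ∨ κ = 1 ∨ κ = -1)
    (hS : IsSmoothSurface κ S) (hp : p ∈ S) {n : V → V}
    (hn : IsUnitNormalNear κ S p n) {u : V} (hu : u ∈ surfaceTangent S p) :
    tfun κ p (fderiv ℝ n p u) = 0 := by
  have htu := hS.tfun_eq_zero hp hu
  have hnu := (hn.isNormal_self hp).2.2 u hu
  obtain ⟨c, hc, rfl, hcS, rfl⟩ := hu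
  have hcd : HasDerivAt c (deriv c 0) 0 := (hc.differentiableAt (by simp)).hasDerivAt
  have hnd := (hn.1.differentiableAt (by simp)).hasFDerivAt.comp_hasDerivAt 0 hcd
  have h1 : HasDerivAt (fun s => tfunL κ (c s) (n (c s)))
      (tfunL κ (c 0) (fderiv ℝ n (c 0) (deriv c 0)) + tfunL κ (deriv c 0) (n (c 0))) 0 :=
    (((tfunL κ).hasFDerivAt.comp_hasDerivAt 0 hcd).clm_apply hnd).congr_deriv (add_comm _ _)
  have hct : Filter.Tendsto c (𝓝 0) (𝓝[S] (c 0)) :=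
    tendsto_nhdsWithin_iff.2 ⟨hc.continuousAt, hcS⟩
  have h2 : (fun s => tfunL κ (c s) (n (c s))) =ᶠ[𝓝 0] fun _ => 0 := by
    filter_upwards [hct.eventually hn.isNormal] with s hs
    rw [tfunL_apply, hs.1]
  have h3 := (h1.congr_of_eventuallyEq h2.symm).unique (hasDerivAt_const (0 : ℝ) (0 : ℝ))
  rw [tfunL_apply, tfunL_apply, tfun_tangent hκ (hS.1 hp) htu, form_comm, hnu] at h3
  linarith

/-- Near an oriented geodesic contained in the tangent surface at `p`, but not through `p`,
the tangency point is a smooth function of the geodesic. -/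
theorem IsSmoothSurface.exists_tangencyPoint (hκ : κ = 0 ∨ κ = 1 ∨ κ = -1)
    (hS : IsSmoothSurface κ S) (hp : p ∈ S) {n : V → V}
    (hn : IsUnitNormalNear κ S p n)
    (hd : ∀ u ∈ surfaceTangent S p, u ≠ 0 → 0 < form κ (-(fderiv ℝ n p u)) u)
    {x v : V} (hli : LinearIndependent ℝ ![p, x, v]) (hx : lam κ p (n p) x = 0)
    (hv : lam κ p (n p) v = 0) :
    ∃ P : V × V → V, ContDiffAt ℝ ∞ P (x, v) ∧ P (x, v) = p ∧
      (∀ᶠ z in 𝓝 (x, v), P z ∈ S ∧ IsNormal κ S (P z) (n (P z)) ∧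
        lam κ (P z) (n (P z)) z.1 = 0 ∧ lam κ (P z) (n (P z)) z.2 = 0) ∧
      ∀ᶠ z : V × V in 𝓝 (x, v), lam κ p (n p) z.1 = 0 → lam κ p (n p) z.2 = 0 → P z = p := by
  have hpM := hS.1 hp
  have hnp := hn.isNormal_self hp
  obtain ⟨O, h, H⟩ := hS.exists_isLocalEquation hp
  obtain ⟨D, hD, hDu⟩ := exists_hasFDerivAt_lamL hn hp
  -- Four equations for the four coordinates of the tangency point: it lies in M_κ and in S, and its
  -- tangent hyperplane contains the base point and the velocity of the geodesic.
  set f : (V × V) × V → V := fun z =>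
    ![tfun κ z.2 z.2, h z.2, lam κ z.2 (n z.2) z.1.1, lam κ z.2 (n z.2) z.1.2] with hf
  have hfc : ContDiffAt ℝ ∞ f ((x, v), p) := by
    have hs : ContDiffAt ℝ ∞ (fun z : (V × V) × V => z.2) ((x, v), p) := contDiffAt_snd
    have hns : ContDiffAt ℝ ∞ (fun z : (V × V) × V => n z.2) ((x, v), p) :=
      ContDiffAt.comp ((x, v), p) (g := n) hn.1 hs
    have hhs : ContDiffAt ℝ ∞ (fun z : (V × V) × V => h z.2) ((x, v), p) :=
      ContDiffAt.comp ((x, v), p) (g := h) H.contDiffAt hs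
    rw [contDiffAt_pi]
    intro i
    fin_cases i
    · exact (contDiff_tfun_self (κ := κ)).contDiffAt.comp ((x, v), p) hs
    · exact hhs
    · exact contDiffAt_lam hs hns (contDiffAt_fst.fst)
    · exact contDiffAt_lam hs hns (contDiffAt_fst.snd)
  -- A kernel vector δ is tangent to S, and the functional `lam` of dn δ kills p, x and v. These
  -- three span the tangent hyperplane at p, which contains δ, so ⟨dn δ, δ⟩ = 0 and definiteness
  -- forces δ = 0.
  have hinv : (fderiv ℝ f ((x, v), p) ∘L .inr ℝ (V × V) V).IsInvertible := by
    apply isInvertible_of_injective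
    intro δ hδ
    have hfd : HasFDerivAt f (fderiv ℝ f ((x, v), p)) ((x, v), p) :=
      (hfc.differentiableAt (by simp)).hasFDerivAt
    have h1 : HasFDerivAt (fun y => f ((x, v), y))
        (fderiv ℝ f ((x, v), p) ∘L .inr ℝ (V × V) V) p :=
      hfd.comp p (hasFDerivAt_prodMk_right (x, v) p)
    have h2 : ∀ i (A : V →L[ℝ] ℝ), HasFDerivAt (fun y => f ((x, v), y) i) A p → A δ = 0 := by
      intro i A hA
      have h3 := (hasFDerivAt_pi'.1 h1 i).unique hA
      rw [← h3, ContinuousLinearMap.comp_apply, hδ, map_zero]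
    have e1 := h2 0 _ (hasFDerivAt_tfun_self p)
    have e2 := h2 1 _ H.hasFDerivAt
    have e3 : ∀ y, HasFDerivAt (fun q => lam κ q (n q) y)
        ((ContinuousLinearMap.apply ℝ ℝ y).comp D) p := by
      intro y
      have := (ContinuousLinearMap.apply ℝ ℝ y).hasFDerivAt.comp p hD
      have e : (fun q => lam κ q (n q) y) =
          (ContinuousLinearMap.apply ℝ ℝ y) ∘ fun q => lamL κ q (n q) := by
        funext q; simp [lamL_apply]
      rw [e]; exact this
    have e4 : D δ x = 0 := h2 2 _ (e3 x)
    have e5 : D δ v = 0 := h2 3 _ (e3 v)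
    have e1 : tfun κ p δ = 0 := by simpa [tfunL_apply] using e1
    have hδt : δ ∈ surfaceTangent S p := by
      rw [H.surfaceTangent_eq]; exact IsLocalEquation.mem_plane.2 ⟨e1, e2⟩
    rw [hDu δ hδt, ← lamL_apply] at e4 e5
    by_contra hne
    have hspan := mem_span_of_functional (lamL κ p (n p) : V →ₗ[ℝ] ℝ) (by
        intro h0
        have h1 : (lamL κ p (n p) : V →ₗ[ℝ] ℝ) (n p) = 0 := by rw [h0]; rfl
        have h2 : lamL κ p (n p) (n p) = 0 := h1
        rw [lamL_apply, hnp.lam_normal hκ hpM] at h2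
        exact one_ne_zero h2) hli
      (by simpa [lamL_apply] using lam_self hκ hpM hnp.1) (by simpa [lamL_apply] using hx)
      (by simpa [lamL_apply] using hv)
      (d := δ) (by
        have := hnp.2.2 δ hδt
        simpa [lamL_apply, lam_tangent hκ hpM e1] using this)
    have hle : Submodule.span ℝ (Set.range ![p, x, v]) ≤
        LinearMap.ker (lamL κ p (fderiv ℝ n p δ) : V →ₗ[ℝ] ℝ) := by
      rw [Submodule.span_le]
      rintro _ ⟨i, rfl⟩
      have e6 : lamL κ p (fderiv ℝ n p δ) p = 0 := by
        rw [lamL_apply]; exact lam_self hκ hpM (hS.tfun_fderiv_normal hκ hp hn hδt)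
      fin_cases i <;> simp [e4, e5, e6]
    have h6 : lamL κ p (fderiv ℝ n p δ) δ = 0 := hle hspan
    rw [lamL_apply, lam_tangent hκ hpM e1] at h6
    have := hd δ hδt hne
    rw [form_neg_left, h6] at this
    simp at this
  have hn0 : (∞ : WithTop ℕ∞) ≠ 0 := by simp
  have hfp : f ((x, v), p) = ![1, 0, 0, 0] := by
    simp only [hf, hx, hv, H.apply_eq_zero, tfun_self hpM]
  refine ⟨hfc.implicitFunction hn0 hinv, hfc.contDiffAt_implicitFunction hn0 hinv,
    hfc.implicitFunction_apply_self hn0 hinv, ?_, ?_⟩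
  · have hself := hfc.implicitFunction_apply_self hn0 hinv
    have hcont := (hfc.contDiffAt_implicitFunction hn0 hinv).continuousAt
    have hev := hfc.eventually_apply_implicitFunction hn0 hinv
    set P := hfc.implicitFunction hn0 hinv with hP
    have htend : Filter.Tendsto P (𝓝 (x, v)) (𝓝 p) := by
      have := hcont.tendsto
      rwa [hself] at this
    have hPS : ∀ᶠ z in 𝓝 (x, v), P z ∈ S := by
      filter_upwards [hev, htend.eventually (H.isOpen.mem_nhds H.mem),
        htend.eventually (eventually_sign hpM)] with z hz hzO hzs
      rw [hfp] at hz
      have h0 : tfun κ (P z) (P z) = 1 := congrFun hz 0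
      have h1 : h (P z) = 0 := congrFun hz 1
      exact (H.mem_iff _ hzO).2 ⟨mem_spaceForm_of_tfun h0 hzs, h1⟩
    have htend' : Filter.Tendsto P (𝓝 (x, v)) (𝓝[S] p) := tendsto_nhdsWithin_iff.2 ⟨htend, hPS⟩
    filter_upwards [hev, hPS, htend'.eventually hn.isNormal] with z hz hzS hzn
    rw [hfp] at hz
    exact ⟨hzS, hzn, congrFun hz 2, congrFun hz 3⟩
  -- If the nearby geodesic still lies in the surface tangent at p, then p itself solves the
  -- equations, and local uniqueness makes it the tangency point.
  · have hev := hfc.eventually_apply_eq_iff_implicitFunction hn0 hinv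
    have hc : Filter.Tendsto (fun z : V × V => (z, p)) (𝓝 (x, v)) (𝓝 ((x, v), p)) := by
      have : Continuous (fun z : V × V => (z, p)) := by fun_prop
      exact this.tendsto (x, v)
    filter_upwards [hc.eventually hev] with z hz h1 h2
    apply hz.1
    rw [hfp]
    simp only [hf, h1, h2, H.apply_eq_zero, tfun_self hpM]

/-! ### Geodesics have at most two tangent surfaces -/

/-- The complete totally geodesic surface tangent to `S` at `p ∈ S` contains the geodesic with
initial velocity `v` at `x`. -/
def IsTangentAt (S : Set V) (p x v : V) : Prop :=
  p ∈ S ∧ x ∈ Submodule.span ℝ (insert p (surfaceTangent S p)) ∧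
    v ∈ Submodule.span ℝ (insert p (surfaceTangent S p))

theorem isTangentAt_iff (hκ : κ = 0 ∨ κ = 1 ∨ κ = -1) (hS : IsSmoothSurface κ S)
    (hp : p ∈ S) {n : V} (hn : IsNormal κ S p n) {x v : V} :
    IsTangentAt S p x v ↔ lam κ p n x = 0 ∧ lam κ p n v = 0 := by
  rw [IsTangentAt, mem_span_iff_lam_eq_zero hκ hS hp hn, mem_span_iff_lam_eq_zero hκ hS hp hn]
  exact and_iff_right hp

theorem isTangentAt_iff_curve (hκ : κ = 0 ∨ κ = 1 ∨ κ = -1) (w : UnitTangent κ) :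
    IsTangentAt S p w.base w.vec ↔ p ∈ S ∧ ∀ r, w.curve r ∈ tangentSurface κ S p := by
  constructor
  · rintro ⟨hp, hx, hv⟩
    exact ⟨hp, fun r => ⟨(isUnitTangent_flow hκ w.isUnitTangent r).1,
      Submodule.add_mem _ (Submodule.smul_mem _ _ hx) (Submodule.smul_mem _ _ hv)⟩⟩
  · rintro ⟨hp, h⟩
    have hx : w.base ∈ Submodule.span ℝ (insert p (surfaceTangent S p)) := by
      have := (h 0).2
      rwa [UnitTangent.curve, geodesic_zero] at this
    refine ⟨hp, hx, ?_⟩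
    have h1 := (h 1).2
    rw [UnitTangent.curve, geodesic, Submodule.add_mem_iff_right _ (Submodule.smul_mem _ _ hx)] at h1
    -- The parameter 1 is not a zero of s_κ, so the points of the geodesic at 0 and 1 already
    -- determine the plane of x and v.
    have hs : sinK κ 1 ≠ 0 := by
      rcases hκ with rfl | rfl | rfl
      · simp [sinK]
      · simp only [sinK, one_ne_zero, if_false, if_true]
        exact (Real.sin_pos_of_pos_of_le_one one_pos le_rfl).ne'
      · have hm : (-1 : ℝ) ≠ 1 := by norm_num
        simp only [sinK, neg_eq_zero, one_ne_zero, if_false, hm]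
        exact (Real.sinh_pos_iff.2 one_pos).ne'
    exact (Submodule.smul_mem_iff _ hs).1 h1

/-- The data of a supporting functional at a point of a quadratically convex surface. -/
theorem IsQuadraticallyConvex.exists_support (hκ : κ = 0 ∨ κ = 1 ∨ κ = -1)
    (hS : IsQuadraticallyConvex κ S) (hp : p ∈ S) :
    ∃ n, IsNormal κ S p n ∧ ∀ x ∈ S, x ≠ p → 0 < lam κ p n x := by
  obtain ⟨n, hn, hd⟩ := hS.definite p hp
  exact ⟨n p, hn.isNormal_self hp, hS.lam_pos hκ hp hn hd⟩

/-- The functionals that vanish on a plane of ℝ⁴ form a two-dimensional space. If three of them were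
independent, they would define a surjection to ℝ³, whose one-dimensional kernel could not contain x
and v. -/
theorem exists_relation {x v : V} (hli : LinearIndependent ℝ ![x, v]) (f g h : V →ₗ[ℝ] ℝ)
    (hf : f x = 0 ∧ f v = 0) (hg : g x = 0 ∧ g v = 0) (hh : h x = 0 ∧ h v = 0) :
    ∃ a b c : ℝ, (a ≠ 0 ∨ b ≠ 0 ∨ c ≠ 0) ∧ ∀ y, a * f y + b * g y + c * h y = 0 := by
  by_contra hcon
  push Not at hcon
  set T : V →ₗ[ℝ] (Fin 3 → ℝ) := LinearMap.pi ![f, g, h] with hT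
  have hsurj : LinearMap.range T = ⊤ := by
    by_contra hne
    obtain ⟨φ, hφ, hle⟩ := Submodule.exists_le_ker_of_lt_top _ (lt_top_iff_ne_top.2 hne)
    have hexp : ∀ z : Fin 3 → ℝ, φ z =
        φ (Pi.single 0 1) * z 0 + φ (Pi.single 1 1) * z 1 + φ (Pi.single 2 1) * z 2 := by
      intro z
      have : z = z 0 • Pi.single 0 1 + z 1 • Pi.single 1 1 + z 2 • Pi.single 2 1 := by
        funext i
        fin_cases i <;> simp
      conv_lhs => rw [this]
      simp only [map_add, map_smul, smul_eq_mul]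
      ring
    obtain ⟨y, hy⟩ := hcon (φ (Pi.single 0 1)) (φ (Pi.single 1 1)) (φ (Pi.single 2 1)) (by
      by_contra hz
      push Not at hz
      apply hφ
      ext i
      fin_cases i
      · simpa using hz.1
      · simpa using hz.2.1
      · simpa using hz.2.2)
    apply hy
    have h1 : φ (T y) = 0 := hle (LinearMap.mem_range_self T y)
    rw [hexp] at h1
    simpa [hT] using h1
  have h1 := LinearMap.finrank_range_add_finrank_ker T
  rw [hsurj, finrank_top] at h1
  simp at h1
  have h2 : Submodule.span ℝ (Set.range ![x, v]) ≤ LinearMap.ker T := by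
    rw [Submodule.span_le]
    rintro _ ⟨i, rfl⟩
    have : T x = 0 ∧ T v = 0 := by
      constructor <;> ext i <;> fin_cases i <;> simp [hT, hf, hg, hh]
    fin_cases i <;> simp [this.1, this.2]
  have h3 := Submodule.finrank_mono h2
  rw [finrank_span_eq_card hli] at h3
  simp at h3
  omega

theorem IsUnitTangent.linearIndependent {x v : V} (h : IsUnitTangent κ x v) :
    LinearIndependent ℝ ![x, v] := by
  rw [LinearIndependent.pair_iff]
  intro s t hst
  have hs : s = 0 := by
    have := congrArg (tfun κ x) hst
    rw [tfun_add, tfun_smul, tfun_smul, h.tfun_base, h.tfun_vec] at this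
    simpa [tfun] using this
  refine ⟨hs, ?_⟩
  have := congrArg (form κ v) hst
  rw [hs, zero_smul, zero_add, form_smul_right, h.2.2, form_zero_right] at this
  linarith

/-- The supporting functionals at three distinct tangency points satisfy a nontrivial relation with
coefficients a, b, c. Evaluated at each of the points, one functional vanishes and the other two are
positive, so any two of the coefficients have opposite signs, which is impossible for three. -/
theorem IsQuadraticallyConvex.tangencyPoint_unique (hκ : κ = 0 ∨ κ = 1 ∨ κ = -1)
    (hS : IsQuadraticallyConvex κ S) {x v p q r : V} (h : IsUnitTangent κ x v)
    (hp : IsTangentAt S p x v) (hq : IsTangentAt S q x v) (hr : IsTangentAt S r x v)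
    (hpq : p ≠ q) : r = p ∨ r = q := by
  by_contra hcon
  push Not at hcon
  obtain ⟨hrp, hrq⟩ := hcon
  obtain ⟨np, hnp, Hp⟩ := hS.exists_support hκ hp.1
  obtain ⟨nq, hnq, Hq⟩ := hS.exists_support hκ hq.1
  obtain ⟨nr, hnr, Hr⟩ := hS.exists_support hκ hr.1
  have ep := lam_self hκ (hS.smooth.1 hp.1) hnp.1
  have eq := lam_self hκ (hS.smooth.1 hq.1) hnq.1
  have er := lam_self hκ (hS.smooth.1 hr.1) hnr.1
  have tp := (isTangentAt_iff hκ hS.smooth hp.1 hnp).1 hp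
  have tq := (isTangentAt_iff hκ hS.smooth hq.1 hnq).1 hq
  have tr := (isTangentAt_iff hκ hS.smooth hr.1 hnr).1 hr
  obtain ⟨a, b, c, hne, hrel⟩ := exists_relation h.linearIndependent (lamL κ p np : V →ₗ[ℝ] ℝ)
    (lamL κ q nq : V →ₗ[ℝ] ℝ) (lamL κ r nr : V →ₗ[ℝ] ℝ) (by simpa [lamL_apply] using tp)
    (by simpa [lamL_apply] using tq) (by simpa [lamL_apply] using tr)
  simp only [ContinuousLinearMap.coe_coe, lamL_apply] at hrel
  have r1 := hrel p
  have r2 := hrel q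
  have r3 := hrel r
  rw [ep] at r1
  rw [eq] at r2
  rw [er] at r3
  have p1 := Hp q hq.1 hpq.symm
  have p2 := Hp r hr.1 hrp
  have q1 := Hq p hp.1 hpq
  have q2 := Hq r hr.1 hrq
  have s1 := Hr p hp.1 hrp.symm
  have s2 := Hr q hq.1 hrq.symm
  clear hrel Hp Hq Hr
  have key : ∀ {s t u w : ℝ}, 0 < u → 0 < w → s * u + t * w = 0 → s * t ≤ 0 ∧ (s = 0 → t = 0) ∧
      (t = 0 → s = 0) := by
    intro s t u w hu hw hst
    refine ⟨?_, fun h0 => ?_, fun h0 => ?_⟩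
    · have h1 : s * t * w = -(s ^ 2 * u) := by linear_combination s * hst
      by_contra hpos
      push Not at hpos
      nlinarith [mul_pos hpos hw, mul_nonneg (sq_nonneg s) hu.le]
    · rw [h0, zero_mul, zero_add] at hst
      exact (mul_eq_zero.1 hst).resolve_right hw.ne'
    · rw [h0, zero_mul, add_zero] at hst
      exact (mul_eq_zero.1 hst).resolve_right hu.ne'
  obtain ⟨k1, k1', k1''⟩ := key q1 s1 (by linarith : b * _ + c * _ = 0)
  obtain ⟨k2, k2', k2''⟩ := key p1 s2 (by linarith : a * _ + c * _ = 0)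
  obtain ⟨k3, k3', k3''⟩ := key p2 q2 (by linarith : a * _ + b * _ = 0)
  have ha : a ≠ 0 := by
    intro h0
    rcases hne with h | h | h
    · exact h h0
    · exact h (k3' h0)
    · exact h (k2' h0)
  have hb : b ≠ 0 := fun h0 => ha (k3'' h0)
  have hc : c ≠ 0 := fun h0 => ha (k2'' h0)
  have l1 : b * c < 0 := lt_of_le_of_ne k1 (mul_ne_zero hb hc)
  have l2 : a * c < 0 := lt_of_le_of_ne k2 (mul_ne_zero ha hc)
  have l3 : a * b < 0 := lt_of_le_of_ne k3 (mul_ne_zero ha hb)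
  nlinarith [mul_pos_of_neg_of_neg l1 l2, mul_pos (mul_pos_of_neg_of_neg l1 l2) (neg_pos.2 l3),
    sq_nonneg (a * b * c)]

end

/-! ### Perpendiculars from a point to a geodesic, and distances -/

section

variable {κ : ℝ} {S : Set V} {p : V}

/-! ### The foot of the perpendicular from a point to a geodesic -/

/-- The component of `p` along `v` in the plane spanned by `x` and `v`. -/
def bet (κ : ℝ) (p x v : V) : ℝ := form κ (p - tfun κ p x • x) v

/-- The square of `c_κ` of the distance from `p` to the geodesic. -/
def rhoSq (κ : ℝ) (p x v : V) : ℝ := tfun κ p x ^ 2 + κ * bet κ p x v ^ 2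

/-- `c_κ` of the distance from `p` to the geodesic. -/
def rho (κ : ℝ) (p x v : V) : ℝ := Real.sqrt (rhoSq κ p x v)

/-- The point closest to `p` on the geodesic with initial velocity `v` at `x`. -/
def foot (κ : ℝ) (p x v : V) : V := (rho κ p x v)⁻¹ • (tfun κ p x • x + bet κ p x v • v)

/-- The velocity of the geodesic at the point closest to `p`. -/
def footVel (κ : ℝ) (p x v : V) : V :=
  (rho κ p x v)⁻¹ • (tfun κ p x • v - (κ * bet κ p x v) • x)

/-- The reflection in `p` of the foot of the perpendicular from `p`. -/
def footRefl (κ : ℝ) (p x v : V) : V := (2 * rho κ p x v) • p - foot κ p x v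

theorem tfun_vec_eq (hκ : κ = 0 ∨ κ = 1 ∨ κ = -1) {x v : V} (h : IsUnitTangent κ x v) :
    tfun κ p v = κ * bet κ p x v := by
  rw [bet, form_sub_left, form_smul_left]
  have h1 := smul_form p v (κ := κ)
  have h2 := smul_form_base hκ h.1 h.tfun_vec
  linear_combination p 0 * h.vec_zero hκ - h1 + tfun κ p x * h2

theorem tfun_flow (hκ : κ = 0 ∨ κ = 1 ∨ κ = -1) {x v : V} (h : IsUnitTangent κ x v) (r : ℝ) :
    tfun κ p (geodesic κ x v r) = cosK κ r * tfun κ p x + κ * sinK κ r * bet κ p x v := by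
  rw [tfun_geodesic, tfun_vec_eq hκ h]; ring

/-- The numbers `tfun κ p x` and `bet κ p x v` are the coordinates of the projection of p to the
plane of x and v. The flow rotates the basis, so the coordinates rotate the opposite way; hence
`rhoSq`, `foot`, `footVel` and `footRefl` depend only on the oriented geodesic. -/
theorem bet_flow (hκ : κ = 0 ∨ κ = 1 ∨ κ = -1) (hp : p ∈ spaceForm κ) {x v : V}
    (h : IsUnitTangent κ x v) (r : ℝ) :
    bet κ p (geodesic κ x v r) (geodesicVel κ x v r)
      = cosK κ r * bet κ p x v - sinK κ r * tfun κ p x := by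
  have hc := cosK_sq_add hκ r
  have fxv := smul_form_base hκ h.1 h.tfun_vec
  have fxx := smul_form_self hκ h.1
  have fpx := smul_form p x (κ := κ)
  have hp0 := base_zero hκ hp
  have hx0 := base_zero hκ h.1
  have e1 : form κ (geodesic κ x v r) (geodesicVel κ x v r) = cosK κ r ^ 2 * form κ x v
      - κ * cosK κ r * sinK κ r * form κ x x + cosK κ r * sinK κ r
      - κ * sinK κ r ^ 2 * form κ x v := by
    rw [form_geodesicVel, form_comm _ x, form_comm _ v, form_geodesic, form_geodesic, h.2.2,
      form_comm v x]
    ring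
  have e2 : bet κ p x v = form κ p v - tfun κ p x * form κ x v := by
    rw [bet, form_sub_left, form_smul_left]
  have e3 : bet κ p (geodesic κ x v r) (geodesicVel κ x v r) =
      cosK κ r * form κ p v - κ * sinK κ r * form κ p x
      - (cosK κ r * tfun κ p x + κ * sinK κ r * bet κ p x v)
        * form κ (geodesic κ x v r) (geodesicVel κ x v r) := by
    rw [bet, form_sub_left, form_smul_left, tfun_flow hκ h, form_geodesicVel]
  rw [e3, e1]
  generalize bet κ p x v = b at *
  generalize tfun κ p x = a at *
  generalize form κ p v = f1 at *
  generalize form κ x v = f2 at *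
  generalize form κ p x = f3 at *
  generalize form κ x x = f4 at *
  have hz : κ = 0 → cosK κ r = 1 := by rintro rfl; simp [cosK]
  generalize cosK κ r = C at *
  generalize sinK κ r = s at *
  rcases hκ with rfl | rfl | rfl
  · have hC : C = 1 := hz rfl
    have ha : a = 1 := by linear_combination p 0 * hx0 - fpx + hp0
    subst hC ha
    linear_combination -e2
  · have hf : f2 = 0 := by linarith
    have hf4 : f4 = 1 := by linarith
    subst hf hf4
    linear_combination -C * e2 - s * fpx
  · have hf : f2 = 0 := by linarith
    have hf4 : f4 = -1 := by linarith
    subst hf hf4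
    linear_combination -C * e2 - s * fpx

theorem rhoSq_flow (hκ : κ = 0 ∨ κ = 1 ∨ κ = -1) (hp : p ∈ spaceForm κ) {x v : V}
    (h : IsUnitTangent κ x v) (r : ℝ) :
    rhoSq κ p (geodesic κ x v r) (geodesicVel κ x v r) = rhoSq κ p x v := by
  rw [rhoSq, bet_flow hκ hp h, tfun_flow hκ h, rhoSq]
  linear_combination (tfun κ p x ^ 2 + κ * bet κ p x v ^ 2) * cosK_sq_add hκ r

theorem foot_flow (hκ : κ = 0 ∨ κ = 1 ∨ κ = -1) (hp : p ∈ spaceForm κ) {x v : V}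
    (h : IsUnitTangent κ x v) (r : ℝ) :
    foot κ p (geodesic κ x v r) (geodesicVel κ x v r) = foot κ p x v := by
  rw [foot, rho, rhoSq_flow hκ hp h, bet_flow hκ hp h, tfun_flow hκ h, foot, rho]
  congr 1
  simp only [geodesic, geodesicVel]
  funext i
  simp only [Pi.add_apply, Pi.sub_apply, Pi.smul_apply, smul_eq_mul]
  linear_combination (tfun κ p x * x i + bet κ p x v * v i) * cosK_sq_add hκ r

theorem footVel_flow (hκ : κ = 0 ∨ κ = 1 ∨ κ = -1) (hp : p ∈ spaceForm κ) {x v : V}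
    (h : IsUnitTangent κ x v) (r : ℝ) :
    footVel κ p (geodesic κ x v r) (geodesicVel κ x v r) = footVel κ p x v := by
  rw [footVel, rho, rhoSq_flow hκ hp h, bet_flow hκ hp h, tfun_flow hκ h, footVel, rho]
  congr 1
  simp only [geodesic, geodesicVel]
  funext i
  simp only [Pi.add_apply, Pi.sub_apply, Pi.smul_apply, smul_eq_mul]
  linear_combination (tfun κ p x * v i - κ * bet κ p x v * x i) * cosK_sq_add hκ r

theorem footRefl_flow (hκ : κ = 0 ∨ κ = 1 ∨ κ = -1) (hp : p ∈ spaceForm κ) {x v : V}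
    (h : IsUnitTangent κ x v) (r : ℝ) :
    footRefl κ p (geodesic κ x v r) (geodesicVel κ x v r) = footRefl κ p x v := by
  rw [footRefl, rho, rhoSq_flow hκ hp h, foot_flow hκ hp h, footRefl, rho]

theorem sq_of_bet_eq_zero {x v : V} (hb : bet κ p x v = 0) (ha : 0 < tfun κ p x) :
    rho κ p x v = tfun κ p x ∧ foot κ p x v = x ∧ footVel κ p x v = v := by
  have h1 : rho κ p x v = tfun κ p x := by
    rw [rho, rhoSq, hb]
    simp [Real.sqrt_sq ha.le]
  refine ⟨h1, ?_, ?_⟩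
  · rw [foot, h1, hb, zero_smul, add_zero, inv_smul_smul₀ ha.ne']
  · rw [footVel, h1, hb, mul_zero, zero_smul, sub_zero, inv_smul_smul₀ ha.ne']

theorem tfun_pos (hκ : κ = 0 ∨ κ = -1) {x : V} (hp : p ∈ spaceForm κ)
    (hx : x ∈ spaceForm κ) : 0 < tfun κ p x := by
  rcases hκ with rfl | rfl
  · have h1 : 0 < p 0 := by simpa using hp.2
    have h2 : 0 < x 0 := by simpa using hx.2
    simpa [tfun] using mul_pos h1 h2
  · have h1 : 0 < p 0 := by
      rcases hp.2 with h | h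
      · norm_num at h
      · exact h
    have h2 : 0 < x 0 := by
      rcases hx.2 with h | h
      · norm_num at h
      · exact h
    have h3 := hp.1
    have h4 := hx.1
    have h5 : |p 1 * x 1 + p 2 * x 2 + p 3 * x 3| < p 0 * x 0 := by
      apply abs_lt_of_sq_lt_sq _ (mul_pos h1 h2).le
      have key : (p 0 * x 0) ^ 2 - (p 1 * x 1 + p 2 * x 2 + p 3 * x 3) ^ 2 =
          (p 1 * x 2 - p 2 * x 1) ^ 2 + (p 1 * x 3 - p 3 * x 1) ^ 2 + (p 2 * x 3 - p 3 * x 2) ^ 2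
          + (p 1 ^ 2 + p 2 ^ 2 + p 3 ^ 2) + (x 1 ^ 2 + x 2 ^ 2 + x 3 ^ 2) + 1 := by
        linear_combination (x 0 ^ 2) * h3 + (p 1 ^ 2 + p 2 ^ 2 + p 3 ^ 2 + 1) * h4
      nlinarith [sq_nonneg (p 1 * x 2 - p 2 * x 1), sq_nonneg (p 1 * x 3 - p 3 * x 1),
        sq_nonneg (p 2 * x 3 - p 3 * x 2), sq_nonneg (p 1), sq_nonneg (p 2), sq_nonneg (p 3),
        sq_nonneg (x 1), sq_nonneg (x 2), sq_nonneg (x 3)]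
    have h6 := (abs_lt.1 h5).2
    simp only [tfun]
    linarith

/-- For κ = -1, the part y of p orthogonal to x and v is spacelike, so that tfun² - bet² = 1 + ⟨y,
y⟩. The sphere has no analogue: there the quantity vanishes when p is at distance π/2 from the whole
great circle. -/
theorem rhoSq_pos (hκ : κ = 0 ∨ κ = -1) (hp : p ∈ spaceForm κ) {x v : V}
    (h : IsUnitTangent κ x v) : 0 < rhoSq κ p x v := by
  have ha := tfun_pos hκ hp h.1
  have hκ' : κ = 0 ∨ κ = 1 ∨ κ = -1 := hκ.imp_right Or.inr
  rcases hκ with rfl | rfl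
  · rw [rhoSq, zero_mul, add_zero]; positivity
  · have hpp := smul_form_self hκ' hp
    have hxx := smul_form_self hκ' h.1
    have hxv := smul_form_base hκ' h.1 h.tfun_vec
    have hpx := smul_form p x (κ := -1)
    have hyt : tfun (-1) x (p - tfun (-1) p x • x - bet (-1) p x v • v) = 0 := by
      rw [tfun_sub, tfun_sub, tfun_smul, tfun_smul, h.tfun_base, h.tfun_vec, tfun_comm x p]; ring
    have hy := (form_self_nonneg hκ' h.1 hyt).1
    have e2 : bet (-1) p x v = form (-1) p v - tfun (-1) p x * form (-1) x v := by
      rw [bet, form_sub_left, form_smul_left]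
    simp only [form_sub_left, form_sub_right, form_smul_left, form_smul_right, h.2.2,
      form_comm v p, form_comm x p, form_comm v x] at hy
    have hf : form (-1) x v = 0 := by linarith
    have hx1 : form (-1) x x = -1 := by linarith
    have hp1 : form (-1) p p = -1 := by linarith
    have hpx1 : form (-1) p x = -tfun (-1) p x := by linarith
    rw [hf] at e2
    rw [hf, hx1, hp1, hpx1, show form (-1) p v = bet (-1) p x v by linarith] at hy
    rw [rhoSq]
    nlinarith

theorem exists_curve_eq_foot (hκ : κ = 0 ∨ κ = 1 ∨ κ = -1) (hp : p ∈ spaceForm κ) {x v : V}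
    (h : IsUnitTangent κ x v) (hr : 0 < rhoSq κ p x v) :
    ∃ t, geodesic κ x v t = foot κ p x v ∧ geodesicVel κ x v t = footVel κ p x v ∧
      cosK κ t = tfun κ p x / rho κ p x v ∧ sinK κ t = bet κ p x v / rho κ p x v := by
  have h0 : 0 < rho κ p x v := Real.sqrt_pos.2 hr
  have h1 : rho κ p x v ^ 2 = rhoSq κ p x v := Real.sq_sqrt hr.le
  obtain ⟨t, h2, h3⟩ := exists_cosK_sinK hκ (a := tfun κ p x / rho κ p x v)
    (b := bet κ p x v / rho κ p x v) (by
      rw [rhoSq] at h1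
      field_simp
      linarith) (by
      intro hne
      exact div_pos (tfun_pos (by tauto) hp h.1) h0)
  refine ⟨t, ?_, ?_, h2, h3⟩
  · rw [geodesic, foot, h2, h3, smul_add, smul_smul, smul_smul]
    congr 2 <;> ring
  · rw [geodesicVel, footVel, h2, h3, smul_sub, smul_smul, smul_smul]
    congr 2 <;> ring

theorem foot_data (hκ : κ = 0 ∨ κ = 1 ∨ κ = -1) (hp : p ∈ spaceForm κ) {x v : V}
    (h : IsUnitTangent κ x v) (hr : 0 < rhoSq κ p x v) :
    IsUnitTangent κ (foot κ p x v) (footVel κ p x v) ∧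
      tfun κ p (foot κ p x v) = rho κ p x v ∧
      bet κ p (foot κ p x v) (footVel κ p x v) = 0 := by
  obtain ⟨t, h1, h2, h3, h4⟩ := exists_curve_eq_foot hκ hp h hr
  have h0 : 0 < rho κ p x v := Real.sqrt_pos.2 hr
  have h5 : rho κ p x v ^ 2 = rhoSq κ p x v := Real.sq_sqrt hr.le
  rw [rhoSq] at h5
  rw [← h1, ← h2]
  refine ⟨isUnitTangent_flow hκ h t, ?_, ?_⟩
  · rw [tfun_flow hκ h, h3, h4]
    field_simp
    linarith
  · rw [bet_flow hκ hp h, h3, h4]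
    ring

/-! ### Distances -/

theorem tfun_le_one {x : V} (hp : p ∈ spaceForm 1) (hx : x ∈ spaceForm 1) :
    -1 ≤ tfun 1 p x ∧ tfun 1 p x ≤ 1 := by
  have h1 := hp.1
  have h2 := hx.1
  simp only [tfun]
  constructor
  · nlinarith [sq_nonneg (p 0 + x 0), sq_nonneg (p 1 + x 1), sq_nonneg (p 2 + x 2),
      sq_nonneg (p 3 + x 3)]
  · nlinarith [sq_nonneg (p 0 - x 0), sq_nonneg (p 1 - x 1), sq_nonneg (p 2 - x 2),
      sq_nonneg (p 3 - x 3)]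

theorem form_one_eq_tfun (x y : V) : form 1 x y = tfun 1 x y := by simp only [form, tfun]; ring
theorem form_neg_one_eq_tfun (x y : V) : -form (-1) x y = tfun (-1) x y := by
  simp only [form, tfun]; ring

theorem tfun_zero_eq_one {x : V} (hp : p ∈ spaceForm 0) (hx : x ∈ spaceForm 0) :
    tfun 0 p x = 1 := by
  have h1 := base_zero (Or.inl rfl) hp
  have h2 := base_zero (Or.inl rfl) hx
  have h1 : p 0 = 1 := by linarith
  have h2 : x 0 = 1 := by linarith
  simp [tfun, h1, h2]

/-- Split p into its component along q and a tangent vector y at q. Then κ⟨y, y⟩ = 1 - tfun², so y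
has length s_κ of the distance; for κ = 0 this length is the distance itself. -/
theorem dist_data (hκ : κ = 0 ∨ κ = 1 ∨ κ = -1) {q : V} (hp : p ∈ spaceForm κ)
    (hq : q ∈ spaceForm κ) (ha : 0 < tfun κ p q) :
    tfun κ q (p - tfun κ p q • q) = 0 ∧ cosK κ (spaceDist κ p q) = tfun κ p q ∧
      sinK κ (spaceDist κ p q)
        = Real.sqrt (form κ (p - tfun κ p q • q) (p - tfun κ p q • q)) := by
  have hyt : tfun κ q (p - tfun κ p q • q) = 0 := by
    rw [tfun_sub, tfun_smul, tfun_self hq, tfun_comm q p]; ring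
  refine ⟨hyt, ?_⟩
  have hN := (form_self_nonneg hκ hq hyt).1
  have hk : κ * form κ (p - tfun κ p q • q) (p - tfun κ p q • q) = 1 - tfun κ p q ^ 2 := by
    rw [← tfun_tangent hκ hq hyt, tfun_sub_left, tfun_smul_left, hyt, tfun_sub, tfun_smul,
      tfun_self hp]
    ring
  have hm : (-1 : ℝ) ≠ 1 := by norm_num
  rcases hκ with rfl | rfl | rfl
  · have h1 := tfun_zero_eq_one hp hq
    refine ⟨by simp [cosK, h1], ?_⟩
    simp [sinK, spaceDist, h1]
  · have h1 := tfun_le_one hp hq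
    simp only [cosK, sinK, spaceDist, one_ne_zero, if_false, if_true]
    rw [form_one_eq_tfun p q, Real.cos_arccos h1.1 h1.2, Real.sin_arccos]
    refine ⟨rfl, ?_⟩
    rw [← hk, one_mul]
  · simp only [cosK, sinK, spaceDist, neg_eq_zero, one_ne_zero, if_false, hm]
    have h1 : 1 ≤ tfun (-1) p q := by nlinarith
    rw [form_neg_one_eq_tfun, Real.cosh_arcosh h1, Real.sinh_arcosh h1]
    refine ⟨rfl, ?_⟩
    congr 1
    linarith

/-- When `bet` vanishes at q, `tfun κ p` along the geodesic is a positive multiple of c_κ(s),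
extremal at s = 0. For κ = 0 it carries no information and Pythagoras takes its place. -/
theorem spaceDist_le_of_bet_eq_zero (hκ : κ = 0 ∨ κ = 1 ∨ κ = -1) (hp : p ∈ spaceForm κ)
    {q u : V} (h : IsUnitTangent κ q u) (ha : 0 < tfun κ p q) (hb : bet κ p q u = 0) (s : ℝ) :
    spaceDist κ p q ≤ spaceDist κ p (geodesic κ q u s) := by
  have hf := tfun_flow (p := p) hκ h s
  have hM := (isUnitTangent_flow hκ h s).1
  rw [hb, mul_zero, add_zero] at hf
  have hm : (-1 : ℝ) ≠ 1 := by norm_num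
  rcases hκ with rfl | rfl | rfl
  · simp only [spaceDist, if_true]
    apply Real.sqrt_le_sqrt
    rw [bet, tfun_zero_eq_one hp h.1, one_smul] at hb
    have : p - geodesic 0 q u s = (p - q) - s • u := by
      simp only [geodesic, cosK, sinK, if_true, one_smul]; abel
    rw [this]
    simp only [form_sub_left _ (p - q), form_sub_right _ (p - q), form_smul_left,
      form_smul_right, h.2.2, hb, form_comm u]
    nlinarith [sq_nonneg s]
  · simp only [spaceDist, one_ne_zero, if_false, if_true, form_one_eq_tfun]
    apply Real.arccos_le_arccos
    rw [hf]
    simp only [cosK, one_ne_zero, if_false, if_true]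
    nlinarith [Real.cos_le_one s]
  · simp only [spaceDist, neg_eq_zero, one_ne_zero, if_false, hm, form_neg_one_eq_tfun]
    rw [Real.arcosh_le_arcosh ha (tfun_pos (Or.inr rfl) hp hM), hf]
    simp only [cosK, neg_eq_zero, one_ne_zero, if_false, hm]
    nlinarith [Real.one_le_cosh s]

/-- For κ = ±1, compare with the foot, where `tfun` equals `rho`: minimality at q and rho² = tfun² +
κ bet² give bet² ≤ 0. For κ = 0, compare with the point at parameter `bet`. -/
theorem bet_eq_zero_of_spaceDist_le (hκ : κ = 0 ∨ κ = 1 ∨ κ = -1) (hp : p ∈ spaceForm κ)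
    {q u : V} (h : IsUnitTangent κ q u) (hr : 0 < rhoSq κ p q u)
    (hd : ∀ s, spaceDist κ p q ≤ spaceDist κ p (geodesic κ q u s)) :
    bet κ p q u = 0 ∧ 0 < tfun κ p q := by
  have hm : (-1 : ℝ) ≠ 1 := by norm_num
  have hρ : 0 < rho κ p q u := Real.sqrt_pos.2 hr
  have hρ2 : rho κ p q u ^ 2 = rhoSq κ p q u := Real.sq_sqrt hr.le
  rw [rhoSq] at hρ2
  obtain ⟨t, ht, -⟩ := exists_curve_eq_foot hκ hp h hr
  have hfoot := (foot_data hκ hp h hr).2.1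
  have hdt := hd t
  rw [ht] at hdt
  have hfM := (foot_data hκ hp h hr).1.1
  rcases hκ with rfl | rfl | rfl
  · refine ⟨?_, tfun_pos (Or.inl rfl) hp h.1⟩
    have hd1 := hd (bet 0 p q u)
    simp only [spaceDist, if_true] at hd1
    have h1 : p - geodesic 0 q u (bet 0 p q u) = (p - q) - bet 0 p q u • u := by
      simp only [geodesic, cosK, sinK, if_true, one_smul]; abel
    have hb : bet 0 p q u = form 0 (p - q) u := by
      rw [bet, tfun_zero_eq_one hp h.1, one_smul]
    have h2 := (Real.sqrt_le_sqrt_iff (by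
      simp only [form]
      nlinarith [sq_nonneg ((p - geodesic 0 q u (bet 0 p q u)) 1),
        sq_nonneg ((p - geodesic 0 q u (bet 0 p q u)) 2),
        sq_nonneg ((p - geodesic 0 q u (bet 0 p q u)) 3)])).1 hd1
    rw [h1] at h2
    simp only [form_sub_left _ (p - q), form_sub_right _ (p - q), form_smul_left,
      form_smul_right, h.2.2, ← hb, form_comm u] at h2
    have h3 : bet 0 p q u ^ 2 ≤ 0 := by nlinarith
    exact pow_eq_zero_iff two_ne_zero |>.1 (le_antisymm h3 (sq_nonneg _))
  · have h1 : rho 1 p q u ≤ tfun 1 p q := by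
      rw [← hfoot]
      simp only [spaceDist, one_ne_zero, if_false, if_true, form_one_eq_tfun] at hdt
      have a1 := tfun_le_one hp hfM
      have a2 := tfun_le_one hp h.1
      exact (Real.strictAntiOn_arccos.le_iff_ge a2 a1).1 hdt
    refine ⟨?_, hρ.trans_le h1⟩
    have h3 : bet 1 p q u ^ 2 ≤ 0 := by nlinarith
    exact pow_eq_zero_iff two_ne_zero |>.1 (le_antisymm h3 (sq_nonneg _))
  · have ha := tfun_pos (Or.inr rfl) hp h.1
    refine ⟨?_, ha⟩
    have h1 : tfun (-1) p q ≤ rho (-1) p q u := by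
      rw [← hfoot]
      simp only [spaceDist, neg_eq_zero, one_ne_zero, if_false, hm, form_neg_one_eq_tfun] at hdt
      exact (Real.arcosh_le_arcosh ha (tfun_pos (Or.inr rfl) hp hfM)).1 hdt
    have h3 : bet (-1) p q u ^ 2 ≤ 0 := by nlinarith
    exact pow_eq_zero_iff two_ne_zero |>.1 (le_antisymm h3 (sq_nonneg _))

end

/-! ### An explicit formula for the outer billiard map -/

section

variable {κ : ℝ} {S : Set V} {p : V}

/-! ### The outer billiard map in terms of the feet of the perpendiculars -/

theorem volumeForm_curve (x a b v : V) (C s C' s' σ σ' : ℝ) :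
    volumeForm x ((C • x + s • v) + σ • a) ((C' • x + s' • v) + σ' • b) v
      = σ * σ' * volumeForm x a b v := by
  simp only [volumeForm_eq, Pi.add_apply, Pi.smul_apply, smul_eq_mul]; ring

theorem volumeForm_flow (hκ : κ = 0 ∨ κ = 1 ∨ κ = -1) (x a b v : V) (r : ℝ) :
    volumeForm (geodesic κ x v r) a b (geodesicVel κ x v r) = volumeForm x a b v := by
  have h := cosK_sq_add hκ r
  simp only [volumeForm_eq, geodesic, geodesicVel, Pi.add_apply, Pi.sub_apply, Pi.smul_apply,
    smul_eq_mul]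
  linear_combination (exp := 1) ((x 0 * a 1 - x 1 * a 0) * (b 2 * v 3 - b 3 * v 2)
    - (x 0 * a 2 - x 2 * a 0) * (b 1 * v 3 - b 3 * v 1)
    + (x 0 * a 3 - x 3 * a 0) * (b 1 * v 2 - b 2 * v 1)
    + (x 1 * a 2 - x 2 * a 1) * (b 0 * v 3 - b 3 * v 0)
    - (x 1 * a 3 - x 3 * a 1) * (b 0 * v 2 - b 2 * v 0)
    + (x 2 * a 3 - x 3 * a 2) * (b 0 * v 1 - b 1 * v 0)) * h

theorem volumeForm_swap (x a b v : V) : volumeForm x a b v = -volumeForm x b a v := by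
  simp only [volumeForm_eq]; ring

theorem volumeForm_self (x a v : V) : volumeForm x a a v = 0 := by
  simp only [volumeForm_eq]; ring

theorem volumeForm_geodesic (x b v : V) (r : ℝ) :
    volumeForm x (geodesic κ x v r) b v = 0 := by
  simp only [volumeForm_eq, geodesic, Pi.add_apply, Pi.smul_apply, smul_eq_mul]; ring

theorem IsTangentAt.flow {x v : V} (h : IsTangentAt S p x v) (r : ℝ) :
    IsTangentAt S p (geodesic κ x v r) (geodesicVel κ x v r) :=
  ⟨h.1, Submodule.add_mem _ (Submodule.smul_mem _ _ h.2.1) (Submodule.smul_mem _ _ h.2.2),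
    Submodule.sub_mem _ (Submodule.smul_mem _ _ h.2.2) (Submodule.smul_mem _ _ h.2.1)⟩

/-- Double angle formulas: the mirror image of q in the point at parameter d is linear in that point
and in q. This is the source of `footRefl`. -/
theorem geodesic_two_mul (hκ : κ = 0 ∨ κ = 1 ∨ κ = -1) (q e : V) (d : ℝ) :
    geodesic κ q e (2 * d) = (2 * cosK κ d) • geodesic κ q e d - q := by
  have h := cosK_sq_add hκ d
  rw [two_mul, geodesic, geodesic, cosK_add hκ, sinK_add hκ]
  funext i
  simp only [Pi.add_apply, Pi.sub_apply, Pi.smul_apply, smul_eq_mul]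
  linear_combination -q i * h

/-- All the quantities in the construction of the outer billiard map, in terms of the tangency
point. -/
theorem tangency_data (hκ : κ = 0 ∨ κ = 1 ∨ κ = -1) (hSM : S ⊆ spaceForm κ)
    {w : UnitTangent κ} {t d : ℝ} {e : V} (h : IsTangency S w p t d e)
    (hr : 0 < rhoSq κ p w.base w.vec) (hne : ∀ r, p ≠ w.curve r) :
    w.curve t = foot κ p w.base w.vec ∧ w.vel t = footVel κ p w.base w.vec ∧
      geodesic κ (w.curve t) e (2 * d) = footRefl κ p w.base w.vec ∧
      form κ (w.vel t) e = 0 ∧ 0 < sinK κ d ∧ cosK κ d • w.curve t + sinK κ d • e = p := by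
  obtain ⟨hpS, -, hmin, hd, he, hpe⟩ := h
  have hp := hSM hpS
  have hu := isUnitTangent_flow hκ w.isUnitTangent t
  have hr' : 0 < rhoSq κ p (w.curve t) (w.vel t) := by
    rw [UnitTangent.curve, UnitTangent.vel, rhoSq_flow hκ hp w.isUnitTangent]; exact hr
  obtain ⟨hb, ha⟩ := bet_eq_zero_of_spaceDist_le hκ hp hu hr' (by
    intro s
    rw [geodesic_geodesic hκ]
    exact hmin _)
  obtain ⟨h1, h2, h3⟩ := sq_of_bet_eq_zero hb ha
  have hrho : rho κ p w.base w.vec = tfun κ p (w.curve t) := by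
    rw [UnitTangent.curve, ← h1, rho, rho, rhoSq_flow hκ hp w.isUnitTangent t]
  rw [foot_flow hκ hp w.isUnitTangent] at h2
  rw [footVel_flow hκ hp w.isUnitTangent] at h3
  obtain ⟨h4, h5, h6⟩ := dist_data hκ hp hu.1 ha
  rw [UnitTangent.curve] at hd
  rw [← hd] at h5 h6
  have hpe' : cosK κ d • w.curve t + sinK κ d • e = p := hpe
  have hy : p - cosK κ d • w.curve t = sinK κ d • e := by rw [← hpe']; abel
  -- If s_κ(d) were 0, then p would be a positive multiple of the nearest point, hence equal to it,
  -- although p is not on the geodesic.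
  have hs : 0 < sinK κ d := by
    have h7 : 0 ≤ sinK κ d := by rw [h6]; exact Real.sqrt_nonneg _
    refine lt_of_le_of_ne h7 fun h0 => ?_
    rw [← h0, zero_smul, add_zero] at hpe'
    have h8 := tfun_self hp
    nth_rewrite 1 [← hpe'] at h8
    rw [tfun_smul_left, tfun_comm, UnitTangent.curve, ← h5] at h8
    have h9 : cosK κ d = 1 := by
      rw [← h5] at ha
      nlinarith
    rw [h9, one_smul] at hpe'
    exact hne t hpe'.symm
  refine ⟨h2.symm, h3.symm, ?_, ?_, hs, hpe'⟩
  · rw [geodesic_two_mul hκ, hpe, h5, footRefl, h2, hrho]; rfl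
  · have h7 : form κ (p - cosK κ d • w.curve t) (w.vel t) = 0 := by
      rw [h5]; exact hb
    rw [hy, form_smul_left, form_comm] at h7
    exact (mul_eq_zero.1 h7).resolve_left hs.ne'

theorem parallelTransport_of_form_eq_zero (x e u : V) (r : ℝ) (h : form κ u e = 0) :
    parallelTransport κ x e r u = u := by
  simp [parallelTransport, h]

theorem exists_tangency (hκ : κ = 0 ∨ κ = 1 ∨ κ = -1) (hSM : S ⊆ spaceForm κ)
    {w : UnitTangent κ} (h : IsTangentAt S p w.base w.vec)
    (hr : 0 < rhoSq κ p w.base w.vec) (hne : ∀ r, p ≠ w.curve r) :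
    ∃ t d e, IsTangency S w p t d e := by
  have hp := hSM h.1
  have hw := w.isUnitTangent
  obtain ⟨t, h1, h2, -, -⟩ := exists_curve_eq_foot hκ hp hw hr
  obtain ⟨hu, hα, hβ⟩ := foot_data hκ hp hw hr
  have hρ : 0 < rho κ p w.base w.vec := Real.sqrt_pos.2 hr
  rw [← hα] at hρ
  rw [← h1, ← h2] at hu hβ
  rw [← h1] at hρ
  change IsUnitTangent κ (w.curve t) (w.vel t) at hu
  change bet κ p (w.curve t) (w.vel t) = 0 at hβ
  change 0 < tfun κ p (w.curve t) at hρ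
  obtain ⟨h4, h5, h6⟩ := dist_data hκ hp hu.1 hρ
  set y := p - tfun κ p (w.curve t) • w.curve t with hy
  have hnn := form_self_nonneg hκ hu.1 h4
  have hy0 : y ≠ 0 := by
    intro h0
    have h8 := tfun_self hp
    have h7 : p = tfun κ p (w.curve t) • w.curve t := sub_eq_zero.1 h0
    nth_rewrite 2 [h7] at h8
    rw [tfun_smul] at h8
    have h9 : tfun κ p (w.curve t) = 1 := by nlinarith
    rw [h9, one_smul] at h7
    exact hne t h7
  have hpos : 0 < form κ y y := lt_of_le_of_ne hnn.1 fun e => hy0 (hnn.2 e.symm)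
  have hs := Real.sqrt_pos.2 hpos
  have hs2 := Real.sq_sqrt hpos.le
  refine ⟨t, spaceDist κ p (w.curve t), (Real.sqrt (form κ y y))⁻¹ • y, h.1,
    ((isTangentAt_iff_curve hκ w).1 h).2, ?_, rfl, ⟨hu.1, ?_, ?_⟩, ?_⟩
  · intro r
    have := spaceDist_le_of_bet_eq_zero hκ hp hu hρ hβ (r - t)
    have h7 : geodesic κ (w.curve t) (w.vel t) (r - t) = w.curve r := by
      have := geodesic_geodesic hκ w.base w.vec t (r - t)
      rwa [add_sub_cancel] at this
    rwa [h7] at this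
  · rw [mem_tangentSpace_iff, tfun_smul, h4, mul_zero]
  · rw [form_smul_left, form_smul_right]
    field_simp
    linarith
  · rw [geodesic, h5, h6, smul_inv_smul₀ hs.ne', hy]
    abel

theorem isUnitTangent_footRefl (hκ : κ = 0 ∨ κ = 1 ∨ κ = -1) (hSM : S ⊆ spaceForm κ)
    {w : UnitTangent κ} {t d : ℝ} {e : V} (h : IsTangency S w p t d e)
    (hr : 0 < rhoSq κ p w.base w.vec) (hne : ∀ r, p ≠ w.curve r) :
    IsUnitTangent κ (footRefl κ p w.base w.vec) (footVel κ p w.base w.vec) := by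
  obtain ⟨h1, h2, h3, h4, h5, h6⟩ := tangency_data hκ hSM h hr hne
  have hp := hSM h.1
  obtain ⟨hu, hα, hβ⟩ := foot_data hκ hp w.isUnitTangent hr
  rw [← h3]
  refine ⟨(isUnitTangent_flow hκ h.2.2.2.2.1 _).1, ?_, hu.2.2⟩
  rw [h3, mem_tangentSpace_iff, footRefl, tfun_sub_left, tfun_smul_left, tfun_vec_eq hκ hu, hβ,
    hu.tfun_vec]
  ring

/-- The value of the map is picked by choice, so every admissible image has to be identified. For
any representative of the geodesic the tangency points are p₁ and p₂ by `tangencyPoint_unique`, the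
orientation excludes exchanging them, and the formulas for the image are invariant under the flow.
-/
theorem outerBilliard_eq (hκ : κ = 0 ∨ κ = 1 ∨ κ = -1) (hS : IsQuadraticallyConvex κ S)
    {x v p₁ p₂ : V} (h : IsUnitTangent κ x v) (T₁ : IsTangentAt S p₁ x v)
    (T₂ : IsTangentAt S p₂ x v) (hvol : 0 < volumeForm x p₁ p₂ v)
    (r₁ : 0 < rhoSq κ p₁ x v) (r₂ : 0 < rhoSq κ p₂ x v) :
    ∃ h' : IsUnitTangent κ (footRefl κ p₁ x v) (footVel κ p₁ x v),
      outerBilliard κ S (UnitTangent.mk x v h).toGeodesic =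
        (UnitTangent.mk (footRefl κ p₁ x v) (footVel κ p₁ x v) h').toGeodesic := by
  have hSM := hS.smooth.1
  set w₀ : UnitTangent κ := ⟨x, v, h⟩ with hw₀
  have n₁ : ∀ r, p₁ ≠ w₀.curve r := by
    intro r hr
    rw [hr] at hvol
    exact hvol.ne' (volumeForm_geodesic _ _ _ _)
  have n₂ : ∀ r, p₂ ≠ w₀.curve r := by
    intro r hr
    rw [hr, volumeForm_swap] at hvol
    exact hvol.ne' (neg_eq_zero.2 (volumeForm_geodesic _ _ _ _))
  have hne : p₁ ≠ p₂ := by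
    rintro rfl
    exact hvol.ne' (volumeForm_self _ _ _)
  obtain ⟨t₁, d₁, e₁, H₁⟩ := exists_tangency hκ hSM (w := w₀) T₁ r₁ n₁
  obtain ⟨t₂, d₂, e₂, H₂⟩ := exists_tangency hκ hSM (w := w₀) T₂ r₂ n₂
  have h' := isUnitTangent_footRefl hκ hSM H₁ r₁ n₁
  refine ⟨h', ?_⟩
  -- The orientation can be read from the tangency points: each is a positive multiple of the
  -- initial velocity of its ray plus a vector in the plane of γ and γ', and that velocity,
  -- orthogonal to γ', is fixed by parallel transport along γ.
  have orient : ∀ (w : UnitTangent κ) {q₁ q₂ : V} {t₁ d₁ t₂ d₂ : ℝ} {e₁ e₂ : V},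
      form κ (w.vel t₁) e₁ = 0 → form κ (w.vel t₂) e₂ = 0 →
      cosK κ d₁ • w.curve t₁ + sinK κ d₁ • e₁ = q₁ →
      cosK κ d₂ • w.curve t₂ + sinK κ d₂ • e₂ = q₂ →
      volumeForm w.base q₁ q₂ w.vec = sinK κ d₁ * sinK κ d₂ * volumeForm w.base
        (parallelTransport κ (w.curve t₁) (w.vel t₁) (-t₁) e₁)
        (parallelTransport κ (w.curve t₂) (w.vel t₂) (-t₂) e₂) w.vec := by
    intro w q₁ q₂ t₁ d₁ t₂ d₂ e₁ e₂ f₁ f₂ c₁ c₂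
    rw [parallelTransport_of_form_eq_zero _ _ _ _ (by rw [form_comm]; exact f₁),
      parallelTransport_of_form_eq_zero _ _ _ _ (by rw [form_comm]; exact f₂),
      ← c₁, ← c₂, UnitTangent.curve, UnitTangent.curve, geodesic, geodesic]
    simp only [smul_add, smul_smul]
    exact volumeForm_curve _ _ _ _ _ _ _ _ _ _
  have hex : ∃ ℓ', IsOuterBilliardImage S w₀.toGeodesic ℓ' := by
    obtain ⟨a1, a2, a3, a4, a5, a6⟩ := tangency_data hκ hSM H₁ r₁ n₁
    obtain ⟨b1, b2, b3, b4, b5, b6⟩ := tangency_data hκ hSM H₂ r₂ n₂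
    refine ⟨(UnitTangent.mk _ _ h').toGeodesic, w₀, rfl, p₁, t₁, d₁, e₁, p₂, t₂, d₂, e₂, H₁, H₂,
      ?_, ?_⟩
    · have := orient w₀ a4 b4 a6 b6
      have hv : 0 < volumeForm w₀.base p₁ p₂ w₀.vec := hvol
      rw [this] at hv
      exact pos_of_mul_pos_right hv (mul_pos a5 b5).le
    · have hPT := parallelTransport_of_form_eq_zero (κ := κ) (w₀.curve t₁) _ _ (2 * d₁) a4
      rw [a2] at hPT
      simp only [a3, a2, hPT]
      exact ⟨h', trivial⟩
  have hspec : IsOuterBilliardImage S w₀.toGeodesic (outerBilliard κ S w₀.toGeodesic) := by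
    rw [outerBilliard, dif_pos hex]; exact hex.choose_spec
  generalize outerBilliard κ S w₀.toGeodesic = ℓ' at hspec
  obtain ⟨w, hw, q₁, t₁, d₁, e₁, q₂, t₂, d₂, e₂, K₁, K₂, hpos, h'', hℓ'⟩ := hspec
  obtain ⟨τ, hb, hv⟩ := (toGeodesic_eq_iff hκ w₀ w).1 hw
  obtain ⟨τ', hb', hv'⟩ := (toGeodesic_eq_iff hκ w w₀).1 hw.symm
  have Q₁ : IsTangentAt S q₁ x v := by
    have := (isTangentAt_iff_curve hκ w).2 ⟨K₁.1, K₁.2.1⟩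
    have h1 := this.flow (κ := κ) τ'
    change IsTangentAt S q₁ (w.curve τ') (w.vel τ') at h1
    rwa [← hb', ← hv'] at h1
  have Q₂ : IsTangentAt S q₂ x v := by
    have := (isTangentAt_iff_curve hκ w).2 ⟨K₂.1, K₂.2.1⟩
    have h1 := this.flow (κ := κ) τ'
    change IsTangentAt S q₂ (w.curve τ') (w.vel τ') at h1
    rwa [← hb', ← hv'] at h1
  have hrho : ∀ q ∈ S, rhoSq κ q w.base w.vec = rhoSq κ q x v := by
    intro q hq
    rw [hb, hv]
    exact rhoSq_flow hκ (hSM hq) h τ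
  have hcase : ∀ q, q = p₁ ∨ q = p₂ →
      0 < rhoSq κ q w.base w.vec ∧ ∀ r, q ≠ w.curve r := by
    have hcurve : ∀ r, w.curve r = w₀.curve (τ + r) := by
      intro r
      rw [UnitTangent.curve, hb, hv]
      exact geodesic_geodesic hκ _ _ _ _
    rintro q (rfl | rfl)
    · refine ⟨by rw [hrho _ T₁.1]; exact r₁, fun r => ?_⟩
      rw [hcurve]; exact n₁ _
    · refine ⟨by rw [hrho _ T₂.1]; exact r₂, fun r => ?_⟩
      rw [hcurve]; exact n₂ _
  have c₁ := hS.tangencyPoint_unique hκ h T₁ T₂ Q₁ hne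
  have c₂ := hS.tangencyPoint_unique hκ h T₁ T₂ Q₂ hne
  obtain ⟨a1, a2, a3, a4, a5, a6⟩ := tangency_data hκ hSM K₁ (hcase _ c₁).1 (hcase _ c₁).2
  obtain ⟨b1, b2, b3, b4, b5, b6⟩ := tangency_data hκ hSM K₂ (hcase _ c₂).1 (hcase _ c₂).2
  have hvol' : 0 < volumeForm x q₁ q₂ v := by
    have h1 := orient w a4 b4 a6 b6
    have h2 : volumeForm w.base q₁ q₂ w.vec = volumeForm x q₁ q₂ v := by
      rw [hb, hv]; exact volumeForm_flow hκ _ _ _ _ _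
    rw [← h2, h1]
    exact mul_pos (mul_pos a5 b5) hpos
  -- Exchanging or merging the two tangency points makes the volume negative or zero.
  have hq : q₁ = p₁ := by
    rcases c₁ with h1 | rfl
    · exact h1
    rcases c₂ with rfl | rfl
    · rw [volumeForm_swap] at hvol'
      linarith
    · rw [volumeForm_self] at hvol'
      exact absurd hvol' (lt_irrefl _)
  subst hq
  rw [hℓ']
  congr 1
  ext1
  · change geodesic κ (w.curve t₁) e₁ (2 * d₁) = footRefl κ q₁ x v
    rw [a3, hb, hv]
    exact footRefl_flow hκ (hSM T₁.1) h τ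
  · change parallelTransport κ (w.curve t₁) e₁ (2 * d₁) (w.vel t₁) = footVel κ q₁ x v
    rw [parallelTransport_of_form_eq_zero _ _ _ _ a4, a2, hb, hv]
    exact footVel_flow hκ (hSM T₁.1) h τ

end

/-! ### From lifts to differentials on Jacobi fields; values of the two-form -/

section

variable {κ : ℝ}

/-! ### The differential of a flow invariant lift -/

/-- The projection to the orthogonal complement of `v` in the tangent space at `x`. -/
def tanProj (κ : ℝ) (x v : V) : V →ₗ[ℝ] V :=
  LinearMap.id - (tfunL κ x : V →ₗ[ℝ] ℝ).smulRight x
    - ((formL κ v : V →ₗ[ℝ] ℝ) ∘ₗ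
        (LinearMap.id - (tfunL κ x : V →ₗ[ℝ] ℝ).smulRight x)).smulRight v

theorem tanProj_apply (x v a : V) : tanProj κ x v a =
    a - tfun κ x a • x - form κ v (a - tfun κ x a • x) • v := by
  simp [tanProj, tfunL_apply, formL_apply]

theorem tfun_tanProj {x v : V} (h : IsUnitTangent κ x v) (a : V) :
    tfun κ x (tanProj κ x v a) = 0 := by
  rw [tanProj_apply, tfun_sub, tfun_sub, tfun_smul, tfun_smul, h.tfun_base, h.tfun_vec]; ring

theorem form_tanProj {x v : V} (h : IsUnitTangent κ x v) (a : V) :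
    form κ (tanProj κ x v a) v = 0 := by
  rw [tanProj_apply, form_sub_left, form_smul_left, h.2.2, form_comm v]; ring

theorem tanProj_eq_self {x v a : V} (h1 : tfun κ x a = 0) (h2 : form κ a v = 0) :
    tanProj κ x v a = a := by
  rw [tanProj_apply, h1, zero_smul, sub_zero, form_comm, h2, zero_smul, sub_zero]

theorem hasDerivAt_jacobi (hκ : κ = 0 ∨ κ = 1 ∨ κ = -1) (a b : V) :
    HasDerivAt (fun r => cosK κ r • a + sinK κ r • b) b 0 := by
  have h := ((hasDerivAt_cosK hκ 0).smul_const a).add ((hasDerivAt_sinK hκ 0).smul_const b)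
  simp only [sinK_zero, cosK_zero, mul_zero, neg_zero, zero_smul, zero_add, one_smul] at h
  exact h

theorem jacobi_differentiableAt (hκ : κ = 0 ∨ κ = 1 ∨ κ = -1) {w : UnitTangent κ}
    (J : jacobiFields w) : DifferentiableAt ℝ (J : ℝ → V) 0 := by
  obtain ⟨_, a, b, -, -, -, -, rfl⟩ := J
  exact (hasDerivAt_jacobi hκ a b).differentiableAt

/-- The initial value and the initial derivative of a Jacobi field. -/
def initialData (hκ : κ = 0 ∨ κ = 1 ∨ κ = -1) (w : UnitTangent κ) :
    jacobiFields w →ₗ[ℝ] V × V where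
  toFun J := ((J : ℝ → V) 0, deriv (J : ℝ → V) 0)
  map_add' I J := by
    rw [Submodule.coe_add, deriv_add (jacobi_differentiableAt hκ I) (jacobi_differentiableAt hκ J)]
    rfl
  map_smul' t J := by
    rw [Submodule.coe_smul, deriv_const_smul _ (jacobi_differentiableAt hκ J)]
    rfl

/-- The Jacobi field with initial data the projections of the given vectors. -/
def ofInitialData (w : UnitTangent κ) : V × V →ₗ[ℝ] jacobiFields w where
  toFun z := ⟨fun r => cosK κ r • tanProj κ w.base w.vec z.1
      + sinK κ r • tanProj κ w.base w.vec z.2,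
    _, _, tfun_tanProj w.isUnitTangent _, form_tanProj w.isUnitTangent _,
      tfun_tanProj w.isUnitTangent _, form_tanProj w.isUnitTangent _, rfl⟩
  map_add' y z := by
    ext1; funext r
    simp only [Prod.fst_add, Prod.snd_add, map_add, smul_add, Submodule.coe_add, Pi.add_apply]
    abel
  map_smul' t z := by
    ext1; funext r
    simp only [Prod.smul_fst, Prod.smul_snd, map_smul, smul_add, RingHom.id_apply,
      Submodule.coe_smul, Pi.smul_apply, smul_comm t]

/-- The velocities of a curve of unit tangent vectors. -/
theorem velocity_constraints (hκ : κ = 0 ∨ κ = 1 ∨ κ = -1) {x v : ℝ → V} {X Y : V}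
    (hx : HasDerivAt x X 0) (hv : HasDerivAt v Y 0)
    (h : ∀ᶠ s in 𝓝 0, IsUnitTangent κ (x s) (v s)) :
    tfun κ (x 0) X = 0 ∧ form κ Y (v 0) = 0 ∧ tfun κ (x 0) Y = -(κ * form κ X (v 0)) := by
  have h0 := h.self_of_nhds
  have e1 : tfun κ (x 0) X = 0 := by
    have h1 := (hasFDerivAt_tfun_self (κ := κ) (x 0)).comp_hasDerivAt 0 hx
    have h2 : (fun s => tfun κ (x s) (x s)) =ᶠ[𝓝 0] fun _ => 1 := by
      filter_upwards [h] with s hs using hs.tfun_base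
    have h3 := (h1.congr_of_eventuallyEq h2.symm).unique (hasDerivAt_const (0 : ℝ) (1 : ℝ))
    simpa [tfunL_apply] using h3
  refine ⟨e1, ?_, ?_⟩
  · have h1 : HasDerivAt (fun s => formL κ (v s) (v s)) _ 0 :=
      ((formL κ).hasFDerivAt.comp_hasDerivAt 0 hv).clm_apply hv
    have h2 : (fun s => formL κ (v s) (v s)) =ᶠ[𝓝 0] fun _ => 1 := by
      filter_upwards [h] with s hs
      rw [formL_apply, hs.2.2]
    have h3 := (h1.congr_of_eventuallyEq h2.symm).unique (hasDerivAt_const (0 : ℝ) (1 : ℝ))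
    simp only [Function.comp_apply, formL_apply, form_comm (v 0)] at h3
    linarith
  · have h1 : HasDerivAt (fun s => tfunL κ (x s) (v s)) _ 0 :=
      ((tfunL κ).hasFDerivAt.comp_hasDerivAt 0 hx).clm_apply hv
    have h2 : (fun s => tfunL κ (x s) (v s)) =ᶠ[𝓝 0] fun _ => 0 := by
      filter_upwards [h] with s hs
      rw [tfunL_apply, hs.tfun_vec]
    have h3 := (h1.congr_of_eventuallyEq h2.symm).unique (hasDerivAt_const (0 : ℝ) (0 : ℝ))
    simp only [Function.comp_apply, tfunL_apply] at h3
    rw [tfun_tangent hκ h0.1 e1] at h3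
    linarith

/-- The Jacobi field of a variation by unit speed geodesics. -/
theorem variation_eq (hκ : κ = 0 ∨ κ = 1 ∨ κ = -1) {x v : ℝ → V} {X Y : V}
    (hx : HasDerivAt x X 0) (hv : HasDerivAt v Y 0)
    (h : ∀ᶠ s in 𝓝 0, IsUnitTangent κ (x s) (v s)) (r : ℝ) :
    deriv (fun s => geodesic κ (x s) (v s) r) 0
        - form κ (deriv (fun s => geodesic κ (x s) (v s) r) 0) (geodesicVel κ (x 0) (v 0) r)
          • geodesicVel κ (x 0) (v 0) r
      = cosK κ r • tanProj κ (x 0) (v 0) X + sinK κ r • tanProj κ (x 0) (v 0) Y ∧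
    tanProj κ (x 0) (v 0) X = X - form κ X (v 0) • v 0 ∧
    tanProj κ (x 0) (v 0) Y = Y + (κ * form κ X (v 0)) • x 0 := by
  obtain ⟨e1, e2, e3⟩ := velocity_constraints hκ hx hv h
  have h0 := h.self_of_nhds
  have hd : deriv (fun s => geodesic κ (x s) (v s) r) 0 = cosK κ r • X + sinK κ r • Y :=
    ((hx.const_smul (cosK κ r)).add (hv.const_smul (sinK κ r))).deriv
  have p1 : tanProj κ (x 0) (v 0) X = X - form κ X (v 0) • v 0 := by
    rw [tanProj_apply, e1, zero_smul, sub_zero, form_comm]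
  have p2 : tanProj κ (x 0) (v 0) Y = Y + (κ * form κ X (v 0)) • x 0 := by
    have h1 := smul_form_base hκ h0.1 h0.tfun_vec
    have h2 : form κ (v 0) (Y - tfun κ (x 0) Y • x 0) = 0 := by
      rw [form_sub_right, form_smul_right, e3, form_comm (v 0) Y, e2, form_comm (v 0)]
      linear_combination form κ X (v 0) * h1
    rw [tanProj_apply, h2, zero_smul, sub_zero, e3, neg_smul, sub_neg_eq_add]
  refine ⟨?_, p1, p2⟩
  have ha := tfun_tanProj h0 X
  have ha' := form_tanProj h0 X
  have hb := tfun_tanProj h0 Y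
  have hb' := form_tanProj h0 Y
  set a := tanProj κ (x 0) (v 0) X
  set b := tanProj κ (x 0) (v 0) Y
  have hsum : cosK κ r • X + sinK κ r • Y =
      (cosK κ r • a + sinK κ r • b) + form κ X (v 0) • geodesicVel κ (x 0) (v 0) r := by
    rw [p1, p2, geodesicVel]
    module
  have hperp : form κ (cosK κ r • a + sinK κ r • b) (geodesicVel κ (x 0) (v 0) r) = 0 := by
    have k1 := smul_form_base hκ h0.1 ha
    have k2 := smul_form_base hκ h0.1 hb
    rw [form_comm] at k1 k2
    rw [form_geodesicVel, form_add, form_add, form_smul_left, form_smul_left, form_smul_left,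
      form_smul_left, ha', hb']
    linear_combination -sinK κ r * cosK κ r * k1 - sinK κ r ^ 2 * k2
  rw [hd, hsum, form_add, hperp, form_smul_left, (isUnitTangent_flow hκ h0 r).2.2, zero_add,
    mul_one, add_sub_cancel_right]

/-- A map with a smooth lift whose differential vanishes along the geodesic flow has a
differential. -/
theorem exists_hasDifferential (hκ : κ = 0 ∨ κ = 1 ∨ κ = -1)
    {f : OrientedGeodesic κ → OrientedGeodesic κ} {w w' : UnitTangent κ} {F : V × V → V × V}
    (hF : ContDiffAt ℝ ∞ F (w.base, w.vec)) (hF0 : F (w.base, w.vec) = (w'.base, w'.vec))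
    (hlift : ∀ᶠ z in 𝓝 (w.base, w.vec), ∀ h : IsUnitTangent κ z.1 z.2,
      ∃ h' : IsUnitTangent κ (F z).1 (F z).2,
        f (UnitTangent.mk z.1 z.2 h).toGeodesic = (UnitTangent.mk (F z).1 (F z).2 h').toGeodesic)
    (hflow : fderiv ℝ F (w.base, w.vec) (w.vec, -(κ • w.base)) = 0) :
    HasDifferential f w w' ((ofInitialData w').comp
      ((fderiv ℝ F (w.base, w.vec) : V × V →ₗ[ℝ] V × V).comp (initialData hκ w))) := by
  refine ⟨⟨F, hF, hF0, hlift⟩, ?_⟩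
  rintro c J ⟨x, v, hx, hv, hx0, hv0, hc, hJ⟩
  have hxd : HasDerivAt x (deriv x 0) 0 := (hx.differentiableAt (by simp)).hasDerivAt
  have hvd : HasDerivAt v (deriv v 0) 0 := (hv.differentiableAt (by simp)).hasDerivAt
  have hz : ContDiffAt ℝ ∞ (fun s => (x s, v s)) 0 := hx.prodMk hv
  have hz0 : (x 0, v 0) = (w.base, w.vec) := by rw [hx0, hv0]
  have hF' : ContDiffAt ℝ ∞ (fun s => F (x s, v s)) 0 := by
    rw [← hz0] at hF
    exact hF.comp (0 : ℝ) hz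
  set D := fderiv ℝ F (w.base, w.vec) with hD
  have hFd : HasDerivAt (fun s => F (x s, v s)) (D (deriv x 0, deriv v 0)) 0 := by
    have h1 : HasFDerivAt F D (x 0, v 0) := by
      rw [hz0]; exact (hF.differentiableAt (by simp)).hasFDerivAt
    exact h1.comp_hasDerivAt (0 : ℝ) (hxd.prodMk hvd)
  have hUT : ∀ᶠ s in 𝓝 0, IsUnitTangent κ (x s) (v s) := hc.mono fun s hs => hs.1
  have hlift' := hz.continuousAt.eventually (hz0 ▸ hlift)
  have hnew : ∀ᶠ s in 𝓝 (0 : ℝ), ∃ h : IsUnitTangent κ (F (x s, v s)).1 (F (x s, v s)).2,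
      (f ∘ c) s = (UnitTangent.mk (F (x s, v s)).1 (F (x s, v s)).2 h).toGeodesic := by
    filter_upwards [hc, hlift'] with s hs hs'
    obtain ⟨h, hcs⟩ := hs
    obtain ⟨h', hfs⟩ := hs' h
    exact ⟨h', by rw [Function.comp_apply, hcs]; exact hfs⟩
  have hUT' : ∀ᶠ s in 𝓝 0, IsUnitTangent κ (F (x s, v s)).1 (F (x s, v s)).2 :=
    hnew.mono fun s hs => hs.1
  have hJ' : (J : ℝ → V) = fun r => cosK κ r • (deriv x 0 - form κ (deriv x 0) w.vec • w.vec)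
      + sinK κ r • (deriv v 0 + (κ * form κ (deriv x 0) w.vec) • w.base) := by
    funext r
    obtain ⟨h1, h2, h3⟩ := variation_eq hκ hxd hvd hUT r
    rw [h2, h3, hx0, hv0] at h1
    rw [hJ r]
    exact h1
  -- The initial data of J are the velocities of x and v minus a multiple of the flow direction (v,
  -- -κx), which D kills by `hflow`.
  have hdata : D (initialData hκ w J) = D (deriv x 0, deriv v 0) := by
    have h1 : initialData hκ w J = (deriv x 0, deriv v 0)
        - form κ (deriv x 0) w.vec • (w.vec, -(κ • w.base)) := by
      change ((J : ℝ → V) 0, deriv (J : ℝ → V) 0) = _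
      rw [hJ', (hasDerivAt_jacobi hκ _ _).deriv]
      ext1
      · simp
      · simp [smul_smul, mul_comm]
    rw [h1, map_sub, map_smul, hflow, smul_zero, sub_zero]
  have b1 : (F (x 0, v 0)).1 = w'.base := by rw [hz0, hF0]
  have b2 : (F (x 0, v 0)).2 = w'.vec := by rw [hz0, hF0]
  refine ⟨fun s => (F (x s, v s)).1, fun s => (F (x s, v s)).2, hF'.fst, hF'.snd, b1, b2, hnew, ?_⟩
  intro r
  have h1 := (variation_eq hκ hFd.fst hFd.snd hUT' r).1
  rw [b1, b2] at h1
  refine Eq.trans ?_ h1.symm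
  simp only [LinearMap.comp_apply, ContinuousLinearMap.coe_coe, hdata]
  rfl

/-! ### The fundamental form -/

theorem volumeForm_cycle (x a b c : V) : volumeForm x a b c = volumeForm x b c a := by
  simp only [volumeForm_eq]; ring

/-- The expression involves x and v only through x ∧ v, which the flow preserves. -/
theorem cross_flow (hκ : κ = 0 ∨ κ = 1 ∨ κ = -1) (x v a : V) (r : ℝ) :
    cross κ (geodesic κ x v r) (geodesicVel κ x v r) a = cross κ x v a := by
  funext i
  simp only [cross]
  congr 1
  rw [volumeForm_cycle, volumeForm_flow hκ, volumeForm_cycle x v]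

theorem cross_smul (x v a : V) (t : ℝ) : cross κ x v (t • a) = t • cross κ x v a := by
  funext i
  simp only [cross, volumeForm_eq, Pi.smul_apply, smul_eq_mul]
  ring

theorem cross_zero_left (x a : V) : cross κ x 0 a = 0 := by
  funext i
  simp [cross, volumeForm_eq]

theorem tfun_cross (x v a : V) : tfun κ x (cross κ x v a) = 0 := by
  simp only [tfun, cross, volumeForm_eq, Pi.single_apply]
  simp
  ring

/-- A Gram determinant identity: the squared length is, up to signs depending on κ, the Gram
determinant of x, v, e, or of v, e alone when κ = 0. -/
theorem form_cross_self (hκ : κ = 0 ∨ κ = 1 ∨ κ = -1) {x v e : V} (h : IsUnitTangent κ x v)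
    (he : tfun κ x e = 0) (hev : form κ e v = 0) (hee : form κ e e = 1) :
    form κ (cross κ x v e) (cross κ x v e) = 1 := by
  have hxx := h.tfun_base
  have hxv := h.tfun_vec
  have hvv := h.2.2
  have hx0 := base_zero hκ h.1
  have hv0 := h.vec_zero hκ
  have he0 := tangent_zero' hκ h.1 he
  have expand : ∀ i, cross κ x v e i = (if i = 0 then κ else 1) *
      volumeForm x v e (Pi.single i 1) := fun i => rfl
  rcases hκ with rfl | rfl | rfl
  · have hx0 : x 0 = 1 := by linarith
    have hv0 : v 0 = 0 := by linarith
    have he0 : e 0 = 0 := by linarith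
    have key : form 0 (cross 0 x v e) (cross 0 x v e) =
        form 0 v v * form 0 e e - form 0 e v ^ 2 := by
      simp only [form, expand, volumeForm_eq, Pi.single_apply, hx0, hv0, he0]
      simp
      ring
    rw [key, hvv, hee, hev]; norm_num
  · have key : form 1 (cross 1 x v e) (cross 1 x v e) =
        tfun 1 x x * form 1 v v * form 1 e e + 2 * tfun 1 x v * tfun 1 x e * form 1 e v
        - tfun 1 x x * form 1 e v ^ 2 - form 1 v v * tfun 1 x e ^ 2
        - form 1 e e * tfun 1 x v ^ 2 := by
      simp only [form, tfun, expand, volumeForm_eq, Pi.single_apply]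
      simp
      ring
    rw [key, hvv, hee, hev, hxx, hxv, he]; norm_num
  · have key : form (-1) (cross (-1) x v e) (cross (-1) x v e) =
        tfun (-1) x x * form (-1) v v * form (-1) e e
        - 2 * tfun (-1) x v * tfun (-1) x e * form (-1) e v
        - tfun (-1) x x * form (-1) e v ^ 2 + form (-1) v v * tfun (-1) x e ^ 2
        + form (-1) e e * tfun (-1) x v ^ 2 := by
      simp only [form, tfun, expand, volumeForm_eq, Pi.single_apply]
      simp
      ring
    rw [key, hvv, hee, hev, hxx, hxv, he]; norm_num

/-- The fundamental form on the Jacobi fields `c_κ a` and `s_κ b`. -/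
theorem omegaCross_eq (hκ : κ = 0 ∨ κ = 1 ∨ κ = -1) {w : UnitTangent κ} {I J : jacobiFields w}
    {e : V} {t : ℝ} (he : tfun κ w.base e = 0) (hev : form κ e w.vec = 0)
    (hee : form κ e e = 1) (hI : (I : ℝ → V) = fun r => cosK κ r • (t • e))
    (hJ : (J : ℝ → V) = fun r => sinK κ r • e) : omegaCross w I J = -(1 / 2) * t := by
  have hw := w.isUnitTangent
  set k := cross κ w.base w.vec e with hk
  have hkt : tfun κ w.base k = 0 := tfun_cross _ _ _
  have hk0 : κ ^ 2 * k 0 = k 0 := tangent_zero hκ hw.1 hkt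
  have hkk : form κ k k = 1 := form_cross_self hκ hw he hev hee
  have hkv : form κ w.vec k = 0 := by
    rw [form_comm, hk, form_cross _ _ _ _ (tangent_zero hκ hw.1 hw.tfun_vec)]
    simp only [volumeForm_eq]; ring
  have hK : complexStructure w (I : ℝ → V) = fun r => cosK κ r • (t • k) + sinK κ r • (0 : V) := by
    funext r
    rw [complexStructure, UnitTangent.curve, UnitTangent.vel, cross_flow hκ, hI, cross_smul,
      cross_smul, smul_zero, add_zero]
  have hJ' : (J : ℝ → V) = fun r => cosK κ r • (0 : V) + sinK κ r • e := by
    rw [hJ]; funext r; simp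
  rw [omegaCross, crossMetric, crossMetricAt, hK, hJ',
    covDeriv_eq hκ w (Submodule.zero_mem _) (form_zero_left _) he hev,
    covDeriv_eq hκ w (Submodule.smul_mem _ t hkt)
      (by rw [form_smul_left, form_comm, hkv, mul_zero]) (Submodule.zero_mem _) (form_zero_left _)]
  -- Since J vanishes at 0, only ½⟨𝒥I × J', γ'⟩ survives. With k = v × e it equals -(t/2) vol(v, e,
  -- k) = -(t/2)⟨k, k⟩.
  simp only [cosK_zero, sinK_zero, mul_zero, zero_smul, one_smul, add_zero, sub_zero,
    UnitTangent.curve, UnitTangent.vel, geodesic_zero, geodesicVel_zero, cross_zero_left]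
  rw [form_cross _ _ _ _ (tangent_zero hκ hw.1 hw.tfun_vec)]
  have h1 : volumeForm w.base (t • k) e w.vec = -t * volumeForm w.base w.vec e k := by
    simp only [volumeForm_eq, Pi.smul_apply, smul_eq_mul]; ring
  rw [h1, ← form_cross _ _ _ _ hk0, ← hk, hkk]
  ring

end

/-! ### A good geodesic: a second tangency point, and avoiding distance π/2 -/

section

variable {κ : ℝ} {S : Set V} {p : V}

/-! ### Geodesics with two tangent surfaces -/

theorem exists_ne_zero_of_functionals {k : ℕ} (hk : k < 4) (f : Fin k → V →ₗ[ℝ] ℝ) :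
    ∃ u : V, u ≠ 0 ∧ ∀ i, f i u = 0 := by
  have h : LinearMap.ker (LinearMap.pi f) ≠ ⊥ := by
    apply LinearMap.ker_ne_bot_of_finrank_lt
    simpa using hk
  obtain ⟨u, hu, hu0⟩ := Submodule.exists_mem_ne_zero_of_ne_bot h
  exact ⟨u, hu0, fun i => congrFun (LinearMap.mem_ker.1 hu) i⟩

theorem IsSmoothSurface.exists_orthonormal (hκ : κ = 0 ∨ κ = 1 ∨ κ = -1)
    (hS : IsSmoothSurface κ S) (hp : p ∈ S) : ∃ e ∈ surfaceTangent S p,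
      ∃ v ∈ surfaceTangent S p, form κ e e = 1 ∧ form κ v v = 1 ∧ form κ e v = 0 := by
  obtain ⟨O, h, H⟩ := hS.exists_isLocalEquation hp
  have hpM := hS.1 hp
  rw [H.surfaceTangent_eq]
  obtain ⟨a, ha0, ha⟩ := exists_ne_zero_of_functionals (k := 2) (by norm_num)
    ![(tfunL κ p : V →ₗ[ℝ] ℝ), (fderiv ℝ h p : V →ₗ[ℝ] ℝ)]
  have ha1 : tfun κ p a = 0 := by simpa [tfunL_apply] using ha 0
  have ha2 : fderiv ℝ h p a = 0 := by simpa using ha 1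
  obtain ⟨s, hs⟩ := exists_unit_smul hκ hpM ha1 ha0
  obtain ⟨b, hb0, hb⟩ := exists_ne_zero_of_functionals (k := 3) (by norm_num)
    ![(tfunL κ p : V →ₗ[ℝ] ℝ), (fderiv ℝ h p : V →ₗ[ℝ] ℝ), (formL κ a : V →ₗ[ℝ] ℝ)]
  have hb1 : tfun κ p b = 0 := by simpa [tfunL_apply] using hb 0
  have hb2 : fderiv ℝ h p b = 0 := by simpa using hb 1
  have hb3 : form κ a b = 0 := by simpa [formL_apply] using hb 2
  obtain ⟨t, ht⟩ := exists_unit_smul hκ hpM hb1 hb0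
  refine ⟨s • a, Submodule.smul_mem _ _ (IsLocalEquation.mem_plane.2 ⟨ha1, ha2⟩), t • b,
    Submodule.smul_mem _ _ (IsLocalEquation.mem_plane.2 ⟨hb1, hb2⟩), hs, ht, ?_⟩
  rw [form_smul_left, form_smul_right, hb3]; ring

theorem IsSmoothSurface.exists_ne (hκ : κ = 0 ∨ κ = 1 ∨ κ = -1)
    (hS : IsSmoothSurface κ S) (hp : p ∈ S) : ∃ y ∈ S, y ≠ p := by
  by_contra hcon
  push Not at hcon
  obtain ⟨e, ⟨c, hc, -, hcS, hce⟩, -, -, he, -⟩ := hS.exists_orthonormal hκ hp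
  have h1 : c =ᶠ[𝓝 0] fun _ => p := hcS.mono fun s hs => hcon _ hs
  rw [← hce, h1.deriv_eq, deriv_const, form_zero_left] at he
  exact zero_ne_one he

/-- A linear functional that is nonnegative on the surface and vanishes at a point of it vanishes
on the tangent plane there. -/
theorem functional_eq_zero_of_nonneg {g : V →L[ℝ] ℝ} (hg : ∀ x ∈ S, 0 ≤ g x) (h0 : g p = 0)
    {u : V} (hu : u ∈ surfaceTangent S p) : g u = 0 := by
  obtain ⟨c, hc, rfl, hcS, rfl⟩ := hu
  have hd := g.hasFDerivAt.comp_hasDerivAt 0 (hc.differentiableAt (by simp)).hasDerivAt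
  have hmin : IsLocalMin (g ∘ c) 0 := by
    filter_upwards [hcS] with s hs
    rw [Function.comp_apply, Function.comp_apply, h0]
    exact hg _ hs
  exact hmin.hasDerivAt_eq_zero hd

/-- The hyperplanes containing ℓ form a pencil, spanned by g and the supporting functional `lam` at
p. Let m be the minimum of g / lam on S away from p, attained at q. Then g - m lam is nonnegative on
S and zero at q, so it vanishes on the tangent hyperplane at q and is a multiple of the functional
there. That functional therefore kills x and v as well. -/
theorem IsQuadraticallyConvex.exists_second_tangencyPoint (hκ : κ = 0 ∨ κ = 1 ∨ κ = -1)
    (hS : IsQuadraticallyConvex κ S) {x v : V} (hp : IsTangentAt S p x v) (g : V →L[ℝ] ℝ)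
    (hgx : g x = 0) (hgv : g v = 0) (hgp : 0 < g p) :
    ∃ q, IsTangentAt S q x v ∧ q ≠ p := by
  obtain ⟨n, hn, hpos⟩ := hS.exists_support hκ hp.1
  obtain ⟨y, hyS, hyp⟩ := hS.smooth.exists_ne hκ hp.1
  have hself : lam κ p n p = 0 := lam_self hκ (hS.smooth.1 hp.1) hn.1
  have htan := (isTangentAt_iff hκ hS.smooth hp.1 hn).1 hp
  have hcl := continuous_lam (κ := κ) p n
  set m₀ := g y / lam κ p n y with hm₀
  -- A sublevel set of the ratio, written without denominators so that it is closed. It omits p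
  -- because g p > 0, so the ratio is continuous on a compact set.
  set T := S ∩ {z | g z ≤ m₀ * lam κ p n z} with hT
  have hTc : IsCompact T := hS.compact.inter_right (isClosed_le g.continuous (by fun_prop))
  have hyT : y ∈ T := by
    refine ⟨hyS, ?_⟩
    change g y ≤ m₀ * lam κ p n y
    rw [hm₀, div_mul_cancel₀ _ (hpos y hyS hyp).ne']
  have hTp : ∀ z ∈ T, 0 < lam κ p n z := by
    rintro z ⟨hzS, hz⟩
    apply hpos z hzS
    rintro rfl
    have hz : g z ≤ m₀ * lam κ z n z := hz
    rw [hself, mul_zero] at hz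
    linarith
  obtain ⟨q, hqT, hqmin⟩ := hTc.exists_isMinOn ⟨y, hyT⟩ (f := fun z => g z / lam κ p n z)
    (ContinuousOn.div g.continuous.continuousOn hcl.continuousOn fun z hz => (hTp z hz).ne')
  set m := g q / lam κ p n q with hm
  have hmm₀ : m ≤ m₀ := hqmin hyT
  have hqS : q ∈ S := hqT.1
  have hlq := hTp q hqT
  have hqp : q ≠ p := by
    rintro rfl
    linarith
  set G : V →L[ℝ] ℝ := g - m • lamL κ p n with hG
  have hGa : ∀ z, G z = g z - m * lam κ p n z := fun z => by simp [hG, lamL_apply]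
  have hGnn : ∀ z ∈ S, 0 ≤ G z := by
    intro z hz
    rw [hGa]
    rcases eq_or_ne z p with rfl | hzp
    · rw [hself]; linarith
    have hlz := hpos z hz hzp
    by_cases hzT : z ∈ T
    · have h1 : m ≤ g z / lam κ p n z := hqmin hzT
      rw [le_div_iff₀ hlz] at h1
      linarith
    · have h1 : m₀ * lam κ p n z < g z := by
        by_contra hcon
        exact hzT ⟨hz, not_lt.1 hcon⟩
      nlinarith
  have hGq : G q = 0 := by
    rw [hGa, hm, div_mul_cancel₀ _ hlq.ne', sub_self]
  obtain ⟨ν, hν⟩ := hS.exists_support hκ hqS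
  have hνn := hν.1
  have hGlam : ∀ z, G z = lam κ q ν z * G ν := by
    intro z
    have h1 : z - lam κ q ν z • ν ∈ Submodule.span ℝ (insert q (surfaceTangent S q)) := by
      rw [mem_span_iff_lam_eq_zero hκ hS.smooth hqS hνn, lam_sub, lam_smul,
        hνn.lam_normal hκ (hS.smooth.1 hqS)]
      ring
    have h2 : Submodule.span ℝ (insert q (surfaceTangent S q)) ≤
        LinearMap.ker (G : V →ₗ[ℝ] ℝ) := by
      rw [Submodule.span_le, Set.insert_subset_iff]
      exact ⟨hGq, fun u hu => functional_eq_zero_of_nonneg hGnn hGq hu⟩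
    have h3 : G (z - lam κ q ν z • ν) = 0 := h2 h1
    rw [map_sub, map_smul, smul_eq_mul, sub_eq_zero] at h3
    exact h3
  -- Otherwise G would be zero, but G p = g p > 0.
  have hGν : G ν ≠ 0 := by
    intro h0
    have h1 := hGlam p
    rw [h0, mul_zero, hGa, hself] at h1
    linarith
  refine ⟨q, (isTangentAt_iff hκ hS.smooth hqS hνn).2 ⟨?_, ?_⟩, hqp⟩
  · have h1 := hGlam x
    rw [hGa, hgx, htan.1, mul_zero, sub_zero] at h1
    exact (mul_eq_zero.1 h1.symm).resolve_right hGν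
  · have h1 := hGlam v
    rw [hGa, hgv, htan.2, mul_zero, sub_zero] at h1
    exact (mul_eq_zero.1 h1.symm).resolve_right hGν

theorem tendsto_geodesic_neg (hκ : κ = 0 ∨ κ = 1 ∨ κ = -1) (x v : V) {d : ℕ → ℝ}
    (hd : Filter.Tendsto d Filter.atTop (𝓝 0)) :
    Filter.Tendsto (fun k => geodesic κ x v (-d k)) Filter.atTop (𝓝 x) := by
  have h1 := (hasDerivAt_geodesic hκ x v 0).continuousAt.tendsto
  rw [geodesic_zero] at h1
  have h2 := hd.neg
  rw [neg_zero] at h2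
  exact h1.comp h2

/-- Geodesics tangent to the surface sufficiently close to `p` are not at distance `π / 2` from
any of their tangency points. -/
theorem IsQuadraticallyConvex.exists_close (hκ : κ = 0 ∨ κ = 1 ∨ κ = -1)
    (hS : IsQuadraticallyConvex κ S) (hp : p ∈ S) (e v : V)
    (hv : ∀ d, IsUnitTangent κ (geodesic κ p e (-d)) v) :
    ∃ d, 0 < d ∧ d < 1 ∧ ∀ q, IsTangentAt S q (geodesic κ p e (-d)) v →
      0 < rhoSq κ q (geodesic κ p e (-d)) v := by
  by_cases hκ1 : κ = 1
  swap
  · exact ⟨1 / 2, by norm_num, by norm_num, fun q hq =>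
      rhoSq_pos (by tauto) (hS.smooth.1 hq.1) (hv _)⟩
  -- Suppose there are bad tangency points for all d = 1/(k + 2). A limit a of them satisfies tfun a
  -- p = 0, and p lies in the surface tangent at a. Strict convexity gives a = p, contrary to tfun p
  -- p = 1.
  by_contra hcon
  push Not at hcon
  set d : ℕ → ℝ := fun k => 1 / ((k : ℝ) + 2) with hd
  have hd0 : ∀ k, 0 < d k := fun k => by positivity
  have hd1 : ∀ k, d k < 1 := fun k => by
    rw [hd]
    simp only
    rw [div_lt_one (by positivity)]
    have : (0 : ℝ) ≤ k := Nat.cast_nonneg k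
    linarith
  choose q hqT hqr using fun k => hcon (d k) (hd0 k) (hd1 k)
  obtain ⟨a, haS, φ, hφ, hlim⟩ := hS.compact.tendsto_subseq fun k => (hqT k).1
  have hdlim : Filter.Tendsto d Filter.atTop (𝓝 0) := by
    have h1 := tendsto_one_div_add_atTop_nhds_zero_nat (𝕜 := ℝ)
    refine squeeze_zero (fun k => (hd0 k).le) (fun k => ?_) h1
    rw [hd]
    simp only
    gcongr
    norm_num
  have hx := tendsto_geodesic_neg hκ p e (hdlim.comp hφ.tendsto_atTop)
  have hpair := hlim.prodMk_nhds hx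
  have h0 : tfun κ a p = 0 := by
    have hcont : Continuous (fun z : V × V => tfun κ z.1 z.2) := by unfold tfun; fun_prop
    have h2 := (hcont.tendsto (a, p)).comp hpair
    refine tendsto_nhds_unique h2 ?_
    refine tendsto_const_nhds.congr fun k => ?_
    have h3 := hqr (φ k)
    rw [rhoSq, hκ1] at h3
    have h4 : tfun 1 (q (φ k)) (geodesic 1 p e (-d (φ k))) = 0 := by
      rw [← pow_eq_zero_iff (two_ne_zero)]
      nlinarith [sq_nonneg (tfun 1 (q (φ k)) (geodesic 1 p e (-d (φ k)))),
        sq_nonneg (bet 1 (q (φ k)) (geodesic 1 p e (-d (φ k))) v)]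
    rw [hκ1]
    exact h4.symm
  obtain ⟨n, hn, -⟩ := hS.definite a haS
  have hlim' : Filter.Tendsto (fun k => q (φ k)) Filter.atTop (𝓝[S] a) :=
    tendsto_nhdsWithin_iff.2 ⟨hlim, Filter.Eventually.of_forall fun k => (hqT _).1⟩
  have hev := hlim'.eventually hn.isNormal
  have hlam : lam κ a (n a) p = 0 := by
    have hcont : ContinuousAt (fun z : V × V => lam κ z.1 (n z.1) z.2) (a, p) := by
      have h1 : ContDiffAt ℝ ∞ (fun z : V × V => n z.1) (a, p) :=
        ContDiffAt.comp (a, p) (g := n) hn.1 contDiffAt_fst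
      exact (contDiffAt_lam contDiffAt_fst h1 contDiffAt_snd).continuousAt
    refine tendsto_nhds_unique (hcont.tendsto.comp hpair) ?_
    refine tendsto_const_nhds.congr' ?_
    filter_upwards [hev] with k hk
    exact ((isTangentAt_iff hκ hS.smooth (hqT (φ k)).1 hk).1 (hqT (φ k))).1.symm
  have hpa : p = a := hS.strictlyConvex a haS p hp ⟨hS.smooth.1 hp,
    (mem_span_iff_lam_eq_zero hκ hS.smooth haS (hn.isNormal_self haS) p).2 hlam⟩
  rw [← hpa, tfun_self (hS.smooth.1 hp)] at h0
  exact one_ne_zero h0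

/-- In a linear relation among x, p, q, v, the supporting functional at p kills all terms but that
of q, and the one at q all but that of p; x and v are independent. -/
theorem volumeForm_ne_zero (hκ : κ = 0 ∨ κ = 1 ∨ κ = -1)
    (hS : IsQuadraticallyConvex κ S) {x v p q : V} (h : IsUnitTangent κ x v)
    (hp : IsTangentAt S p x v) (hq : IsTangentAt S q x v) (hpq : p ≠ q) :
    volumeForm x p q v ≠ 0 := by
  intro h0
  obtain ⟨a, ha, hrel⟩ := Matrix.exists_vecMul_eq_zero_iff.2 h0
  apply ha
  have hrel' : a 0 • x + a 1 • p + a 2 • q + a 3 • v = 0 := by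
    rw [← hrel]
    funext i
    simp [Matrix.vecMul, dotProduct, Fin.sum_univ_four]
  have hzero : ∀ {r s : V}, IsTangentAt S r x v → s ∈ S → s ≠ r →
      ∀ b c : ℝ, a 0 • x + b • r + c • s + a 3 • v = 0 → c = 0 := by
    intro r s hr hs hsr b c hrel
    obtain ⟨n, hn, hpos⟩ := hS.exists_support hκ hr.1
    have ht := (isTangentAt_iff hκ hS.smooth hr.1 hn).1 hr
    have h1 := congrArg (lamL κ r n) hrel
    simp only [map_add, map_smul, lamL_apply, map_zero, ht.1, ht.2, smul_eq_mul,
      lam_self hκ (hS.smooth.1 hr.1) hn.1] at h1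
    have h2 := hpos s hs hsr
    have h3 : c * lam κ r n s = 0 := by linarith
    exact (mul_eq_zero.1 h3).resolve_right h2.ne'
  have h2 := hzero hp hq.1 hpq.symm (a 1) (a 2) hrel'
  have h1 := hzero hq hp.1 hpq (a 2) (a 1) (by rw [← hrel']; abel)
  rw [h1, h2, zero_smul, zero_smul, add_zero, add_zero] at hrel'
  have h3 := LinearIndependent.pair_iff.1 h.linearIndependent _ _ hrel'
  funext i
  fin_cases i
  · exact h3.1
  · exact h1
  · exact h2
  · exact h3.2

/-- The supporting functional at q kills x and v but is positive at p. -/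
theorem linearIndependent_of_tangent (hκ : κ = 0 ∨ κ = 1 ∨ κ = -1)
    (hS : IsQuadraticallyConvex κ S) {x v p q : V} (h : IsUnitTangent κ x v)
    (hp : IsTangentAt S p x v) (hq : IsTangentAt S q x v) (hpq : p ≠ q) :
    LinearIndependent ℝ ![p, x, v] := by
  obtain ⟨n, hn, hpos⟩ := hS.exists_support hκ hq.1
  have ht := (isTangentAt_iff hκ hS.smooth hq.1 hn).1 hq
  refine linearIndependent_finCons.2 ⟨h.linearIndependent, fun hmem => ?_⟩
  have hle : Submodule.span ℝ (Set.range ![x, v]) ≤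
      LinearMap.ker (lamL κ q n : V →ₗ[ℝ] ℝ) := by
    rw [Submodule.span_le]
    rintro _ ⟨i, rfl⟩
    fin_cases i <;> simp [lamL_apply, ht.1, ht.2]
  have h1 : lamL κ q n p = 0 := hle hmem
  rw [lamL_apply] at h1
  exact (hpos p hp.1 hpq).ne' h1

/-- A point of S on the geodesic would lie in both tangent surfaces, hence coincide with both p and
q. -/
theorem mem_billiardTable (hκ : κ = 0 ∨ κ = 1 ∨ κ = -1)
    (hS : IsQuadraticallyConvex κ S) {w : UnitTangent κ} {p q : V}
    (hp : IsTangentAt S p w.base w.vec) (hq : IsTangentAt S q w.base w.vec) (hpq : p ≠ q)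
    (hr : ∀ a, IsTangentAt S a w.base w.vec → 0 < rhoSq κ a w.base w.vec) :
    w.toGeodesic ∈ billiardTable κ S := by
  constructor
  · rintro y ⟨w', hw', r, rfl⟩ hy
    obtain ⟨t, hb, hv⟩ := (toGeodesic_eq_iff hκ w w').1 hw'
    have hcurve : w'.curve r = w.curve (t + r) := by
      rw [UnitTangent.curve, hb, hv]
      exact geodesic_geodesic hκ _ _ _ _
    rw [hcurve] at hy
    have h1 := ((isTangentAt_iff_curve hκ w).1 hp).2 (t + r)
    have h2 := ((isTangentAt_iff_curve hκ w).1 hq).2 (t + r)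
    exact hpq ((hS.strictlyConvex p hp.1 _ hy h1).symm.trans (hS.strictlyConvex q hq.1 _ hy h2))
  -- If the circle lies in T_aS, its points at 0 and π/2 show that x and v are orthogonal to a, so a
  -- would be a tangency point with `rhoSq` equal to 0.
  · rintro rfl ⟨a, haS, hsub⟩
    have h1 : w.base ∈ surfaceTangent S a := hsub ⟨w, rfl, 0, (geodesic_zero _ _).symm⟩
    have h2 : w.vec ∈ surfaceTangent S a :=
      hsub ⟨w, rfl, Real.pi / 2, by simp [UnitTangent.curve, geodesic, cosK, sinK]⟩
    have h3 := hr a ⟨haS, Submodule.subset_span (Or.inr h1), Submodule.subset_span (Or.inr h2)⟩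
    have e1 := hS.smooth.tfun_eq_zero haS h1
    have e2 := hS.smooth.tfun_eq_zero haS h2
    rw [tfun_vec_eq hκ w.isUnitTangent, one_mul] at e2
    rw [rhoSq, e1, e2] at h3
    norm_num at h3

end

/-! ### The differential in the tangent surface, and the change of sign -/

section

variable {κ : ℝ} {S : Set V}

/-! ### The lift of the outer billiard map and its differential -/

/-- The lift of the outer billiard map to unit tangent vectors, in terms of the function that
gives the tangency point. -/
def billiardLift (κ : ℝ) (P : V × V → V) (z : V × V) : V × V :=
  (footRefl κ (P z) z.1 z.2, footVel κ (P z) z.1 z.2)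

theorem contDiffAt_rhoSq {P : V × V → V} {z₀ : V × V} (hP : ContDiffAt ℝ ∞ P z₀) :
    ContDiffAt ℝ ∞ (fun z => tfun κ (P z) z.1) z₀ ∧
    ContDiffAt ℝ ∞ (fun z => bet κ (P z) z.1 z.2) z₀ ∧
    ContDiffAt ℝ ∞ (fun z => rhoSq κ (P z) z.1 z.2) z₀ := by
  have h1 : ContDiffAt ℝ ∞ (fun z : V × V => tfun κ (P z) z.1) z₀ :=
    contDiffAt_tfun hP contDiffAt_fst
  have h2 : ContDiffAt ℝ ∞ (fun z : V × V => bet κ (P z) z.1 z.2) z₀ :=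
    contDiffAt_form (hP.sub (h1.smul contDiffAt_fst)) contDiffAt_snd
  exact ⟨h1, h2, (h1.pow 2).add (contDiffAt_const.mul (h2.pow 2))⟩

theorem contDiffAt_billiardLift {P : V × V → V} {z₀ : V × V} (hP : ContDiffAt ℝ ∞ P z₀)
    (hr : 0 < rhoSq κ (P z₀) z₀.1 z₀.2) : ContDiffAt ℝ ∞ (billiardLift κ P) z₀ := by
  obtain ⟨h1, h2, h3⟩ := contDiffAt_rhoSq (κ := κ) hP
  have h4 : ContDiffAt ℝ ∞ (fun z => rho κ (P z) z.1 z.2) z₀ := h3.sqrt hr.ne'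
  have h5 : ContDiffAt ℝ ∞ (fun z => (rho κ (P z) z.1 z.2)⁻¹) z₀ :=
    h4.inv (Real.sqrt_pos.2 hr).ne'
  have h6 : ContDiffAt ℝ ∞ (fun z => foot κ (P z) z.1 z.2) z₀ :=
    h5.smul ((h1.smul contDiffAt_fst).add (h2.smul contDiffAt_snd))
  have h7 : ContDiffAt ℝ ∞ (fun z => footVel κ (P z) z.1 z.2) z₀ :=
    h5.smul ((h1.smul contDiffAt_snd).sub ((contDiffAt_const.mul h2).smul contDiffAt_fst))
  exact (((contDiffAt_const.mul h4).smul hP).sub h6).prodMk h7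

theorem volumeForm_continuous : Continuous fun z : (V × V) × (V × V) =>
    volumeForm z.1.1 z.1.2 z.2.1 z.2.2 := by
  simp only [volumeForm_eq]
  fun_prop

theorem eventually_outerBilliard_eq (hκ : κ = 0 ∨ κ = 1 ∨ κ = -1)
    (hS : IsQuadraticallyConvex κ S) {n₁ n₂ : V → V} {P₁ P₂ : V × V → V} {z₀ : V × V}
    (hP₁ : ContDiffAt ℝ ∞ P₁ z₀) (hP₂ : ContDiffAt ℝ ∞ P₂ z₀)
    (t₁ : ∀ᶠ z in 𝓝 z₀, P₁ z ∈ S ∧ IsNormal κ S (P₁ z) (n₁ (P₁ z)) ∧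
      lam κ (P₁ z) (n₁ (P₁ z)) z.1 = 0 ∧ lam κ (P₁ z) (n₁ (P₁ z)) z.2 = 0)
    (t₂ : ∀ᶠ z in 𝓝 z₀, P₂ z ∈ S ∧ IsNormal κ S (P₂ z) (n₂ (P₂ z)) ∧
      lam κ (P₂ z) (n₂ (P₂ z)) z.1 = 0 ∧ lam κ (P₂ z) (n₂ (P₂ z)) z.2 = 0)
    (r₁ : 0 < rhoSq κ (P₁ z₀) z₀.1 z₀.2) (r₂ : 0 < rhoSq κ (P₂ z₀) z₀.1 z₀.2)
    (hvol : 0 < volumeForm z₀.1 (P₁ z₀) (P₂ z₀) z₀.2) :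
    ∀ᶠ z in 𝓝 z₀, ∀ h : IsUnitTangent κ z.1 z.2,
      ∃ h' : IsUnitTangent κ (billiardLift κ P₁ z).1 (billiardLift κ P₁ z).2,
        outerBilliard κ S (UnitTangent.mk z.1 z.2 h).toGeodesic =
          (UnitTangent.mk (billiardLift κ P₁ z).1 (billiardLift κ P₁ z).2 h').toGeodesic := by
  have e₁ := (contDiffAt_rhoSq (κ := κ) hP₁).2.2.continuousAt.eventually_const_lt r₁
  have e₂ := (contDiffAt_rhoSq (κ := κ) hP₂).2.2.continuousAt.eventually_const_lt r₂
  have hpair : Filter.Tendsto (fun z : V × V => ((z.1, P₁ z), (P₂ z, z.2))) (𝓝 z₀)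
      (𝓝 ((z₀.1, P₁ z₀), (P₂ z₀, z₀.2))) :=
    ((continuousAt_fst.prodMk hP₁.continuousAt).prodMk
      (hP₂.continuousAt.prodMk continuousAt_snd) :)
  have e₃ := hpair.eventually ((volumeForm_continuous.tendsto _).eventually_const_lt hvol)
  filter_upwards [e₁, e₂, e₃, t₁, t₂] with z r₁ r₂ hz t₁ t₂ h
  exact outerBilliard_eq hκ hS h ((isTangentAt_iff hκ hS.smooth t₁.1 t₁.2.1).2 t₁.2.2)
    ((isTangentAt_iff hκ hS.smooth t₂.1 t₂.2.1).2 t₂.2.2) hz r₁ r₂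

/-- Derivative of the lift when the geodesic turns about x with the tangency point held at p. Here
`rho` depends on s only through s², so it is stationary and only linear terms contribute. The vector
v + s e has unit length only to first order, which suffices because the formulas make sense on all
of V × V. -/
theorem hasDerivAt_billiardLift_rotation {p x v e : V} {C σ : ℝ} (hC : 0 < C)
    (hα : tfun κ p x = C) (hβ : ∀ s : ℝ, bet κ p x (v + s • e) = σ * s) :
    HasDerivAt (fun s : ℝ => (footRefl κ p x (v + s • e), footVel κ p x (v + s • e)))
      (-((C⁻¹ * σ) • v), e - (C⁻¹ * (κ * σ)) • x) 0 := by
  have hline : HasDerivAt (fun s : ℝ => v + s • e) e 0 := by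
    simpa using ((hasDerivAt_id (0 : ℝ)).smul_const e).const_add v
  have hb : HasDerivAt (fun s : ℝ => σ * s) σ 0 := by
    simpa using (hasDerivAt_id (0 : ℝ)).const_mul σ
  have hsq : HasDerivAt (fun s : ℝ => C ^ 2 + κ * (σ * s) ^ 2) 0 0 := by
    have h1 := ((hb.pow 2).const_mul κ).const_add (C ^ 2)
    simpa using h1
  have hρ : HasDerivAt (fun s : ℝ => Real.sqrt (C ^ 2 + κ * (σ * s) ^ 2)) 0 0 := by
    have h1 := hsq.sqrt (by simp [hC.ne'])
    simpa using h1
  have hρ0 : Real.sqrt (C ^ 2 + κ * (σ * 0) ^ 2) = C := by simp [Real.sqrt_sq hC.le]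
  have hρi : HasDerivAt (fun s : ℝ => (Real.sqrt (C ^ 2 + κ * (σ * s) ^ 2))⁻¹) 0 0 := by
    have h1 := hρ.fun_inv (by rw [hρ0]; exact hC.ne')
    simpa using h1
  have e1 : ∀ s : ℝ, rho κ p x (v + s • e) = Real.sqrt (C ^ 2 + κ * (σ * s) ^ 2) := by
    intro s; rw [rho, rhoSq, hα, hβ]
  have hfoot := hρi.smul ((hb.smul hline).const_add (C • x))
  have hvel := hρi.smul ((hline.const_smul C).sub ((hb.const_mul κ).smul_const x))
  have hrefl := ((hρ.const_mul 2).smul_const p).sub hfoot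
  simp only [footRefl, footVel, foot, e1, hα, hβ]
  refine (hrefl.prodMk hvel).congr_deriv ?_
  rw [hρ0]
  ext1
  · simp [smul_smul]
  · simp [smul_smul, smul_sub, hC.ne']

/-- If a geodesic has two tangent surfaces and meets the orientation condition, and the feet of
the perpendiculars from its tangency points lie at positive distance, the outer billiard map is
smooth there and does not preserve the fundamental form. -/
theorem not_preservesForm_of_tangent (hκ : κ = 0 ∨ κ = 1 ∨ κ = -1)
    (hS : IsQuadraticallyConvex κ S) {x v e q : V} {d : ℝ} (hv : IsUnitTangent κ x v)
    (he : IsUnitTangent κ x e) (hev : form κ e v = 0) (hC : 0 < cosK κ d) (hσ : 0 < sinK κ d)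
    (hp : IsTangentAt S (geodesic κ x e d) x v) (hq : IsTangentAt S q x v)
    (hr : ∀ a, IsTangentAt S a x v → 0 < rhoSq κ a x v)
    (hvol : 0 < volumeForm x (geodesic κ x e d) q v) :
    ¬ PreservesForm (outerBilliard κ S) (fun w => omegaCross w) (billiardTable κ S) := by
  set p := geodesic κ x e d with hpdef
  set C := cosK κ d with hCdef
  set σ := sinK κ d with hσdef
  have hpe : p = C • x + σ • e := rfl
  have hpq : p ≠ q := by
    rintro h
    rw [← h] at hvol
    exact hvol.ne' (volumeForm_self _ _ _)
  have hSM := hS.smooth.1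
  have hpM := hSM hp.1
  have fxv := smul_form_base hκ hv.1 hv.tfun_vec
  have tpx : tfun κ p x = C := by
    rw [hpe, tfun_add_left, tfun_smul_left, tfun_smul_left, hv.tfun_base, tfun_comm,
      he.tfun_vec]; ring
  have tpe : tfun κ p e = κ * σ := by
    rw [hpe, tfun_add_left, tfun_smul_left, tfun_smul_left, he.tfun_vec,
      tfun_tangent hκ he.1 he.tfun_vec, he.2.2]; ring
  -- the tangency points of the nearby geodesics
  obtain ⟨n₁, hn₁, hd₁⟩ := hS.definite p hp.1
  obtain ⟨n₂, hn₂, hd₂⟩ := hS.definite q hq.1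
  have hN₁ := hn₁.isNormal_self hp.1
  have l₁ := (isTangentAt_iff hκ hS.smooth hp.1 hN₁).1 hp
  have l₂ := (isTangentAt_iff hκ hS.smooth hq.1 (hn₂.isNormal_self hq.1)).1 hq
  obtain ⟨P₁, hP₁c, hP₁0, hP₁t, hP₁u⟩ := hS.smooth.exists_tangencyPoint hκ hp.1 hn₁ hd₁
    (linearIndependent_of_tangent hκ hS hv hp hq hpq) l₁.1 l₁.2
  obtain ⟨P₂, hP₂c, hP₂0, hP₂t, -⟩ := hS.smooth.exists_tangencyPoint hκ hq.1 hn₂ hd₂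
    (linearIndependent_of_tangent hκ hS hv hq hp hpq.symm) l₂.1 l₂.2
  -- As p and x lie in the tangent hyperplane at p, so does e. Hence moving x or v along e keeps the
  -- tangency point at p.
  have le : lam κ p (n₁ p) e = 0 := by
    have h1 : lam κ p (n₁ p) (C • x + σ • e) = 0 := lam_self hκ hpM hN₁.1
    rw [lam_add, lam_smul, lam_smul, l₁.1, mul_zero, zero_add] at h1
    exact (mul_eq_zero.1 h1).resolve_left hσ.ne'
  obtain ⟨h', -⟩ := outerBilliard_eq hκ hS hv hp hq hvol (hr p hp) (hr q hq)
  set w : UnitTangent κ := ⟨x, v, hv⟩ with hw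
  set w' : UnitTangent κ := ⟨footRefl κ p x v, footVel κ p x v, h'⟩ with hw'
  have hFc : ContDiffAt ℝ ∞ (billiardLift κ P₁) (w.base, w.vec) :=
    contDiffAt_billiardLift hP₁c (by rw [hP₁0]; exact hr p hp)
  have hF0 : billiardLift κ P₁ (w.base, w.vec) = (w'.base, w'.vec) := by
    simp only [billiardLift, hw, hP₁0, hw']
  have hlift : ∀ᶠ z in 𝓝 (w.base, w.vec), ∀ h : IsUnitTangent κ z.1 z.2,
      ∃ h' : IsUnitTangent κ (billiardLift κ P₁ z).1 (billiardLift κ P₁ z).2,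
        outerBilliard κ S (UnitTangent.mk z.1 z.2 h).toGeodesic =
          (UnitTangent.mk (billiardLift κ P₁ z).1 (billiardLift κ P₁ z).2 h').toGeodesic :=
    eventually_outerBilliard_eq hκ hS hP₁c hP₂c hP₁t hP₂t (by rw [hP₁0]; exact hr p hp)
      (by rw [hP₂0]; exact hr q hq) (by rw [hP₁0, hP₂0]; exact hvol)
  -- derivatives along curves of geodesics in the tangent surface at `p`
  set D := fderiv ℝ (billiardLift κ P₁) (w.base, w.vec) with hD
  have hDc : ∀ (c : ℝ → V × V) (c' y : V × V) (b : ℝ → V × V), HasDerivAt c c' 0 →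
      c 0 = (x, v) → (∀ᶠ s in 𝓝 0, lam κ p (n₁ p) (c s).1 = 0 ∧ lam κ p (n₁ p) (c s).2 = 0) →
      (∀ᶠ s in 𝓝 0, (footRefl κ p (c s).1 (c s).2, footVel κ p (c s).1 (c s).2) = b s) →
      HasDerivAt b y 0 → D c' = y := by
    intro c c' y b hc hc0 hl hb hby
    have h1 : HasDerivAt (fun s => billiardLift κ P₁ (c s)) (D c') 0 := by
      have h2 : HasFDerivAt (billiardLift κ P₁) D (c 0) := by
        rw [hc0]; exact (hFc.differentiableAt (by simp)).hasFDerivAt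
      exact h2.comp_hasDerivAt 0 hc
    have h2 : (fun s => billiardLift κ P₁ (c s)) =ᶠ[𝓝 0] b := by
      have h3 := hc.continuousAt.eventually (hc0 ▸ hP₁u)
      filter_upwards [hl, hb, h3] with s hs hs' h3
      rw [← hs', billiardLift, h3 hs.1 hs.2]
    exact h1.unique (hby.congr_of_eventuallyEq h2)
  -- The flow stays in the tangent surface, and the foot formulas are constant along it.
  have hflow : D (w.vec, -(κ • w.base)) = 0 := by
    refine hDc (fun s => (geodesic κ x v s, geodesicVel κ x v s)) _ 0
      (fun _ => (footRefl κ p x v, footVel κ p x v)) ?_ ?_ ?_ ?_ (hasDerivAt_const _ _)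
    · have h1 := hasDerivAt_geodesic hκ x v 0
      rw [geodesicVel_zero] at h1
      have h2 : HasDerivAt (geodesicVel κ x v) (-(κ • x)) 0 := by
        have h3 := ((hasDerivAt_cosK hκ 0).smul_const v).sub
          (((hasDerivAt_sinK hκ 0).const_mul κ).smul_const x)
        simp only [sinK_zero, cosK_zero, mul_zero, neg_zero, zero_smul, zero_sub, mul_one] at h3
        exact h3
      exact h1.prodMk h2
    · simp only [geodesic_zero, geodesicVel_zero]
    · refine Filter.Eventually.of_forall fun s => ⟨?_, ?_⟩
      · rw [lam_geodesic, l₁.1, l₁.2]; ring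
      · rw [lam_geodesicVel, l₁.1, l₁.2]; ring
    · refine Filter.Eventually.of_forall fun s => ?_
      simp only [footRefl_flow hκ hpM hv, footVel_flow hκ hpM hv]
  have hα : tfun κ p x = C := tpx
  have hβ : bet κ p x v = 0 := by
    rw [bet, tpx, hpe, add_sub_cancel_left, form_smul_left, hev, mul_zero]
  have hbase := sq_of_bet_eq_zero hβ (by rw [hα]; exact hC)
  set x' := (2 * C) • p - x with hx'
  have hb1 : w'.base = x' := by
    change footRefl κ p x v = x'
    rw [footRefl, hbase.1, hbase.2.1, hα]
  have hb2 : w'.vec = v := hbase.2.2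
  -- Displacement of x along e, which need only be tangent to M_κ. Since `bet` stays 0, the foot
  -- formula keeps returning the base point.
  have hD1 : D (e, 0) = ((2 * (κ * σ)) • p - e, 0) := by
    refine hDc (fun s => (x + s • e, v)) _ _
      (fun s => ((2 * (C + s * (κ * σ))) • p - (x + s • e), v)) ?_ ?_ ?_ ?_ ?_
    · have h1 : HasDerivAt (fun s : ℝ => x + s • e) e 0 := by
        simpa using ((hasDerivAt_id (0 : ℝ)).smul_const e).const_add x
      exact h1.prodMk (hasDerivAt_const _ _)
    · simp
    · refine Filter.Eventually.of_forall fun s => ⟨?_, l₁.2⟩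
      rw [lam_add, lam_smul, l₁.1, le]; ring
    · have h1 : ContinuousAt (fun s : ℝ => C + s * (κ * σ)) 0 := by fun_prop
      filter_upwards [h1.eventually_const_lt (u := 0) (by simpa using hC)] with s hs
      have h2 : tfun κ p (x + s • e) = C + s * (κ * σ) := by
        rw [tfun_add, tfun_smul, tpx, tpe]
      have h3 : bet κ p (x + s • e) v = 0 := by
        rw [bet, h2, form_sub_left, form_smul_left, hpe, form_add, form_add, form_smul_left,
          form_smul_left, form_smul_left, hev]
        linear_combination -s * σ * fxv
      obtain ⟨k1, k2, k3⟩ := sq_of_bet_eq_zero h3 (by rw [h2]; exact hs)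
      simp only [footRefl, k1, k2, k3, h2]
    · have h1 : HasDerivAt (fun s : ℝ => (2 * (C + s * (κ * σ)))) (2 * (κ * σ)) 0 := by
        simpa using (((hasDerivAt_id (0 : ℝ)).mul_const (κ * σ)).const_add C).const_mul 2
      have h2 : HasDerivAt (fun s : ℝ => x + s • e) e 0 := by
        simpa using ((hasDerivAt_id (0 : ℝ)).smul_const e).const_add x
      exact ((h1.smul_const p).sub h2).prodMk (hasDerivAt_const _ _)
  have hD2 : D (0, e) = (-((C⁻¹ * σ) • v), e - (C⁻¹ * (κ * σ)) • x) := by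
    refine hDc (fun s => (x, v + s • e)) _ _ _ ?_ ?_ ?_ (Filter.Eventually.of_forall fun s => rfl)
      (hasDerivAt_billiardLift_rotation hC hα ?_)
    · have h1 : HasDerivAt (fun s : ℝ => v + s • e) e 0 := by
        simpa using ((hasDerivAt_id (0 : ℝ)).smul_const e).const_add v
      exact (hasDerivAt_const _ _).prodMk h1
    · simp
    · refine Filter.Eventually.of_forall fun s => ⟨l₁.1, ?_⟩
      rw [lam_add, lam_smul, l₁.2, le]; ring
    · intro s
      rw [bet, tpx, hpe, add_sub_cancel_left, form_smul_left, form_add_right, form_smul_right,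
        hev, he.2.2]
      ring
  -- the transported unit vector
  set e' := e - (2 * (κ * σ)) • p with he'
  have hUT' : IsUnitTangent κ x' e' := by
    have h1 := isUnitTangent_flow hκ he (2 * d)
    have h2 : geodesic κ x e (2 * d) = x' := geodesic_two_mul hκ x e d
    have h3 : geodesicVel κ x e (2 * d) = e' := by
      rw [geodesicVel, two_mul, cosK_add hκ, sinK_add hκ, he', hpe, hCdef, hσdef]
      have h4 := cosK_sq_add hκ d
      funext i
      simp only [Pi.add_apply, Pi.sub_apply, Pi.smul_apply, smul_eq_mul]
      linear_combination e i * h4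
    rwa [h2, h3] at h1
  have hw'UT : IsUnitTangent κ x' v := by
    have := w'.isUnitTangent
    rwa [hb1, hb2] at this
  have hev' : form κ e' v = 0 := by
    rw [he', hpe, form_sub_left, form_smul_left, form_add, form_smul_left, form_smul_left, hev]
    linear_combination -2 * σ * C * fxv
  have t1 : tanProj κ x' v e' = e' := tanProj_eq_self hUT'.tfun_vec hev'
  have t2 : tanProj κ x' v v = 0 := by
    rw [tanProj_apply, hw'UT.tfun_vec, zero_smul, sub_zero, hw'UT.2.2, one_smul, sub_self]
  have t3 : tanProj κ x' v x' = 0 := by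
    rw [tanProj_apply, hw'UT.tfun_base, one_smul, sub_self, form_zero_right, zero_smul, sub_self]
  intro hpres
  have hdiff := exists_hasDifferential hκ hFc hF0 hlift hflow
  set L := (ofInitialData w').comp
      ((fderiv ℝ (billiardLift κ P₁) (w.base, w.vec) : V × V →ₗ[ℝ] V × V).comp
        (initialData hκ w)) with hL
  -- The two test fields: displacement along e and rotation about x.
  have hI : (fun r => cosK κ r • ((1 : ℝ) • e)) ∈ jacobiFields w :=
    ⟨e, 0, he.tfun_vec, hev, Submodule.zero_mem _, form_zero_left _, by
      funext r; simp⟩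
  have hJ : (fun r => sinK κ r • e) ∈ jacobiFields w :=
    ⟨0, e, Submodule.zero_mem _, form_zero_left _, he.tfun_vec, hev, by
      funext r; simp⟩
  have key := hpres w w' L (mem_billiardTable hκ hS hp hq hpq hr) hdiff ⟨_, hI⟩ ⟨_, hJ⟩
  have hI0 : initialData hκ w ⟨_, hI⟩ = (e, 0) := by
    change ((fun r => cosK κ r • ((1 : ℝ) • e)) 0, deriv (fun r => cosK κ r • ((1 : ℝ) • e)) 0) = _
    have h1 := (hasDerivAt_jacobi hκ ((1 : ℝ) • e) 0).deriv
    simp only [smul_zero, add_zero] at h1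
    rw [h1]; simp
  have hJ0 : initialData hκ w ⟨_, hJ⟩ = (0, e) := by
    change ((fun r => sinK κ r • e) 0, deriv (fun r => sinK κ r • e) 0) = _
    have h1 := (hasDerivAt_jacobi hκ 0 e).deriv
    simp only [smul_zero, zero_add] at h1
    rw [h1]; simp
  -- The mirror image moves backwards; this sign, which has no counterpart in `hLJ`, reverses the
  -- value of the form.
  have hLI : ((L ⟨_, hI⟩ : jacobiFields w') : ℝ → V) = fun r => cosK κ r • ((-1 : ℝ) • e') := by
    have h1 : L ⟨_, hI⟩ = ofInitialData w' (D (e, 0)) := by rw [← hI0]; rfl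
    rw [h1, hD1]
    change (fun r => cosK κ r • tanProj κ w'.base w'.vec ((2 * (κ * σ)) • p - e)
      + sinK κ r • tanProj κ w'.base w'.vec 0) = _
    rw [hb1, hb2, show (2 * (κ * σ)) • p - e = -e' by rw [he', neg_sub], map_neg, t1, map_zero]
    funext r; simp
  have hLJ : ((L ⟨_, hJ⟩ : jacobiFields w') : ℝ → V) = fun r => sinK κ r • e' := by
    have h1 : L ⟨_, hJ⟩ = ofInitialData w' (D (0, e)) := by rw [← hJ0]; rfl
    rw [h1, hD2]
    change (fun r => cosK κ r • tanProj κ w'.base w'.vec (-((C⁻¹ * σ) • v))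
      + sinK κ r • tanProj κ w'.base w'.vec (e - (C⁻¹ * (κ * σ)) • x)) = _
    -- Modulo x' and v, which the projection removes, the image of the rotation field has initial
    -- derivative e'.
    have h2 : e - (C⁻¹ * (κ * σ)) • x = e' + (C⁻¹ * (κ * σ)) • x' := by
      rw [he', hx', smul_sub, smul_smul,
        show C⁻¹ * (κ * σ) * (2 * C) = 2 * (κ * σ) by field_simp]
      abel
    rw [hb1, hb2, h2, map_neg, map_smul, t2, map_add, map_smul, t1, t3]
    funext r; simp
  have k1 : omegaCross w ⟨_, hI⟩ ⟨_, hJ⟩ = _ :=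
    omegaCross_eq hκ he.tfun_vec hev he.2.2 rfl rfl
  have k2 : omegaCross w' (L ⟨_, hI⟩) (L ⟨_, hJ⟩) = _ :=
    omegaCross_eq hκ (by rw [hb1]; exact hUT'.tfun_vec) (by rw [hb2]; exact hev') hUT'.2.2
      hLI hLJ
  replace key := k2.symm.trans (key.trans k1)
  norm_num at key

/-- The geodesic leaves x = γ(-d) in the direction v, where γ starts at p with velocity e and e, v
are orthonormal in T_pS. It lies in the surface tangent at p, and the perpendicular from p meets it
at x. The bound d < 1 keeps c_κ(d) and s_κ(d) positive. -/
theorem not_preservesForm (hκ : κ = 0 ∨ κ = 1 ∨ κ = -1) (hS : IsQuadraticallyConvex κ S) :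
    ¬ PreservesForm (outerBilliard κ S) (fun w => omegaCross w) (billiardTable κ S) := by
  obtain ⟨p, hp⟩ := hS.connected.nonempty
  have hpM := hS.smooth.1 hp
  obtain ⟨e, he, v, hv, hee, hvv, hev⟩ := hS.smooth.exists_orthonormal hκ hp
  have het := hS.smooth.tfun_eq_zero hp he
  have hvt := hS.smooth.tfun_eq_zero hp hv
  have heU : IsUnitTangent κ p e := ⟨hpM, het, hee⟩
  have hvU : ∀ d, IsUnitTangent κ (geodesic κ p e (-d)) v := fun d => by
    refine ⟨(isUnitTangent_flow hκ heU _).1, ?_, hvv⟩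
    rw [mem_tangentSpace_iff, tfun_comm, tfun_geodesic, tfun_comm v p, hvt, tfun_comm,
      tfun_tangent hκ hpM het, hev]
    ring
  obtain ⟨d, hd0, hd1, hr⟩ := hS.exists_close hκ hp e v hvU
  have heU' := isUnitTangent_flow hκ heU (-d)
  have hxv := hvU d
  have hend : geodesic κ (geodesic κ p e (-d)) (geodesicVel κ p e (-d)) d = p := by
    rw [geodesic_geodesic hκ, neg_add_cancel, geodesic_zero]
  have hev' : form κ (geodesicVel κ p e (-d)) v = 0 := by
    rw [form_comm, form_geodesicVel, form_comm v e, hev, form_comm v p]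
    linear_combination -sinK κ (-d) * smul_form_base hκ hpM hvt
  have hC : 0 < cosK κ d := by
    simp only [cosK]
    split_ifs
    · exact one_pos
    · exact Real.cos_pos_of_mem_Ioo ⟨by linarith [Real.pi_gt_three], by linarith [Real.pi_gt_three]⟩
    · exact Real.cosh_pos d
  have hσ : 0 < sinK κ d := by
    simp only [sinK]
    split_ifs
    · exact hd0
    · exact Real.sin_pos_of_pos_of_lt_pi hd0 (by linarith [Real.pi_gt_three])
    · exact Real.sinh_pos_iff.2 hd0
  have hpT : IsTangentAt S p (geodesic κ p e (-d)) v :=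
    ⟨hp, Submodule.add_mem _ (Submodule.smul_mem _ _ (Submodule.subset_span (Or.inl rfl)))
      (Submodule.smul_mem _ _ (Submodule.subset_span (Or.inr he))),
      Submodule.subset_span (Or.inr hv)⟩
  set x := geodesic κ p e (-d) with hx
  set E := geodesicVel κ p e (-d) with hE
  -- The auxiliary functional has kernel normal to the perpendicular at x, so it kills x and v and
  -- takes the value s_κ(d) > 0 at p.
  obtain ⟨q, hq, hqp⟩ := hS.exists_second_tangencyPoint hκ hpT (lamL κ x E)
    (by rw [lamL_apply]; exact lam_self hκ hxv.1 heU'.tfun_vec)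
    (by rw [lamL_apply, lam_tangent hκ hxv.1 hxv.tfun_vec]; exact hev')
    (by
      rw [lamL_apply, ← hend, lam_geodesic, lam_self hκ hxv.1 heU'.tfun_vec,
        lam_tangent hκ hxv.1 heU'.tfun_vec, heU'.2.2, mul_zero, zero_add, mul_one]
      exact hσ)
  have hneg : ∀ {a}, IsTangentAt S a x (-v) ↔ IsTangentAt S a x v := by
    intro a
    rw [IsTangentAt, IsTangentAt, Submodule.neg_mem_iff]
  -- Reversing v changes the sign of the volume and leaves tangency and `rhoSq` unchanged, so p can
  -- always be made the tangency point labelled +.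
  rcases lt_or_gt_of_ne (volumeForm_ne_zero hκ hS hxv hpT hq hqp.symm) with h | h
  · refine not_preservesForm_of_tangent hκ hS (q := q) hxv.neg heU'
      (by rw [form_neg_right, hev', neg_zero]) hC hσ (hneg.2 (by rw [hend]; exact hpT))
      (hneg.2 hq) (fun a ha => ?_) ?_
    · have h1 := hr a (hneg.1 ha)
      rw [rhoSq, bet, form_neg_right, neg_sq]
      exact h1
    · rw [hend]
      have : volumeForm x p q (-v) = -volumeForm x p q v := by
        simp only [volumeForm_eq, Pi.neg_apply]; ring
      linarith
  · exact not_preservesForm_of_tangent hκ hS (q := q) hxv heU' hev' hC hσ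
      (by rw [hend]; exact hpT) hq hr (by rw [hend]; exact h)

end

end OuterBilliard

end

theorem mainTheorem4 (κ : ℝ) (hκ : κ = 0 ∨ κ = 1 ∨ κ = -1) (S : Set OuterBilliard.V)
    (hS : OuterBilliard.IsQuadraticallyConvex κ S) :
    ¬ OuterBilliard.PreservesForm (OuterBilliard.outerBilliard κ S)
      (fun w => OuterBilliard.omegaCross w) (OuterBilliard.billiardTable κ S) :=
  OuterBilliard.not_preservesForm hκ hS
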